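/- Let $k$ be a commutative ring, $\delta\in k$, and let $0\le i\le m$ be integers. A *Brauer partition* in $J(m,n)$ is a partition into pairs of the set $\{1,\dots,m\}\cup\{1',\dots,n'\}$ of top and bottom vertices. The *Brauer algebra* $B_m$ is the free $k$-module on $J(m,m)$ with the product $p*q=\delta^{c}\,r$, where $r$ is the partition and $c$ the number of closed loops obtained by drawing $p$ above $q$. Let $\sigma_j\in J(m,m)$ have the pairs $\{j,(j+1)'\},\{j+1,j'\}$ and $\{a,a'\}$ for $a\ne j,j+1$, and let $U_j\in J(m,m)$ have the pairs $\{j,j+1\},\{j',(j+1)'\}$ and $\{a,a'\}$ for $a\neq j,j+1$ $(1\le j\le m-1)$. Let $B_{i+1,i+1,m}$ be the (unital) subalgebra of $B_m$ generated by the $\sigma_j$ with $j\le i$ and the $U_j$ with $j>i$ (where $1\le j\le m-1$ throughout). *Height.* A picture of $p\in J(m,n)$ is a drawing of $p$ by lines (closed loops allowed) in a rectangle, with the vertices $1,\dots,m$ on the top edge and $1',\dots,n'$ on the bottom edge, in general position with respect to the vertical direction: from top to bottom it is a finite stack of horizontal layers, each containing vertical lines and exactly one transversal crossing of two neighbouring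 lines, one local minimum or one local maximum. The height of a crossing point is the least number of lines crossed by a path in the rectangle that runs from this point to the left edge and avoids all other crossing points (the two lines through the starting point are not counted at the start). The height of a picture is the maximum of the heights of its crossing points, or $-1$ if there are none, and the height of $p$ is the minimum of the heights of its pictures. *Chains.* Order the vertices by the disk order $1<2<\dots<m<n'<\dots<2'<1'$. A chain in $p$ is a non-empty sequence of pairs $\{l_1,r_1\},\{l_2,r_2\},\dots,\{l_s,r_s\}$ of $p$ with $l_t<r_t$ for all $t$ and $l_t<l_{t+1}<r_t<r_{t+1}$ for $1\le t<s$; it starts at $l_1$ and ends at $r_s$, and its link regions are the disk intervals $[l_{t+1},r_t]$, $1\le t<s$. Two chains are exclusive if they have no pair in common and every link region of one is disjoint from every link region of the other. The partition $p$ is $Li$-chain if it contains $i$ pairwise exclusive chains that start at the vertices $1,\dots,i$ and end in $\{1',\dots,i'\}$. Let $J^i_{\le i-1}(m,m)$ be the set of $Li$-chain partitions in $J(m,m)$ of height at most $i-1$. **Theorem.** As $k$-submodules of $B_m$, $$B_{i+1,i+1,m}\;=\;k\,J^i_{\le i-1}(m,m).$$ In particular the span $kJ^i_{\leq i-1}(m,m)$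 is a subalgebra of $B_m$, and $J^i_{\le i-1}(m,m)$ is a $k$-basis of $B_{i+1,i+1,m}$. -/

import Mathlib

namespace Brauer

/-! ### Equivalence relations: gluing and closed components -/

section Gluing

variable {X Y Z W O : Type}

/-- The number of classes of `S` that contain no point `o y`. -/
noncomputable def freeClasses (S : Setoid X) (o : O → X) : ℕ :=
  Nat.card {c : Quotient S // ∀ y, Quotient.mk S (o y) ≠ c}

theorem map_le_iff (r : Setoid X) (f : X → Y) (s : Setoid Y) :
    r.map f ≤ s ↔ ∀ x y, r x y → s (f x) (f y) := by
  constructor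
  · intro h x y hxy
    exact h (Relation.EqvGen.rel _ _ ⟨x, y, hxy, rfl, rfl⟩)
  · intro h
    refine Setoid.eqvGen_le ?_
    rintro _ _ ⟨x, y, hxy, rfl, rfl⟩
    exact h x y hxy

theorem map_rel (r : Setoid X) (f : X → Y) {x y : X} (h : r x y) : r.map f (f x) (f y) :=
  (map_le_iff r f _).1 le_rfl x y h

theorem map_map (r : Setoid X) (f : X → Y) (g : Y → Z) :
    (r.map f).map g = r.map (g ∘ f) := by
  apply le_antisymm
  · rw [map_le_iff]
    intro x y h
    have : r.map f ≤ (r.map (g ∘ f)).comap g := by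
      rw [map_le_iff]
      intro x y h
      exact map_rel r (g ∘ f) h
    exact this h
  · rw [map_le_iff]
    intro x y h
    exact map_rel _ g (map_rel r f h)

theorem map_sup (r s : Setoid X) (f : X → Y) : (r ⊔ s).map f = r.map f ⊔ s.map f := by
  apply le_antisymm
  · have : r ⊔ s ≤ (r.map f ⊔ s.map f).comap f :=
      sup_le (fun x y h => (le_sup_left : r.map f ≤ _) (map_rel r f h))
        (fun x y h => (le_sup_right : s.map f ≤ _) (map_rel s f h))
    rw [map_le_iff]
    exact fun x y h => this h
  · refine sup_le ?_ ?_ <;> rw [map_le_iff] <;> intro x y h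
    · exact map_rel _ f ((le_sup_left : r ≤ r ⊔ s) h)
    · exact map_rel _ f ((le_sup_right : s ≤ r ⊔ s) h)

theorem map_inj_iff (r : Setoid X) {f : X → Y} (hf : Function.Injective f) (u v : Y) :
    r.map f u v ↔ u = v ∨ ∃ x y, f x = u ∧ f y = v ∧ r x y := by
  have h := Setoid.coe_map_of_ker_le r f (by rw [Setoid.ker_eq_bot_iff.2 hf]; exact bot_le)
  have h2 : r.map f u v ↔ (Relation.Map r f f ⊔ (· = ·)) u v := by rw [← h]
  rw [h2]
  constructor
  · rintro (⟨x, y, h, rfl, rfl⟩ | h)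
    · exact Or.inr ⟨x, y, rfl, rfl, h⟩
    · exact Or.inl h
  · rintro (h | ⟨x, y, rfl, rfl, h⟩)
    · exact Or.inr h
    · exact Or.inl ⟨x, y, h, rfl, rfl⟩

/-- Passing to the points `f y` first: relations `s` living on these points can be added after
restriction. -/
theorem comap_sup_map (E : Setoid X) (f : Y → X) (s : Setoid Y) :
    (E ⊔ s.map f).comap f = E.comap f ⊔ s := by
  apply le_antisymm
  · -- the relation on `X` generated by `E` and by the equivalence generated on `Y`
    let F : Setoid Y := E.comap f ⊔ s
    have key : ∀ u v, (E ⊔ s.map f) u v →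
        (E u v ∨ ∃ y y', E u (f y) ∧ F y y' ∧ E (f y') v) := by
      intro u v h
      rw [Setoid.sup_eq_eqvGen] at h
      change Relation.EqvGen _ u v at h
      have hE : ∀ y y', E (f y) (f y') → F y y' := fun y y' h =>
        (le_sup_left : E.comap f ≤ F) h
      have tr : ∀ u v w, (E u v ∨ ∃ y y', E u (f y) ∧ F y y' ∧ E (f y') v) →
          (E v w ∨ ∃ y y', E v (f y) ∧ F y y' ∧ E (f y') w) →
          (E u w ∨ ∃ y y', E u (f y) ∧ F y y' ∧ E (f y') w) := by
        rintro u v w (h1 | ⟨a, b, h1, h2, h3⟩) (h4 | ⟨c, d, h4, h5, h6⟩)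
        · exact Or.inl (E.trans' h1 h4)
        · exact Or.inr ⟨c, d, E.trans' h1 h4, h5, h6⟩
        · exact Or.inr ⟨a, b, h1, h2, E.trans' h3 h4⟩
        · exact Or.inr ⟨a, d, h1, F.trans' h2 (F.trans' (hE _ _ (E.trans' h3 h4)) h5), h6⟩
      have sy : ∀ u v, (E u v ∨ ∃ y y', E u (f y) ∧ F y y' ∧ E (f y') v) →
          (E v u ∨ ∃ y y', E v (f y) ∧ F y y' ∧ E (f y') u) := by
        rintro u v (h1 | ⟨a, b, h1, h2, h3⟩)
        · exact Or.inl (E.symm' h1)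
        · exact Or.inr ⟨b, a, E.symm' h3, F.symm' h2, E.symm' h1⟩
      induction h with
      | rel u v h =>
        rcases h with h | h
        · exact Or.inl h
        · change Relation.EqvGen _ u v at h
          induction h with
          | rel u v h =>
            obtain ⟨y, y', h, rfl, rfl⟩ := h
            exact Or.inr ⟨y, y', E.refl' _, (le_sup_right : s ≤ F) h, E.refl' _⟩
          | refl u => exact Or.inl (E.refl' u)
          | symm u v _ ih => exact sy _ _ ih
          | trans u v w _ _ ih1 ih2 => exact tr _ _ _ ih1 ih2
      | refl u => exact Or.inl (E.refl' u)
      | symm u v _ ih => exact sy _ _ ih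
      | trans u v w _ _ ih1 ih2 => exact tr _ _ _ ih1 ih2
    intro y y' h
    have hE : ∀ y y', E (f y) (f y') → F y y' := fun y y' h =>
      (le_sup_left : E.comap f ≤ F) h
    rcases key _ _ h with h | ⟨a, b, h1, h2, h3⟩
    · exact hE _ _ h
    · exact F.trans' (hE _ _ h1) (F.trans' h2 (hE _ _ h3))
  · refine sup_le (fun x y h => (le_sup_left : E ≤ E ⊔ s.map f) h) (fun x y h => ?_)
    exact (le_sup_right : s.map f ≤ E ⊔ s.map f) (map_rel s f h)

/-- A class of `E ⊔ s.map f` missing all `f y` is a class of `E`. -/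
theorem sup_map_of_free (E : Setoid X) (f : Y → X) (s : Setoid Y) {u v : X}
    (hu : ∀ y, ¬ E u (f y)) (h : (E ⊔ s.map f) u v) : E u v := by
  let G : Setoid X :=
    { r := fun a b => E a b ∨ ((∃ y, E a (f y)) ∧ (∃ y, E b (f y)))
      iseqv := ⟨fun a => Or.inl (E.refl' a), by
          rintro a b (h | ⟨h1, h2⟩)
          · exact Or.inl (E.symm' h)
          · exact Or.inr ⟨h2, h1⟩, by
          rintro a b c (h | ⟨h1, y, h2⟩) (h' | ⟨⟨z, h3⟩, h4⟩)
          · exact Or.inl (E.trans' h h')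
          · exact Or.inr ⟨⟨z, E.trans' h h3⟩, h4⟩
          · exact Or.inr ⟨h1, y, E.trans' (E.symm' h') h2⟩
          · exact Or.inr ⟨h1, h4⟩⟩ }
  have hG : E ⊔ s.map f ≤ G := by
    refine sup_le (fun a b h => Or.inl h) ?_
    rw [map_le_iff]
    intro y y' _
    exact Or.inr ⟨⟨y, E.refl' _⟩, ⟨y', E.refl' _⟩⟩
  rcases hG h with h | ⟨⟨y, h⟩, _⟩
  · exact h
  · exact absurd h (hu y)

theorem freeClasses_sup_map [Finite X] [Finite Y] (E : Setoid X) (f : Y → X) (s : Setoid Y)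
    (o : O → Y) :
    freeClasses (E ⊔ s.map f) (f ∘ o)
      = freeClasses E f + freeClasses (E.comap f ⊔ s) o := by
  classical
  unfold freeClasses
  rw [← Nat.card_sum]
  have hcm := comap_sup_map E f s
  have hrel : ∀ y y', (E.comap f ⊔ s) y y' ↔ (E ⊔ s.map f) (f y) (f y') := by
    intro y y'
    rw [← hcm]
    rfl
  let g : {c : Quotient E // ∀ y, Quotient.mk E (f y) ≠ c} ⊕
      {c : Quotient (E.comap f ⊔ s) // ∀ y, Quotient.mk _ (o y) ≠ c} →
      {c : Quotient (E ⊔ s.map f) // ∀ y, Quotient.mk _ ((f ∘ o) y) ≠ c} := fun z =>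
    match z with
    | Sum.inl c => ⟨Quotient.map' id (fun a b h => (le_sup_left : E ≤ E ⊔ s.map f) h) c.1, by
        obtain ⟨c, hc⟩ := c
        induction c using Quotient.inductionOn with
        | h x =>
          intro y hy
          have h1 : (E ⊔ s.map f) x (f (o y)) :=
            (E ⊔ s.map f).symm' (Quotient.exact hy)
          have h2 := sup_map_of_free E f s
            (fun y hxy => hc y (Quotient.sound (E.symm' hxy))) h1
          exact hc _ (Quotient.sound (E.symm' h2))⟩
    | Sum.inr c => ⟨Quotient.map' f (fun a b h => (hrel a b).1 h) c.1, by
        obtain ⟨c, hc⟩ := c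
        induction c using Quotient.inductionOn with
        | h x =>
          intro y hy
          exact hc y (Quotient.sound ((hrel _ _).2 (Quotient.exact hy)))⟩
  refine (Nat.card_congr (Equiv.ofBijective g ⟨?_, ?_⟩)).symm
  · rintro (⟨c, hc⟩ | ⟨c, hc⟩) (⟨d, hd⟩ | ⟨d, hd⟩) h
    · induction c using Quotient.inductionOn with
      | h x =>
      induction d using Quotient.inductionOn with
      | h x' =>
      have h1 : (E ⊔ s.map f) x x' := Quotient.exact (congrArg Subtype.val h)
      have h2 := sup_map_of_free E f s
            (fun y hxy => hc y (Quotient.sound (E.symm' hxy))) h1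
      congr 2
      exact Quotient.sound h2
    · induction c using Quotient.inductionOn with
      | h x =>
      induction d using Quotient.inductionOn with
      | h x' =>
      have h1 : (E ⊔ s.map f) x (f x') := Quotient.exact (congrArg Subtype.val h)
      have h2 := sup_map_of_free E f s
            (fun y hxy => hc y (Quotient.sound (E.symm' hxy))) h1
      exact absurd (Quotient.sound (E.symm' h2)) (hc x')
    · induction c using Quotient.inductionOn with
      | h x =>
      induction d using Quotient.inductionOn with
      | h x' =>
      have h1 : (E ⊔ s.map f) (f x) x' := Quotient.exact (congrArg Subtype.val h)
      have h2 := sup_map_of_free E f s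
            (fun y hxy => hd y (Quotient.sound (E.symm' hxy))) ((E ⊔ s.map f).symm' h1)
      exact absurd (Quotient.sound (E.symm' h2)) (hd x)
    · induction c using Quotient.inductionOn with
      | h x =>
      induction d using Quotient.inductionOn with
      | h x' =>
      have h1 : (E ⊔ s.map f) (f x) (f x') := Quotient.exact (congrArg Subtype.val h)
      congr 2
      exact Quotient.sound ((hrel _ _).2 h1)
  · rintro ⟨c, hc⟩
    induction c using Quotient.inductionOn with
    | h x =>
    by_cases hx : ∃ y, (E ⊔ s.map f) x (f y)
    · obtain ⟨y, hy⟩ := hx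
      refine ⟨Sum.inr ⟨Quotient.mk _ y, ?_⟩, Subtype.ext (Quotient.sound ?_)⟩
      · intro z hz
        apply hc z
        exact Quotient.sound ((E ⊔ s.map f).trans' ((hrel _ _).1 (Quotient.exact hz))
          ((E ⊔ s.map f).symm' hy))
      · exact (E ⊔ s.map f).symm' hy
    · refine ⟨Sum.inl ⟨Quotient.mk _ x, ?_⟩, Subtype.ext (Quotient.sound ?_)⟩
      · intro z hz
        exact hx ⟨z, (le_sup_left : E ≤ _) (E.symm' (Quotient.exact hz))⟩
      · exact (E ⊔ s.map f).refl' x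

/-- Base change along a pullback square of injections. -/
theorem comap_map_square (G : Setoid Z) {h : Z → X} {f : Y → X} {i : W → Y} {g : W → Z}
    (hh : Function.Injective h) (hf : Function.Injective f)
    (hsq : ∀ w, h (g w) = f (i w))
    (hpb : ∀ z y, h z = f y → ∃ w, g w = z ∧ i w = y) :
    (G.map h).comap f = (G.comap g).map i := by
  apply le_antisymm
  · intro y y' hy
    rcases (map_inj_iff G hh _ _).1 hy with e | ⟨z, z', h1, h2, h3⟩
    · rw [hf e]
    · obtain ⟨w, rfl, rfl⟩ := hpb _ _ h1
      obtain ⟨w', rfl, rfl⟩ := hpb _ _ h2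
      exact map_rel (G.comap g) i h3
  · rw [map_le_iff]
    intro w w' hw
    change G.map h (f (i w)) (f (i w'))
    rw [← hsq, ← hsq]
    exact map_rel G h hw

theorem freeClasses_map (G : Setoid Z) {h : Z → X} {f : Y → X} {i : W → Y} {g : W → Z}
    (hh : Function.Injective h)
    (hsq : ∀ w, h (g w) = f (i w))
    (hpb : ∀ z y, h z = f y → ∃ w, g w = z ∧ i w = y)
    (hcov : ∀ x, (∃ z, h z = x) ∨ ∃ y, f y = x) :
    freeClasses (G.map h) f = freeClasses G g := by
  unfold freeClasses
  have hG : ∀ z z', G.map h (h z) (h z') ↔ G z z' := by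
    intro z z'
    have := Setoid.comap_map_eq h G hh
    exact ⟨fun k => by rw [← this]; exact k, fun k => map_rel G h k⟩
  symm
  let e : {c : Quotient G // ∀ y, Quotient.mk G (g y) ≠ c} →
      {c : Quotient (G.map h) // ∀ y, Quotient.mk _ (f y) ≠ c} := fun c =>
    ⟨Quotient.map' h (fun a b k => map_rel G h k) c.1, by
      obtain ⟨c, hc⟩ := c
      induction c using Quotient.inductionOn with
      | h z =>
      intro y hy
      have h1 : G.map h (f y) (h z) := Quotient.exact hy
      rcases (map_inj_iff G hh _ _).1 h1 with e | ⟨a, b, h2, h3, h4⟩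
      · obtain ⟨w, rfl, rfl⟩ := hpb _ _ e.symm
        exact hc w rfl
      · obtain ⟨w, rfl, rfl⟩ := hpb _ _ h2
        rw [hh h3] at h4
        exact hc w (Quotient.sound h4)⟩
  refine Nat.card_congr (Equiv.ofBijective e ⟨?_, ?_⟩)
  · rintro ⟨c, hc⟩ ⟨d, hd⟩ k
    induction c using Quotient.inductionOn with
    | h z =>
    induction d using Quotient.inductionOn with
    | h z' =>
    have h1 : G.map h (h z) (h z') := Quotient.exact (congrArg Subtype.val k)
    congr 1
    exact Quotient.sound ((hG _ _).1 h1)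
  · rintro ⟨c, hc⟩
    induction c using Quotient.inductionOn with
    | h x =>
    rcases hcov x with ⟨z, rfl⟩ | ⟨y, rfl⟩
    · refine ⟨⟨Quotient.mk _ z, ?_⟩, rfl⟩
      intro w hw
      apply hc (i w)
      rw [← hsq]
      exact Quotient.sound (map_rel G h (Quotient.exact hw))
    · exact absurd rfl (hc y)

end Gluing

/-! ### Composition of relations on boundary points -/

section Composition

variable {A B C D : Type}

/-- Draw `p` above `q` and identify the bottom points of `p` with the top points of `q`. -/
@[reducible] def glue (p : Setoid (A ⊕ B)) (q : Setoid (B ⊕ C)) : Setoid (A ⊕ (B ⊕ C)) :=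
  p.map (Sum.map id Sum.inl) ⊔ q.map Sum.inr

/-- The inclusion of the top and bottom points into the points of a glued diagram. -/
def outer : A ⊕ C → A ⊕ (B ⊕ C) := Sum.map id Sum.inr

/-- The relation induced on the outer points by the glued diagram. -/
@[reducible] def comp (p : Setoid (A ⊕ B)) (q : Setoid (B ⊕ C)) : Setoid (A ⊕ C) :=
  (glue p q).comap outer

/-- The number of closed loops: components of the glued diagram without outer points. -/
noncomputable def loops (p : Setoid (A ⊕ B)) (q : Setoid (B ⊕ C)) : ℕ :=
  freeClasses (glue p q) outer

/-- The trivial diagram. -/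
@[reducible] def idRel (A : Type) : Setoid (A ⊕ A) := Setoid.ker (Sum.elim id id)

theorem glue3_left (p : Setoid (A ⊕ B)) (q : Setoid (B ⊕ C)) (r : Setoid (C ⊕ D)) :
    (p.map (Sum.map id Sum.inl) ⊔ (q.map (Sum.inr ∘ Sum.map id Sum.inl) ⊔
      r.map (Sum.inr ∘ Sum.inr)) : Setoid (A ⊕ (B ⊕ (C ⊕ D)))) =
    (glue p q).map (Sum.map id (Sum.map id Sum.inl)) ⊔
      (r.map (Sum.inr : C ⊕ D → A ⊕ (C ⊕ D))).map (Sum.map id Sum.inr) := by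
  rw [glue, map_sup, map_map, map_map, map_map, sup_assoc]
  congr 2
  funext x
  rcases x with x | x <;> rfl

theorem glue3_right (p : Setoid (A ⊕ B)) (q : Setoid (B ⊕ C)) (r : Setoid (C ⊕ D)) :
    (p.map (Sum.map id Sum.inl) ⊔ (q.map (Sum.inr ∘ Sum.map id Sum.inl) ⊔
      r.map (Sum.inr ∘ Sum.inr)) : Setoid (A ⊕ (B ⊕ (C ⊕ D)))) =
    (glue q r).map Sum.inr ⊔
      (p.map (Sum.map id Sum.inl : A ⊕ B → A ⊕ (B ⊕ D))).map
        (Sum.map id (Sum.map id Sum.inr)) := by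
  rw [glue, map_sup, map_map, map_map, map_map, sup_comm]
  congr 2
  funext x
  rcases x with x | x <;> rfl

theorem comap_glue3_left (p : Setoid (A ⊕ B)) (q : Setoid (B ⊕ C)) :
    ((glue p q).map (Sum.map id (Sum.map id (Sum.inl : C → C ⊕ D)))).comap
      (Sum.map id Sum.inr) = (comp p q).map (Sum.map id Sum.inl) := by
  apply comap_map_square
  · exact Sum.map_injective.2
      ⟨Function.injective_id, Sum.map_injective.2 ⟨Function.injective_id, Sum.inl_injective⟩⟩
  · exact Sum.map_injective.2 ⟨Function.injective_id, Sum.inr_injective⟩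
  · rintro (w | w) <;> rfl
  · rintro (z | z | z) (y | y | y) h <;> simp_all [outer]

theorem comap_glue3_right (q : Setoid (B ⊕ C)) (r : Setoid (C ⊕ D)) :
    ((glue q r).map (Sum.inr : _ → A ⊕ (B ⊕ (C ⊕ D)))).comap
      (Sum.map id (Sum.map id Sum.inr)) = (comp q r).map Sum.inr := by
  apply comap_map_square
  · exact Sum.inr_injective
  · exact Sum.map_injective.2
      ⟨Function.injective_id, Sum.map_injective.2 ⟨Function.injective_id, Sum.inr_injective⟩⟩
  · rintro (w | w) <;> rfl
  · rintro (z | z | z) (y | y | y) h <;> simp_all [outer]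

theorem comp_assoc (p : Setoid (A ⊕ B)) (q : Setoid (B ⊕ C)) (r : Setoid (C ⊕ D)) :
    comp (comp p q) r = comp p (comp q r) := by
  have h1 := comap_sup_map ((glue p q).map (Sum.map id (Sum.map id (Sum.inl : C → C ⊕ D))))
    (Sum.map id Sum.inr) (r.map (Sum.inr : C ⊕ D → A ⊕ (C ⊕ D)))
  have h2 := comap_sup_map ((glue q r).map (Sum.inr : _ → A ⊕ (B ⊕ (C ⊕ D))))
    (Sum.map id (Sum.map id Sum.inr)) (p.map (Sum.map id Sum.inl : A ⊕ B → A ⊕ (B ⊕ D)))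
  rw [← glue3_left, comap_glue3_left] at h1
  rw [← glue3_right, comap_glue3_right] at h2
  have h3 : comp p (comp q r) = ((comp q r).map Sum.inr ⊔
      p.map (Sum.map id Sum.inl : A ⊕ B → A ⊕ (B ⊕ D))).comap outer := by
    unfold comp glue
    rw [sup_comm]
  rw [h3, ← h2]
  change Setoid.comap outer ((comp p q).map (Sum.map id Sum.inl) ⊔ r.map Sum.inr) = _
  rw [← h1]
  ext x y
  rcases x with x | x <;> rcases y with y | y <;> exact Iff.rfl

theorem loops_assoc [Finite A] [Finite B] [Finite C] [Finite D]
    (p : Setoid (A ⊕ B)) (q : Setoid (B ⊕ C)) (r : Setoid (C ⊕ D)) :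
    loops p q + loops (comp p q) r = loops q r + loops p (comp q r) := by
  have h1 := freeClasses_sup_map
    ((glue p q).map (Sum.map id (Sum.map id (Sum.inl : C → C ⊕ D))))
    (Sum.map id Sum.inr) (r.map (Sum.inr : C ⊕ D → A ⊕ (C ⊕ D))) outer
  have h2 := freeClasses_sup_map ((glue q r).map (Sum.inr : _ → A ⊕ (B ⊕ (C ⊕ D))))
    (Sum.map id (Sum.map id Sum.inr)) (p.map (Sum.map id Sum.inl : A ⊕ B → A ⊕ (B ⊕ D))) outer
  rw [← glue3_left, comap_glue3_left] at h1
  rw [← glue3_right, comap_glue3_right] at h2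
  have h5 : loops p (comp q r) = freeClasses ((comp q r).map Sum.inr ⊔
      p.map (Sum.map id Sum.inl : A ⊕ B → A ⊕ (B ⊕ D))) outer := by
    unfold loops glue
    rw [sup_comm]
  have e : (Sum.map id Sum.inr ∘ outer : A ⊕ D → A ⊕ (B ⊕ (C ⊕ D))) =
      Sum.map id (Sum.map id Sum.inr) ∘ outer := by
    funext x
    rcases x with x | x <;> rfl
  have h3 : freeClasses ((glue p q).map (Sum.map id (Sum.map id (Sum.inl : C → C ⊕ D))))
      (Sum.map id Sum.inr) = loops p q := by
    apply freeClasses_map (i := Sum.map id Sum.inl)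
    · exact Sum.map_injective.2
        ⟨Function.injective_id, Sum.map_injective.2 ⟨Function.injective_id, Sum.inl_injective⟩⟩
    · rintro (w | w) <;> rfl
    · rintro (z | z | z) (y | y | y) h <;> simp_all [outer]
    · rintro (x | x | x | x) <;> simp
  have h4 : freeClasses ((glue q r).map (Sum.inr : _ → A ⊕ (B ⊕ (C ⊕ D))))
      (Sum.map id (Sum.map id Sum.inr)) = loops q r := by
    apply freeClasses_map (i := Sum.inr)
    · exact Sum.inr_injective
    · rintro (w | w) <;> rfl
    · rintro (z | z | z) (y | y | y) h <;> simp_all [outer]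
    · rintro (x | x | x | x) <;> simp
  rw [h3] at h1
  rw [h4] at h2
  rw [e, h2, ← h5] at h1
  exact h1.symm

theorem glue_id_left (p : Setoid (A ⊕ B)) :
    glue (idRel A) p = p.comap (Sum.elim Sum.inl id) := by
  apply le_antisymm
  · refine sup_le ?_ ?_ <;> rw [map_le_iff]
    · rintro (x | x) (y | y) h <;> cases h <;> exact p.refl' _
    · intro x y h
      exact h
  · have h0 : ∀ x : A ⊕ (A ⊕ B),
        glue (idRel A) p x (Sum.inr (Sum.elim Sum.inl id x)) := by
      rintro (x | x)
      · have h : idRel A (Sum.inl x) (Sum.inr x) := rfl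
        exact (le_sup_left : _ ≤ glue (idRel A) p)
          (map_rel (idRel A) (Sum.map id Sum.inl : A ⊕ A → A ⊕ (A ⊕ B)) h)
      · exact Setoid.refl' _ _
    intro x y h
    refine Setoid.trans' _ (h0 x) (Setoid.trans' _ ?_ (Setoid.symm' _ (h0 y)))
    exact (le_sup_right : _ ≤ glue (idRel A) p) (map_rel p Sum.inr h)

theorem glue_id_right (p : Setoid (A ⊕ B)) :
    glue p (idRel B) = p.comap (Sum.map id (Sum.elim id id)) := by
  apply le_antisymm
  · refine sup_le ?_ ?_ <;> rw [map_le_iff]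
    · rintro (x | x) (y | y) h <;> exact h
    · rintro (x | x) (y | y) h <;> cases h <;> exact p.refl' _
  · have h0 : ∀ x : A ⊕ (B ⊕ B),
        glue p (idRel B) x (Sum.map id Sum.inl (Sum.map id (Sum.elim id id) x : A ⊕ B)) := by
      rintro (x | x | x)
      · exact Setoid.refl' _ _
      · exact Setoid.refl' _ _
      · have h : idRel B (Sum.inr x) (Sum.inl x) := rfl
        exact (le_sup_right : _ ≤ glue p (idRel B)) (map_rel (idRel B) Sum.inr h)
    intro x y h
    refine Setoid.trans' _ (h0 x) (Setoid.trans' _ ?_ (Setoid.symm' _ (h0 y)))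
    exact (le_sup_left : _ ≤ glue p (idRel B)) (map_rel p (Sum.map id Sum.inl) h)

theorem comp_id_left (p : Setoid (A ⊕ B)) : comp (idRel A) p = p := by
  unfold comp
  rw [glue_id_left]
  ext x y
  rcases x with x | x <;> rcases y with y | y <;> rfl

theorem comp_id_right (p : Setoid (A ⊕ B)) : comp p (idRel B) = p := by
  unfold comp
  rw [glue_id_right]
  ext x y
  rcases x with x | x <;> rcases y with y | y <;> rfl

theorem loops_id_left (p : Setoid (A ⊕ B)) : loops (idRel A) p = 0 := by
  unfold loops freeClasses
  rw [Nat.card_eq_zero]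
  left
  refine ⟨fun ⟨c, hc⟩ => ?_⟩
  induction c using Quotient.inductionOn with
  | h x =>
  refine hc (Sum.elim Sum.inl id x) (Quotient.sound ?_)
  change glue (idRel A) p _ _
  rw [glue_id_left]
  rcases x with x | x | x <;> exact p.refl' _

theorem loops_id_right (p : Setoid (A ⊕ B)) : loops p (idRel B) = 0 := by
  unfold loops freeClasses
  rw [Nat.card_eq_zero]
  left
  refine ⟨fun ⟨c, hc⟩ => ?_⟩
  induction c using Quotient.inductionOn with
  | h x =>
  refine hc (Sum.map id (Sum.elim id id) x) (Quotient.sound ?_)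
  change glue p (idRel B) _ _
  rw [glue_id_right]
  rcases x with x | x | x <;> exact p.refl' _

end Composition

/-! ### Brauer partitions -/

/-- Every class of `s` has exactly two elements. -/
def IsPairing {X : Type} (s : Setoid X) : Prop := ∀ x, ∃! y, y ≠ x ∧ s x y

section Dihedral

variable {X : Type} [Finite X]

/-- Following alternately two involutions without common fixed point from a fixed point of one of
them leads to exactly one other such point. -/
theorem existsUnique_end (P Q : Equiv.Perm X) (hP : ∀ x, P (P x) = x) (hQ : ∀ x, Q (Q x) = x)
    (hno : ∀ x, ¬ (P x = x ∧ Q x = x)) (S : Setoid X)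
    (h1 : ∀ x, S x (P x)) (h2 : ∀ x, S x (Q x))
    (h3 : ∀ T : Setoid X, (∀ x, T x (P x)) → (∀ x, T x (Q x)) → S ≤ T)
    (a : X) (ha : Q a = a) :
    ∃! y, y ≠ a ∧ (P y = y ∨ Q y = y) ∧ S a y := by
  classical
  set ρ : Equiv.Perm X := Q * P with hρ
  have hPi : P⁻¹ = P := by
    ext x
    rw [Equiv.Perm.inv_eq_iff_eq, hP]
  have hQi : Q⁻¹ = Q := by
    ext x
    rw [Equiv.Perm.inv_eq_iff_eq, hQ]
  have hQQ : Q * Q = 1 := by ext x; simp [hQ]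
  have hPP : P * P = 1 := by ext x; simp [hP]
  have hconj : ∀ n : ℤ, Q * ρ ^ n = ρ ^ (-n) * Q := by
    intro n
    have : Q * ρ * Q⁻¹ = ρ⁻¹ := by
      rw [hρ, mul_inv_rev, hPi, hQi, ← mul_assoc, hQQ, one_mul]
    have h4 := congrArg (fun z => z ^ n) this
    simp only [conj_zpow] at h4
    rw [zpow_neg, ← inv_zpow, ← h4]
    group
  have hQn : ∀ n : ℤ, Q ((ρ ^ n) a) = (ρ ^ (-n)) a := by
    intro n
    have := congrArg (fun z : Equiv.Perm X => z a) (hconj n)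
    simpa [ha] using this
  have hPn : ∀ n : ℤ, P ((ρ ^ n) a) = (ρ ^ (-n - 1)) a := by
    intro n
    have h4 : P ((ρ ^ n) a) = Q (ρ ((ρ ^ n) a)) := by simp [hρ, hQ]
    have h5 : ρ ((ρ ^ n) a) = (ρ ^ (n + 1)) a := by
      rw [add_comm, zpow_add, zpow_one]
      rfl
    rw [h4, h5, hQn]
    congr 2
    ring
  have hper : ∀ n k : ℤ, (ρ ^ n) a = (ρ ^ k) a ↔
      (Function.minimalPeriod (ρ • · : X → X) a : ℤ) ∣ n - k := by
    intro n k
    rw [← MulAction.zpow_smul_eq_iff_minimalPeriod_dvd, Equiv.Perm.smul_def, sub_eq_neg_add,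
      zpow_add, zpow_neg, Equiv.Perm.mul_apply, Equiv.Perm.inv_eq_iff_eq]
  have hM : 0 < Function.minimalPeriod (ρ • · : X → X) a := by
    apply Function.minimalPeriod_pos_of_mem_periodicPts
    exact (Function.Injective.mem_periodicPts (MulAction.injective ρ) a)
  generalize Function.minimalPeriod (ρ • · : X → X) a = M at hper hM
  have hQfix : ∀ n : ℤ, Q ((ρ ^ n) a) = (ρ ^ n) a ↔ (M : ℤ) ∣ 2 * n := by
    intro n
    rw [hQn, hper, ← dvd_neg]
    congr! 1
    ring
  have hPfix : ∀ n : ℤ, P ((ρ ^ n) a) = (ρ ^ n) a ↔ (M : ℤ) ∣ 2 * n + 1 := by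
    intro n
    rw [hPn, hper, ← dvd_neg]
    congr! 1
    ring
  have hne : ∀ n : ℤ, (ρ ^ n) a ≠ a ↔ ¬ (M : ℤ) ∣ n := by
    intro n
    have := hper n 0
    simpa using this.not
  have hS : ∀ y, S a y ↔ ∃ n : ℤ, (ρ ^ n) a = y := by
    intro y
    constructor
    · let T : Setoid X := Setoid.ker (fun x => ∃ n : ℤ, (ρ ^ n) a = x)
      have hT : S ≤ T := by
        apply h3
        · intro x
          refine propext ⟨?_, ?_⟩
          · rintro ⟨n, rfl⟩
            exact ⟨_, (hPn n).symm⟩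
          · rintro ⟨n, hn⟩
            refine ⟨-n - 1, ?_⟩
            rw [← hPn, hn, hP]
        · intro x
          refine propext ⟨?_, ?_⟩
          · rintro ⟨n, rfl⟩
            exact ⟨_, (hQn n).symm⟩
          · rintro ⟨n, hn⟩
            refine ⟨-n, ?_⟩
            rw [← hQn, hn, hQ]
      intro h
      have h5 : (∃ n : ℤ, (ρ ^ n) a = a) = (∃ n : ℤ, (ρ ^ n) a = y) := hT h
      rw [← h5]
      exact ⟨0, by simp⟩
    · rintro ⟨n, rfl⟩
      have hstep : ∀ x, S x (ρ x) := fun x => S.trans' (h1 x) (h2 (P x))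
      induction n using Int.induction_on with
      | zero => simp
      | succ n ih =>
        rw [add_comm, zpow_add, zpow_one]
        exact S.trans' ih (hstep _)
      | pred n ih =>
        have h6 := hstep ((ρ ^ (-(n : ℤ) - 1)) a)
        have h7 : ρ ((ρ ^ (-(n : ℤ) - 1)) a) = (ρ ^ (-(n : ℤ))) a := by
          rw [← Equiv.Perm.mul_apply, ← zpow_one_add]
          congr 2
          ring
        rw [h7] at h6
        exact S.trans' ih (S.symm' h6)
  obtain ⟨h, hh | hh⟩ := Nat.even_or_odd' M
  · refine ⟨(ρ ^ (h : ℤ)) a, ⟨?_, Or.inr ?_, (hS _).2 ⟨_, rfl⟩⟩, ?_⟩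
    · rw [hne]
      rintro ⟨c, hc⟩
      subst hh
      push_cast at hc
      have h8 : (h : ℤ) * (2 * c - 1) = 0 := by linear_combination -hc
      rcases mul_eq_zero.1 h8 with h9 | h9 <;> omega
    · rw [hQfix, hh]
      push_cast
      exact dvd_rfl
    · rintro y ⟨hy1, hy2, hy3⟩
      obtain ⟨n, rfl⟩ := (hS y).1 hy3
      rw [hne] at hy1
      rw [hPfix, hQfix] at hy2
      rw [hper]
      rcases hy2 with hy2 | hy2
      · exfalso
        have : (2 : ℤ) ∣ 2 * n + 1 := dvd_trans ⟨(h : ℤ), by rw [hh]; push_cast; ring⟩ hy2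
        omega
      · obtain ⟨c, hc⟩ := hy2
        rw [hh] at hc hy1 ⊢
        push_cast at hc hy1 ⊢
        have hn : n = h * c := by linarith
        obtain ⟨e, he | he⟩ := Int.even_or_odd' c
        · exact absurd ⟨e, by rw [hn, he]; ring⟩ hy1
        · exact ⟨e, by rw [hn, he]; ring⟩
  · refine ⟨(ρ ^ (h : ℤ)) a, ⟨?_, Or.inl ?_, (hS _).2 ⟨_, rfl⟩⟩, ?_⟩
    · rw [hne]
      rintro ⟨c, hc⟩
      rw [hh] at hc
      push_cast at hc
      have h0 : h = 0 := by
        by_contra h0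
        have hpos : 0 < (h : ℤ) := by omega
        rcases lt_trichotomy c 0 with hc0 | hc0 | hc0
        · nlinarith
        · subst hc0; omega
        · nlinarith
      subst h0
      have hM1 : M = 1 := by omega
      have h9 := (hPfix 0).2 (by rw [hM1]; simp)
      exact hno a ⟨by simpa using h9, ha⟩
    · rw [hPfix, hh]
      push_cast
      exact dvd_rfl
    · rintro y ⟨hy1, hy2, hy3⟩
      obtain ⟨n, rfl⟩ := (hS y).1 hy3
      rw [hne] at hy1
      rw [hPfix, hQfix] at hy2
      rw [hper]
      have hcop : IsCoprime (M : ℤ) 2 := ⟨1, -h, by rw [hh]; push_cast; ring⟩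
      rcases hy2 with hy2 | hy2
      · apply hcop.dvd_of_dvd_mul_left
        have := dvd_sub hy2 (dvd_refl (M : ℤ))
        have e : 2 * n + 1 - (M : ℤ) = 2 * (n - h) := by rw [hh]; push_cast; ring
        rwa [e] at this
      · exact absurd (hcop.dvd_of_dvd_mul_left hy2) hy1

end Dihedral

theorem IsPairing.exists_perm {X : Type} {s : Setoid X} (hs : IsPairing s) :
    ∃ P : Equiv.Perm X, (∀ x, P (P x) = x) ∧ (∀ x, P x ≠ x) ∧ (∀ x y, s x y ↔ y = x ∨ y = P x) := by
  choose f hf using hs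
  have hff : ∀ x, f (f x) = x := fun x =>
    ((hf (f x)).2 x ⟨(hf x).1.1.symm, s.symm' (hf x).1.2⟩).symm
  refine ⟨⟨f, f, hff, hff⟩, hff, fun x => (hf x).1.1, fun x y => ⟨fun h => ?_, ?_⟩⟩
  · by_cases hy : y = x
    · exact Or.inl hy
    · exact Or.inr ((hf x).2 y ⟨hy, h⟩)
  · rintro (rfl | rfl)
    · exact s.refl' _
    · exact (hf x).1.2

theorem IsPairing.comp {A B C : Type} [Finite A] [Finite B] [Finite C]
    {p : Setoid (A ⊕ B)} {q : Setoid (B ⊕ C)} (hp : IsPairing p) (hq : IsPairing q) :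
    IsPairing (comp p q) := by
  obtain ⟨P, hP1, hP2, hP3⟩ := hp.exists_perm
  obtain ⟨Q, hQ1, hQ2, hQ3⟩ := hq.exists_perm
  let i : A ⊕ B → A ⊕ (B ⊕ C) := Sum.map id Sum.inl
  let P' : A ⊕ (B ⊕ C) → A ⊕ (B ⊕ C) := fun x => match x with
    | Sum.inl a => i (P (Sum.inl a))
    | Sum.inr (Sum.inl b) => i (P (Sum.inr b))
    | Sum.inr (Sum.inr c) => Sum.inr (Sum.inr c)
  let Q' : A ⊕ (B ⊕ C) → A ⊕ (B ⊕ C) := fun x => match x with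
    | Sum.inl a => Sum.inl a
    | Sum.inr y => Sum.inr (Q y)
  have hPi : ∀ x, P' (i x) = i (P x) := by rintro (x | x) <;> rfl
  have hi : Function.Injective i :=
    Sum.map_injective.2 ⟨Function.injective_id, Sum.inl_injective⟩
  have hcov : ∀ x, (∃ y, i y = x) ∨ ∃ c, x = Sum.inr (Sum.inr c) := by
    rintro (x | x | x)
    · exact Or.inl ⟨Sum.inl x, rfl⟩
    · exact Or.inl ⟨Sum.inr x, rfl⟩
    · exact Or.inr ⟨x, rfl⟩
  have hP' : ∀ x, P' (P' x) = x := by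
    intro x
    rcases hcov x with ⟨y, rfl⟩ | ⟨c, rfl⟩
    · rw [hPi, hPi, hP1]
    · rfl
  have hQ' : ∀ x, Q' (Q' x) = x := by
    rintro (x | x)
    · rfl
    · exact congrArg Sum.inr (hQ1 x)
  have hPfix : ∀ x, P' x = x ↔ ∃ c, x = Sum.inr (Sum.inr c) := by
    intro x
    constructor
    · intro h
      rcases hcov x with ⟨y, rfl⟩ | h'
      · rw [hPi] at h
        exact absurd (hi h) (hP2 y)
      · exact h'
    · rintro ⟨c, rfl⟩
      rfl
  have hQfix : ∀ x, Q' x = x ↔ ∃ a, x = Sum.inl a := by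
    rintro (x | x)
    · simp [Q']
    · simp [Q', hQ2]
  have hno : ∀ x, ¬ (P' x = x ∧ Q' x = x) := by
    rintro x ⟨h1, h2⟩
    obtain ⟨c, hc⟩ := (hPfix x).1 h1
    obtain ⟨a, ha⟩ := (hQfix x).1 h2
    rw [hc] at ha
    cases ha
  have h1 : ∀ x, glue p q x (P' x) := by
    intro x
    rcases hcov x with ⟨y, rfl⟩ | ⟨c, rfl⟩
    · rw [hPi]
      exact (le_sup_left : _ ≤ glue p q) (map_rel p i ((hP3 _ _).2 (Or.inr rfl)))
    · exact Setoid.refl' _ _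
  have h2 : ∀ x, glue p q x (Q' x) := by
    rintro (x | x)
    · exact Setoid.refl' _ _
    · exact (le_sup_right : _ ≤ glue p q) (map_rel q Sum.inr ((hQ3 _ _).2 (Or.inr rfl)))
  have h3 : ∀ T : Setoid (A ⊕ (B ⊕ C)), (∀ x, T x (P' x)) → (∀ x, T x (Q' x)) →
      glue p q ≤ T := by
    intro T hT1 hT2
    refine sup_le ?_ ?_ <;> rw [map_le_iff] <;> intro x y h
    · rcases (hP3 _ _).1 h with rfl | rfl
      · exact T.refl' _
      · have h4 := hT1 (i x)
        rw [hPi] at h4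
        exact h4
    · rcases (hQ3 _ _).1 h with rfl | rfl
      · exact T.refl' _
      · exact hT2 (Sum.inr x)
  have hout : ∀ y, (P' y = y ∨ Q' y = y) ↔ ∃ z : A ⊕ C, outer z = y := by
    intro y
    rw [hPfix, hQfix]
    constructor
    · rintro (⟨c, rfl⟩ | ⟨a, rfl⟩)
      · exact ⟨Sum.inr c, rfl⟩
      · exact ⟨Sum.inl a, rfl⟩
    · rintro ⟨z | z, rfl⟩
      · exact Or.inr ⟨z, rfl⟩
      · exact Or.inl ⟨z, rfl⟩
  have hoinj : Function.Injective (outer : A ⊕ C → A ⊕ (B ⊕ C)) :=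
    Sum.map_injective.2 ⟨Function.injective_id, Sum.inr_injective⟩
  have main : ∀ x : A ⊕ C, ∃! y, y ≠ outer x ∧ (P' y = y ∨ Q' y = y) ∧ glue p q (outer x) y := by
    rintro (x | x)
    · exact existsUnique_end ⟨P', P', hP', hP'⟩ ⟨Q', Q', hQ', hQ'⟩ hP' hQ' hno _ h1 h2 h3 _
        ((hQfix _).2 ⟨x, rfl⟩)
    · have := existsUnique_end ⟨Q', Q', hQ', hQ'⟩ ⟨P', P', hP', hP'⟩ hQ' hP'
        (fun x h => hno x h.symm) _ h2 h1 (fun T a b => h3 T b a) (outer (Sum.inr x))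
        ((hPfix _).2 ⟨x, rfl⟩)
      obtain ⟨y, ⟨hy1, hy2, hy3⟩, hy4⟩ := this
      exact ⟨y, ⟨hy1, hy2.symm, hy3⟩, fun z hz => hy4 z ⟨hz.1, hz.2.1.symm, hz.2.2⟩⟩
  intro x
  obtain ⟨y, ⟨hy1, hy2, hy3⟩, huniq⟩ := main x
  obtain ⟨z, rfl⟩ := (hout y).1 hy2
  refine ⟨z, ⟨fun h => hy1 (congrArg _ h), hy3⟩, ?_⟩
  rintro w ⟨hw1, hw2⟩
  exact hoinj (huniq _ ⟨fun h => hw1 (hoinj h), (hout _).2 ⟨w, rfl⟩, hw2⟩)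

/-- The partition into the pairs `{x, f x}` for an involution `f`. -/
@[reducible] def pairsOf {X : Type} (f : X → X) (hf : Function.Involutive f) : Setoid X where
  r x y := y = x ∨ y = f x
  iseqv := by
    refine ⟨fun x => Or.inl rfl, ?_, ?_⟩
    · rintro x y (rfl | rfl)
      · exact Or.inl rfl
      · exact Or.inr (hf x).symm
    · rintro x y z (rfl | rfl) (rfl | rfl)
      · exact Or.inl rfl
      · exact Or.inr rfl
      · exact Or.inr rfl
      · exact Or.inl (hf x)

theorem isPairing_pairsOf {X : Type} (f : X → X) (hf : Function.Involutive f)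
    (hne : ∀ x, f x ≠ x) : IsPairing (pairsOf f hf) := by
  intro x
  refine ⟨f x, ⟨hne x, Or.inr rfl⟩, ?_⟩
  rintro y ⟨h1, rfl | h2⟩
  · exact absurd rfl h1
  · exact h2

end Brauer

open Brauer

/-- A Brauer partition: a partition into pairs of the `m` top vertices `1, …, m` (left summand) and
the `n` bottom vertices `1', …, n'` (right summand). Vertices are numbered from `0` in `Fin`. -/
@[ext]
structure BrauerPartition (m n : ℕ) where
  rel : Setoid (Fin m ⊕ Fin n)
  pairing : IsPairing rel

namespace BrauerPartition

/-- The identity partition `{1, 1'}, …, {m, m'}`. -/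
def one (m : ℕ) : BrauerPartition m m where
  rel := idRel (Fin m)
  pairing := by
    rintro (x | x)
    · refine ⟨Sum.inr x, ⟨by simp, rfl⟩, ?_⟩
      rintro (y | y) ⟨h1, h2⟩
      · exact absurd (congrArg Sum.inl (show x = y from h2).symm) h1
      · exact congrArg Sum.inr (show x = y from h2).symm
    · refine ⟨Sum.inl x, ⟨by simp, rfl⟩, ?_⟩
      rintro (y | y) ⟨h1, h2⟩
      · exact congrArg Sum.inl (show x = y from h2).symm
      · exact absurd (congrArg Sum.inr (show x = y from h2).symm) h1

/-- The partition of the concatenation, `p` above `q`, with closed loops removed. -/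
def mul {l m n : ℕ} (p : BrauerPartition l m) (q : BrauerPartition m n) : BrauerPartition l n where
  rel := comp p.rel q.rel
  pairing := p.pairing.comp q.pairing

/-- The number of closed loops of the concatenation. -/
noncomputable def loops {l m n : ℕ} (p : BrauerPartition l m) (q : BrauerPartition m n) : ℕ :=
  Brauer.loops p.rel q.rel

theorem one_mul {m n : ℕ} (p : BrauerPartition m n) : (one m).mul p = p :=
  BrauerPartition.ext (comp_id_left p.rel)

theorem mul_one {m n : ℕ} (p : BrauerPartition m n) : p.mul (one n) = p :=
  BrauerPartition.ext (comp_id_right p.rel)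

theorem mul_assoc {a b c d : ℕ} (p : BrauerPartition a b) (q : BrauerPartition b c)
    (r : BrauerPartition c d) : (p.mul q).mul r = p.mul (q.mul r) :=
  BrauerPartition.ext (comp_assoc p.rel q.rel r.rel)

/-- The transposition `σ_j`: pairs `{j, (j+1)'}`, `{j+1, j'}`, and `{a, a'}` for the other `a`
(here `1 ≤ j < m` in the usual numbering from `1`). -/
def sigma {m : ℕ} (j : ℕ) (h1 : 1 ≤ j) (h2 : j < m) : BrauerPartition m m where
  rel := pairsOf
    (Sum.elim (fun a => Sum.inr (Equiv.swap (⟨j - 1, by omega⟩ : Fin m) ⟨j, h2⟩ a))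
      (fun a => Sum.inl (Equiv.swap (⟨j - 1, by omega⟩ : Fin m) ⟨j, h2⟩ a)))
    (by rintro (x | x) <;> simp)
  pairing := isPairing_pairsOf _ _ (by rintro (x | x) <;> simp)

/-- The partner of a vertex in `U_j`. -/
def cupCapPartner {m : ℕ} (j : ℕ) (h2 : j < m) : Fin m ⊕ Fin m → Fin m ⊕ Fin m
  | Sum.inl a =>
    if a.1 = j - 1 ∨ a.1 = j then
      Sum.inl (Equiv.swap (⟨j - 1, by omega⟩ : Fin m) ⟨j, h2⟩ a) else Sum.inr a
  | Sum.inr a =>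
    if a.1 = j - 1 ∨ a.1 = j then
      Sum.inr (Equiv.swap (⟨j - 1, by omega⟩ : Fin m) ⟨j, h2⟩ a) else Sum.inl a

/-- The diagram `U_j`: pairs `{j, j+1}`, `{j', (j+1)'}`, and `{a, a'}` for the other `a`
(here `1 ≤ j < m` in the usual numbering from `1`). -/
def cupCap {m : ℕ} (j : ℕ) (h1 : 1 ≤ j) (h2 : j < m) : BrauerPartition m m where
  rel := pairsOf (cupCapPartner j h2) (by
    have hs : ∀ a : Fin m, (a.1 = j - 1 ∨ a.1 = j) →
        ((Equiv.swap (⟨j - 1, by omega⟩ : Fin m) ⟨j, h2⟩ a).1 = j - 1 ∨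
          (Equiv.swap (⟨j - 1, by omega⟩ : Fin m) ⟨j, h2⟩ a).1 = j) := by
      rintro ⟨a, ha⟩ (h | h) <;> simp only at h <;> subst h
      · right; rw [Equiv.swap_apply_left]
      · left; rw [Equiv.swap_apply_right]
    rintro (a | a) <;> by_cases h : a.1 = j - 1 ∨ a.1 = j <;> simp [cupCapPartner, h, hs])
  pairing := isPairing_pairsOf _ _ (by
    have hs : ∀ a : Fin m, (a.1 = j - 1 ∨ a.1 = j) →
        Equiv.swap (⟨j - 1, by omega⟩ : Fin m) ⟨j, h2⟩ a ≠ a := by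
      rintro ⟨a, ha⟩ (h | h) <;> simp only at h <;> subst h
      · rw [Equiv.swap_apply_left, Ne, Fin.ext_iff]; simp only; omega
      · rw [Equiv.swap_apply_right, Ne, Fin.ext_iff]; simp only; omega
    rintro (a | a) <;> by_cases h : a.1 = j - 1 ∨ a.1 = j <;> simp [cupCapPartner, h, hs])

end BrauerPartition

/-! ### The Brauer algebra -/

/-- The Brauer algebra `B_m` over `k` with parameter `δ`: the free `k`-module on the Brauer
partitions `J(m, m)`, with product `p * q = δ ^ (number of closed loops) (p above q)`. -/
def BrauerAlgebra (k : Type*) [CommRing k] (_δ : k) (m : ℕ) : Type _ :=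
  BrauerPartition m m →₀ k

namespace BrauerAlgebra

variable {k : Type*} [CommRing k] {δ : k} {m : ℕ}

noncomputable instance : AddCommGroup (BrauerAlgebra k δ m) :=
  inferInstanceAs (AddCommGroup (BrauerPartition m m →₀ k))

noncomputable instance : Module k (BrauerAlgebra k δ m) :=
  inferInstanceAs (Module k (BrauerPartition m m →₀ k))

variable (k δ) in
/-- A Brauer partition as an element of the Brauer algebra. -/
noncomputable def of (p : BrauerPartition m m) : BrauerAlgebra k δ m :=
  (Finsupp.single p 1 : BrauerPartition m m →₀ k)

/-- Linear maps out of the Brauer algebra are determined on partitions. -/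
theorem hom_ext {M : Type*} [AddCommMonoid M] [Module k M]
    {f g : BrauerAlgebra k δ m →ₗ[k] M} (h : ∀ p, f (of k δ p) = g (of k δ p)) : f = g :=
  Finsupp.lhom_ext' fun p => LinearMap.ext_ring (h p)

variable (k δ m) in
/-- The bilinear product. -/
noncomputable def mulHom :
    BrauerAlgebra k δ m →ₗ[k] BrauerAlgebra k δ m →ₗ[k] BrauerAlgebra k δ m :=
  Finsupp.linearCombination k fun p =>
    (Finsupp.linearCombination k fun q => δ ^ p.loops q • of k δ (p.mul q) :
      (BrauerPartition m m →₀ k) →ₗ[k] BrauerAlgebra k δ m)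

theorem mulHom_of (p q : BrauerPartition m m) :
    mulHom k δ m (of k δ p) (of k δ q) = δ ^ p.loops q • of k δ (p.mul q) := by
  unfold mulHom of
  erw [Finsupp.linearCombination_single, one_smul, Finsupp.linearCombination_single, one_smul]

theorem mulHom_assoc (x y z : BrauerAlgebra k δ m) :
    mulHom k δ m (mulHom k δ m x y) z = mulHom k δ m x (mulHom k δ m y z) := by
  have h : (LinearMap.llcomp k _ _ _ (mulHom k δ m)).comp (mulHom k δ m) =
      ((LinearMap.llcomp k (BrauerAlgebra k δ m) (BrauerAlgebra k δ m)
        (BrauerAlgebra k δ m)).flip.comp (mulHom k δ m)).flip.comp (mulHom k δ m) := by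
    refine hom_ext fun p => hom_ext fun q => hom_ext fun r => ?_
    simp only [LinearMap.comp_apply, LinearMap.llcomp_apply, LinearMap.flip_apply, mulHom_of,
      map_smul, LinearMap.smul_apply, smul_smul, ← pow_add, BrauerPartition.mul_assoc]
    congr 2
    exact loops_assoc p.rel q.rel r.rel
  exact congrArg (fun f => f x y z) h

noncomputable instance : Mul (BrauerAlgebra k δ m) := ⟨fun x y => mulHom k δ m x y⟩

noncomputable instance : One (BrauerAlgebra k δ m) := ⟨of k δ (BrauerPartition.one m)⟩

theorem mul_def (x y : BrauerAlgebra k δ m) : x * y = mulHom k δ m x y := rfl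

theorem one_def : (1 : BrauerAlgebra k δ m) = of k δ (BrauerPartition.one m) := rfl

theorem of_mul_of (p q : BrauerPartition m m) :
    of k δ p * of k δ q = δ ^ p.loops q • of k δ (p.mul q) := mulHom_of p q

noncomputable instance : Ring (BrauerAlgebra k δ m) :=
  { (inferInstance : AddCommGroup (BrauerAlgebra k δ m)) with
    mul := (· * ·)
    one := 1
    left_distrib := fun x y z => by simp only [mul_def, map_add]
    right_distrib := fun x y z => by simp only [mul_def, map_add, LinearMap.add_apply]
    zero_mul := fun x => by simp only [mul_def, map_zero, LinearMap.zero_apply]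
    mul_zero := fun x => by simp only [mul_def, map_zero]
    mul_assoc := mulHom_assoc
    one_mul := fun x => by
      have h : mulHom k δ m 1 = LinearMap.id := hom_ext fun p => by
        have h0 : (BrauerPartition.one m).loops p = 0 := loops_id_left p.rel
        rw [one_def, mulHom_of, h0, pow_zero, one_smul, BrauerPartition.one_mul]
        rfl
      exact congrArg (fun f => f x) h
    mul_one := fun x => by
      have h : (mulHom k δ m).flip 1 = LinearMap.id := hom_ext fun p => by
        have h0 : p.loops (BrauerPartition.one m) = 0 := loops_id_right p.rel
        rw [LinearMap.flip_apply, one_def, mulHom_of, h0, pow_zero, one_smul,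
          BrauerPartition.mul_one]
        rfl
      exact congrArg (fun f => f x) h }

noncomputable instance : Algebra k (BrauerAlgebra k δ m) :=
  Algebra.ofModule (fun r x y => by simp only [mul_def, map_smul, LinearMap.smul_apply])
    (fun r x y => by simp only [mul_def, map_smul])

variable (k δ) in
/-- The subalgebra `B_{i+1,i+1,m}` of `B_m`, generated by `σ_1, …, σ_i` and the `U_j` with `j > i`
(those of them that exist in `B_m`, that is, with index at most `m - 1`). -/
noncomputable def coxeterSubalgebra (i m : ℕ) : Subalgebra k (BrauerAlgebra k δ m) :=
  Algebra.adjoin k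
    ({x | ∃ (j : ℕ) (h1 : 1 ≤ j) (h2 : j < m), j ≤ i ∧ x = of k δ (BrauerPartition.sigma j h1 h2)} ∪
     {x | ∃ (j : ℕ) (h1 : 1 ≤ j) (h2 : j < m), i < j ∧ x = of k δ (BrauerPartition.cupCap j h1 h2)})

end BrauerAlgebra

/-! ### Pictures and height

A picture is drawn in general position with respect to the vertical direction: reading from top to
bottom it is a finite stack of horizontal layers, each of which contains vertical lines and exactly
one crossing, one local minimum or one local maximum. -/

/-- A layer of a picture; `a` is the number of lines to the left of the special part. -/
inductive PictureLayer where
  /-- lines number `a` and `a + 1` (counted from `0`) cross -/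
  | cross (a : ℕ)
  /-- lines number `a` and `a + 1` coming from above are joined by an arc `∪` -/
  | cup (a : ℕ)
  /-- an arc `∩` starts, whose ends are the lines number `a` and `a + 1` below -/
  | cap (a : ℕ)

namespace PictureLayer

/-- The layer can have `w` lines at its top and `w'` lines at its bottom. -/
def Fits : PictureLayer → ℕ → ℕ → Prop
  | cross a, w, w' => a + 2 ≤ w ∧ w' = w
  | cup a, w, w' => a + 2 ≤ w ∧ w = w' + 2
  | cap a, w, w' => a ≤ w ∧ w' = w + 2

/-- The line at position `j` at the top of the layer is at position `j'` at its bottom. -/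
def Runs : PictureLayer → ℕ → ℕ → Prop
  | cross a, j, j' => j' = Equiv.swap a (a + 1) j
  | cup a, j, j' => (j < a ∧ j' = j) ∨ (a + 2 ≤ j ∧ j = j' + 2)
  | cap a, j, j' => (j < a ∧ j' = j) ∨ (a ≤ j ∧ j' = j + 2)

/-- One can go inside the layer, without meeting a line, from gap `g` at its top to gap `g'` at its
bottom; gap `g` is the interval with exactly `g` lines to its left. -/
def Passes : PictureLayer → ℕ → ℕ → Prop
  | cross a, g, g' => g ≠ a + 1 ∧ g' = g
  | cup a, g, g' => (g ≤ a ∧ g' = g) ∨ (a + 2 ≤ g ∧ g = g' + 2)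
  | cap a, g, g' => (g ≤ a ∧ g' = g) ∨ (a ≤ g ∧ g' = g + 2)

end PictureLayer

/-- A picture with `m` marked points on the top edge and `n` on the bottom edge of the rectangle:
the layers `layer 0, …, layer (depth - 1)` from top to bottom; level `t` is the horizontal line at
the top of layer `t`, level `depth` is the bottom edge, and `width t` lines meet level `t`. -/
structure Picture (m n : ℕ) where
  depth : ℕ
  width : ℕ → ℕ
  layer : ℕ → PictureLayer
  width_top : width 0 = m
  width_bottom : width depth = n
  fits : ∀ t < depth, (layer t).Fits (width t) (width (t + 1))

namespace Picture

variable {m n : ℕ} (d : Picture m n)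

/-- Segments of lines; `(t, j)` is the point where level `t` meets its line number `j`. -/
inductive Segment : ℕ × ℕ → ℕ × ℕ → Prop
  | run (t j j' : ℕ) : t < d.depth → j < d.width t → (d.layer t).Runs j j' →
      Segment (t, j) (t + 1, j')
  | cup (t a : ℕ) : t < d.depth → d.layer t = PictureLayer.cup a → Segment (t, a) (t, a + 1)
  | cap (t a : ℕ) : t < d.depth → d.layer t = PictureLayer.cap a →
      Segment (t + 1, a) (t + 1, a + 1)

/-- The marked points on the top and bottom edges. -/
def marked : Fin m ⊕ Fin n → ℕ × ℕ
  | Sum.inl a => (0, a)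
  | Sum.inr b => (d.depth, b)

/-- `d` is a picture of `p`: vertices are paired in `p` when a line of `d` joins them. -/
def IsPictureOf (p : BrauerPartition m n) : Prop :=
  ∀ x y, p.rel x y ↔ Relation.EqvGen d.Segment (d.marked x) (d.marked y)

/-- `d.PathToLeft f c`: there is a path in the rectangle, from the region of the picture that
contains the gap `f = (t, g)` (gap number `g` of level `t`) to the left edge, that avoids crossing
points and crosses lines exactly `c` times. -/
inductive PathToLeft : ℕ × ℕ → ℕ → Prop
  | left (t : ℕ) : t ≤ d.depth → PathToLeft (t, 0) 0
  | down (t g g' c : ℕ) : t < d.depth → g ≤ d.width t → (d.layer t).Passes g g' →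
      PathToLeft (t + 1, g') c → PathToLeft (t, g) c
  | up (t g g' c : ℕ) : t < d.depth → g ≤ d.width t → (d.layer t).Passes g g' →
      PathToLeft (t, g) c → PathToLeft (t + 1, g') c
  | crossLeft (t g c : ℕ) : t ≤ d.depth → g < d.width t →
      PathToLeft (t, g) c → PathToLeft (t, g + 1) (c + 1)
  | crossRight (t g c : ℕ) : t ≤ d.depth → g < d.width t →
      PathToLeft (t, g + 1) c → PathToLeft (t, g) (c + 1)

/-- The crossing point in layer `t`, of lines `a` and `a + 1`, has (left-)height at most `l`: a path
that starts from it, into one of the four sectors there, reaches the left edge after crossing at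
most `l` lines (the lines of the crossing point itself are not counted at the start). -/
def CrossingHeightLE (t a : ℕ) (l : ℤ) : Prop :=
  ∃ f c, (f = (t, a) ∨ f = (t, a + 1) ∨ f = (t, a + 2) ∨ f = (t + 1, a + 1)) ∧
    d.PathToLeft f c ∧ (c : ℤ) ≤ l

/-- The height of `d`, the maximum of the heights of its crossing points (`-1` if there are none),
is at most `l`. -/
def HeightLE (l : ℤ) : Prop :=
  ∀ t a, t < d.depth → d.layer t = PictureLayer.cross a → d.CrossingHeightLE t a l

end Picture

namespace BrauerPartition

variable {m n : ℕ}

/-- The (left-)height of `p`, the minimum of the heights of its pictures, is at most `l`. -/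
def HeightLE (p : BrauerPartition m n) (l : ℤ) : Prop :=
  ∃ d : Picture m n, d.IsPictureOf p ∧ d.HeightLE l

/-! ### Chains -/

/-- The position of a vertex in the disk order `1 < 2 < ⋯ < m < n' < ⋯ < 2' < 1'`. -/
def diskPos : Fin m ⊕ Fin n → ℕ
  | Sum.inl a => a
  | Sum.inr b => m + n - 1 - b

/-- A chain of `p`: a sequence of pairs `(l₁, r₁), (l₂, r₂), …` of `p`, `l_t < r_t`, in which
consecutive pairs cross in the form `l_t < l_{t+1} < r_t < r_{t+1}`, all in the disk order. -/
def IsChain (p : BrauerPartition m n) (c : List ((Fin m ⊕ Fin n) × (Fin m ⊕ Fin n))) : Prop :=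
  (∀ e ∈ c, p.rel e.1 e.2 ∧ diskPos e.1 < diskPos e.2) ∧
  c.IsChain fun e f =>
    diskPos e.1 < diskPos f.1 ∧ diskPos f.1 < diskPos e.2 ∧ diskPos e.2 < diskPos f.2

/-- The chain starts at the vertex `v`. -/
def StartsAt (c : List ((Fin m ⊕ Fin n) × (Fin m ⊕ Fin n))) (v : Fin m ⊕ Fin n) : Prop :=
  c.head?.map Prod.fst = some v

/-- The chain ends at the vertex `v`. -/
def EndsAt (c : List ((Fin m ⊕ Fin n) × (Fin m ⊕ Fin n))) (v : Fin m ⊕ Fin n) : Prop :=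
  c.getLast?.map Prod.snd = some v

/-- The link region of consecutive pairs `e = (l_t, r_t)`, `f = (l_{t+1}, r_{t+1})` of a chain: the
disk interval `[l_{t+1}, r_t]`. -/
def linkRegion (e f : (Fin m ⊕ Fin n) × (Fin m ⊕ Fin n)) : Set (Fin m ⊕ Fin n) :=
  {v | diskPos f.1 ≤ diskPos v ∧ diskPos v ≤ diskPos e.2}

/-- Two chains are exclusive if they have no pair in common and the link regions of one are disjoint
from those of the other. -/
def Exclusive (c c' : List ((Fin m ⊕ Fin n) × (Fin m ⊕ Fin n))) : Prop :=
  c.Disjoint c' ∧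
  ∀ e f e' f', [e, f] <:+: c → [e', f'] <:+: c' → Disjoint (linkRegion e f) (linkRegion e' f')

/-- `p` is an `Li`-chain partition: there are `i` pairwise exclusive chains in `p` that start at
the vertices `1, …, i` and end in `{1', …, i'}`. -/
def IsLChain (i : ℕ) (p : BrauerPartition m n) : Prop :=
  ∃ c : Fin i → List ((Fin m ⊕ Fin n) × (Fin m ⊕ Fin n)),
    (∀ s, p.IsChain (c s)) ∧
    (∀ s, ∃ v : Fin m, v.1 = s.1 ∧ StartsAt (c s) (Sum.inl v)) ∧
    (∀ s, ∃ w : Fin n, w.1 < i ∧ EndsAt (c s) (Sum.inr w)) ∧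
    (∀ s s', s ≠ s' → Exclusive (c s) (c s'))

/-- The set `J^i_{≤ l}(m, n)` of `Li`-chain partitions of height at most `l`. -/
def chainSet (i : ℕ) (l : ℤ) (m n : ℕ) : Set (BrauerPartition m n) :=
  {p | p.IsLChain i ∧ p.HeightLE l}

end BrauerPartition

/-!
Reading the vertices in disk order turns a partition of `J(m, m)` into a fixed-point-free involution
`f` of the positions `0, …, 2 * m - 1` (`BrauerPartition.diskInv`). For a gap `g` between two
positions let `cover f g` be the number of pairs `{x, f x}` with `x < g ≤ f x`. The proof
characterizes both the generated subalgebra and the chain partitions of bounded height by this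
function: `f` is *tame* (`IsTame`) if `i ≤ cover f g` for `i ≤ g ≤ 2 * m - i`, and if
`cover f (f x) ≤ i + 1` whenever `x < z < f x < f z`.

**Chain partitions are tame.** Each of `i` disjoint chains contains a pair that covers a given gap
(`BrauerPartition.IsLChain.le_cover`). For the second condition consider a picture of height at
most `i - 1`, suppose that `x < z < f x < f z` and that at least `i + 2` pairs cover the gap in
front of `f x`, and let `X` be the last position before `f x` where one of these pairs opens. At `X`
the line of this pair has a region beside it that all these lines separate from the left edge, by
the parity of the number of their points to the left of a gap (`Picture.leftParity`). The line keeps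
this property and meets no crossing point, since all sectors there would be separated from the left
edge by too many lines (`Picture.Segment.separating_iff`). So its other end is a boundary position
beside which all these lines are open as well, which is only the case at `f x`; but `X ≥ z > x`.
This is `Picture.IsPictureOf.cover_le`.

**Tame matchings are chain partitions, once they have small height.** The chains start with the
pairs of the first `i` positions and are continued greedily: the next pair opens at the last
position, before the current pair closes, in front of which exactly `i` pairs are open
(`ChainStep`). Tameness makes this possible and makes each member of a chain determine the previous
one (`isLChain_of_isTame`).

**Products of generators are chain partitions.** Pictures of factors are stacked to a picture of the
product (`Picture.IsPictureOf.append`), which bounds the height, and right multiplication by a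
generator preserves the lower bound for the cover function.

**Tame matchings are products of generators without closed loops**
(`BrauerPartition.isGenerated_of_isTame`). Two moves undo right multiplications: an exchange of
neighbouring positions among the last `i + 1` undoes some `σ_j`, and a pair at positions `Q + 1`,
`Q + 2` can be moved to `Q`, `Q + 1` at the cost of one `U_j`. If some pair joins two bottom
vertices, these moves lead to a matching with the pair `{m, m + 1}` of positions
(`exists_bottomReduces`), and by reflection to one that has the pair `{m - 2, m - 1}` as well. One
more move of the second kind increases `cover f m`, the number of pairs between top and bottom. When
it equals `m`, the matching is a permutation of the first `i + 1` vertices, a product of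
`σ_1, …, σ_i`.
-/

namespace Brauer

/-! ### Fixed-point-free involutions of the disk positions -/

/-- A perfect matching of the positions `0, …, N - 1`, given by the map that sends each position to
its partner; the map is extended by the identity to all natural numbers. -/
structure IsDiskMatching (N : ℕ) (f : ℕ → ℕ) : Prop where
  invol : ∀ x, f (f x) = x
  lt : ∀ x, x < N → f x < N
  ne : ∀ x, x < N → f x ≠ x
  eq : ∀ x, N ≤ x → f x = x

/-- The number of pairs `{x, f x}` with `x < g ≤ f x`: those that separate the gap in front of
position `g` from the base point of the disk. -/
def cover (f : ℕ → ℕ) (g : ℕ) : ℕ := ((Finset.range g).filter fun x => g ≤ f x).card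

/-- The matchings that belong to the generated subalgebra, described by their cover function: at
least `i` pairs cover each gap between the first `i` and the last `i` positions, and where two pairs
cross, the one that closes first does so at a place covered by at most `i + 1` pairs. -/
structure IsTame (i N : ℕ) (f : ℕ → ℕ) : Prop where
  matching : IsDiskMatching N f
  le_cover : ∀ g, i ≤ g → g + i ≤ N → i ≤ cover f g
  cover_le : ∀ x z, x < z → z < f x → f x < f z → cover f (f x) ≤ i + 1

/-- The matching `f` read in the reversed order of the positions. -/
def reflect (N : ℕ) (f : ℕ → ℕ) (x : ℕ) : ℕ := if x < N then N - 1 - f (N - 1 - x) else x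

/-- The matching `f` with the positions `a` and `b` exchanged. -/
def conjSwap (a b : ℕ) (f : ℕ → ℕ) (x : ℕ) : ℕ := Equiv.swap a b (f (Equiv.swap a b x))

/-- The matching obtained from `f` by joining the partners of `P` and `P + 1`, and `P` with
`P + 1`. -/
def joinAt (f : ℕ → ℕ) (P x : ℕ) : ℕ :=
  if x = P then P + 1 else if x = P + 1 then P else
    if f x = P then f (P + 1) else if f x = P + 1 then f P else f x

section Cover

variable {i N : ℕ} {f : ℕ → ℕ}

theorem cover_le_self (f : ℕ → ℕ) (g : ℕ) : cover f g ≤ g :=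
  (Finset.card_filter_le _ _).trans (by simp)

theorem cover_succ_of_lt (hf : ∀ x, f (f x) = x) {x : ℕ} (h : x < f x) :
    cover f (x + 1) = cover f x + 1 := by
  unfold cover
  have : ((Finset.range (x + 1)).filter fun y => x + 1 ≤ f y) =
      insert x ((Finset.range x).filter fun y => x ≤ f y) := by
    ext y
    have := hf y
    simp only [Finset.mem_filter, Finset.mem_range, Finset.mem_insert]
    grind
  rw [this, Finset.card_insert_of_notMem (by simp)]

theorem cover_succ_of_gt (hf : ∀ x, f (f x) = x) {x : ℕ} (h : f x < x) :
    cover f x = cover f (x + 1) + 1 := by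
  unfold cover
  have : ((Finset.range x).filter fun y => x ≤ f y) =
      insert (f x) ((Finset.range (x + 1)).filter fun y => x + 1 ≤ f y) := by
    ext y
    have := hf y
    have := hf x
    simp only [Finset.mem_filter, Finset.mem_range, Finset.mem_insert]
    grind
  rw [this, Finset.card_insert_of_notMem (by simp [hf])]

/-- The cover function counted by the closing ends of the pairs. -/
theorem IsDiskMatching.cover_eq_right (hf : IsDiskMatching N f) {g : ℕ} (hg : g ≤ N) :
    cover f g = ((Finset.Ico g N).filter fun y => f y < g).card := by
  unfold cover
  refine Finset.card_bij' (fun x _ => f x) (fun x _ => f x) ?_ ?_ (fun x _ => hf.invol x)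
    (fun x _ => hf.invol x)
  · intro x hx
    simp only [Finset.mem_filter, Finset.mem_range, Finset.mem_Ico, hf.invol] at hx ⊢
    exact ⟨⟨hx.2, hf.lt x (by omega)⟩, hx.1⟩
  · intro x hx
    simp only [Finset.mem_filter, Finset.mem_range, Finset.mem_Ico, hf.invol] at hx ⊢
    omega

/-- The cover function does not change when positions on the same side of the gap are permuted. -/
theorem cover_congr_of_perm (s : Equiv.Perm ℕ) (f : ℕ → ℕ) {g : ℕ} (hs : ∀ x, s (s x) = x)
    (h : ∀ x, s x < g ↔ x < g) : cover (fun x => s (f (s x))) g = cover f g := by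
  unfold cover
  refine Finset.card_bij' (fun x _ => s x) (fun x _ => s x) ?_ ?_ (fun x _ => hs x)
    (fun x _ => hs x)
  · intro x hx
    simp only [Finset.mem_filter, Finset.mem_range] at hx ⊢
    have := h x
    have := h (f (s x))
    omega
  · intro x hx
    simp only [Finset.mem_filter, Finset.mem_range, hs] at hx ⊢
    have := h x
    have := h (f x)
    omega

/-- No pair joins two of the first `i` positions, since `i` pairs cover the gap behind them. -/
theorem IsTame.first_lt (hf : IsTame i N f) (hi : 2 * i ≤ N) {x : ℕ} (hx : x < i) : i ≤ f x := by
  have h1 := hf.le_cover i le_rfl (by omega)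
  unfold cover at h1
  have h2 := Finset.filter_card_eq (s := Finset.range i) (p := fun x => i ≤ f x)
    (le_antisymm (Finset.card_filter_le _ _) (by simpa using h1))
  exact h2 x (Finset.mem_range.2 hx)

theorem IsTame.last_lt (hf : IsTame i N f) (hi : 2 * i ≤ N) {x : ℕ} (hx : N - i ≤ x) (hN : x < N) :
    f x < N - i := by
  have h1 := hf.le_cover (N - i) (by omega) (by omega)
  rw [hf.matching.cover_eq_right (by omega)] at h1
  have h2 := Finset.filter_card_eq (s := Finset.Ico (N - i) N) (p := fun x => f x < N - i)
    (le_antisymm (Finset.card_filter_le _ _) (by rw [Nat.card_Ico]; omega))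
  exact h2 x (Finset.mem_Ico.2 ⟨hx, hN⟩)

/-- The mirror image of the crossing condition: where two pairs cross, the one that opens last does
so at a place covered by at most `i + 1` pairs. -/
theorem IsTame.cover_le_open (hf : IsTame i N f) {x z : ℕ} (h1 : x < z) (h2 : z < f x)
    (h3 : f x < f z) : cover f (z + 1) ≤ i + 1 := by
  by_contra hc
  obtain ⟨u, hu, hmin⟩ := Finset.exists_min_image
    ((Finset.range (z + 1)).filter fun x => z + 1 ≤ f x) f
    ⟨z, by simp only [Finset.mem_filter, Finset.mem_range]; omega⟩
  simp only [Finset.mem_filter, Finset.mem_range] at hu hmin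
  have h4 := hmin x (by omega)
  have h5 : u ≠ z := by rintro rfl; omega
  have h6 := hf.cover_le u z (by omega) (by omega) (by omega)
  have h7 : cover f (z + 1) ≤ cover f (f u) := by
    unfold cover
    apply Finset.card_le_card
    intro w hw
    simp only [Finset.mem_filter, Finset.mem_range] at hw ⊢
    exact ⟨by omega, hmin w hw⟩
  omega

theorem reflect_of_lt {x : ℕ} (h : x < N) : reflect N f x = N - 1 - f (N - 1 - x) := if_pos h

theorem IsDiskMatching.reflect (hf : IsDiskMatching N f) : IsDiskMatching N (reflect N f) where
  invol x := by
    by_cases h : x < N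
    · have h1 := hf.lt (N - 1 - x) (by omega)
      rw [reflect_of_lt h, reflect_of_lt (by omega),
        show N - 1 - (N - 1 - f (N - 1 - x)) = f (N - 1 - x) by omega, hf.invol]
      omega
    · simp [Brauer.reflect, h]
  lt x h := by rw [reflect_of_lt h]; omega
  ne x h := by
    have h1 := hf.lt (N - 1 - x) (by omega)
    have h2 := hf.ne (N - 1 - x) (by omega)
    rw [reflect_of_lt h]; omega
  eq x h := if_neg (by omega)

theorem IsDiskMatching.reflect_reflect (hf : IsDiskMatching N f) :
    Brauer.reflect N (Brauer.reflect N f) = f := by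
  funext x
  by_cases h : x < N
  · have h1 := hf.lt x h
    rw [reflect_of_lt h, reflect_of_lt (by omega), show N - 1 - (N - 1 - x) = x by omega]
    omega
  · rw [hf.reflect.reflect.eq x (by omega), hf.eq x (by omega)]

theorem IsDiskMatching.cover_reflect (hf : IsDiskMatching N f) {g : ℕ} (hg : g ≤ N) :
    cover (Brauer.reflect N f) g = cover f (N - g) := by
  rw [hf.cover_eq_right (by omega)]
  unfold cover
  refine Finset.card_bij' (fun x _ => N - 1 - x) (fun x _ => N - 1 - x) ?_ ?_ ?_ ?_
  · intro x hx
    simp only [Finset.mem_filter, Finset.mem_range, Finset.mem_Ico] at hx ⊢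
    rw [reflect_of_lt (by omega)] at hx
    have h1 := hf.lt (N - 1 - x) (by omega)
    omega
  · intro x hx
    simp only [Finset.mem_filter, Finset.mem_range, Finset.mem_Ico] at hx ⊢
    rw [reflect_of_lt (by omega), show N - 1 - (N - 1 - x) = x by omega]
    omega
  · intro x hx
    simp only [Finset.mem_filter, Finset.mem_range] at hx
    omega
  · intro x hx
    simp only [Finset.mem_filter, Finset.mem_Ico] at hx
    omega

theorem IsTame.reflect (hf : IsTame i N f) : IsTame i N (reflect N f) where
  matching := hf.matching.reflect
  le_cover g h1 h2 := by
    rw [hf.matching.cover_reflect (by omega)]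
    exact hf.le_cover _ (by omega) (by omega)
  cover_le x z h1 h2 h3 := by
    have hr := hf.matching.reflect
    have hz : z < N := by
      by_contra h
      rw [hr.eq z (by omega)] at h3
      omega
    have e1 := reflect_of_lt (f := f) (show x < N by omega)
    have e2 := reflect_of_lt (f := f) hz
    have l1 := hf.matching.lt (N - 1 - x) (by omega)
    have l2 := hf.matching.lt (N - 1 - z) (by omega)
    have i1 := hf.matching.invol (N - 1 - x)
    have i2 := hf.matching.invol (N - 1 - z)
    rw [hf.matching.cover_reflect (by omega), e1,
      show N - (N - 1 - f (N - 1 - x)) = f (N - 1 - x) + 1 by omega]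
    apply hf.cover_le_open (x := f (N - 1 - z)) <;> omega

end Cover

end Brauer

namespace Brauer

/-! ### Moves of matchings -/

section Moves

variable {i N : ℕ} {f : ℕ → ℕ}

theorem IsDiskMatching.conjSwap (hf : IsDiskMatching N f) {a b : ℕ} (ha : a < N) (hb : b < N) :
    IsDiskMatching N (conjSwap a b f) := by
  have hs : ∀ x, Equiv.swap a b x < N ↔ x < N := by
    intro x
    rw [Equiv.swap_apply_def]
    grind
  refine ⟨fun x => ?_, fun x h => (hs _).2 (hf.lt _ ((hs x).2 h)), fun x h e => ?_, fun x h => ?_⟩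
  · simp [Brauer.conjSwap, hf.invol]
  · refine hf.ne _ ((hs x).2 h) ?_
    have := congrArg (Equiv.swap a b) e
    simpa [Brauer.conjSwap] using this
  · have h1 : ¬ Equiv.swap a b x < N := by rw [hs]; omega
    simp [Brauer.conjSwap, hf.eq _ (not_lt.1 h1)]

theorem cover_conjSwap (f : ℕ → ℕ) {a b g : ℕ} (h : a < g ↔ b < g) :
    cover (conjSwap a b f) g = cover f g := by
  refine cover_congr_of_perm (Equiv.swap a b) f (fun x => by simp) fun x => ?_
  rw [Equiv.swap_apply_def]
  grind

/-- Exchanging two neighbouring positions among the last `i + 1` preserves tameness. -/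
theorem IsTame.conjSwap_succ (hf : IsTame i N f) (hi : 2 * i ≤ N) {P : ℕ} (h1 : N ≤ P + 1 + i)
    (h2 : P + 1 < N) (h3 : N ≤ 2 * P) : IsTame i N (conjSwap P (P + 1) f) := by
  have hm := hf.matching.conjSwap (a := P) (b := P + 1) (by omega) h2
  have c1 : f (P + 1) < P := by
    have := hf.last_lt hi (x := P + 1) (by omega) h2
    rcases Nat.lt_or_ge (f (P + 1)) P with h | h
    · exact h
    · -- otherwise `P` opens a pair at a place covered by fewer than `i` pairs
      exfalso
      have e : f (P + 1) = P := by omega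
      have e' : f P = P + 1 := by simpa [e] using hf.matching.invol (P + 1)
      have k1 := cover_succ_of_lt hf.matching.invol (x := P) (by omega)
      have k2 := hf.le_cover P (by omega) (by omega)
      have k3 := hf.matching.cover_eq_right (g := P + 1) (by omega)
      have k4 := Finset.card_filter_le (Finset.Ico (P + 1) N) fun y => f y < P + 1
      rw [Nat.card_Ico] at k4
      omega
  have c0 : f P < P := by
    have hP := hf.matching.ne P (by omega)
    rcases Nat.lt_or_ge (f P) P with h | h
    · exact h
    · exfalso
      rcases Nat.lt_or_ge P (N - i) with h' | h'
      · have k1 := cover_succ_of_lt hf.matching.invol (x := P) (by omega)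
        have k2 := hf.le_cover P (by omega) (by omega)
        have k3 := hf.matching.cover_eq_right (g := P + 1) (by omega)
        have k4 := Finset.card_filter_le (Finset.Ico (P + 1) N) fun y => f y < P + 1
        rw [Nat.card_Ico] at k4
        omega
      · have := hf.last_lt hi h' (by omega)
        omega
  have hlt : ∀ x < P, Equiv.swap P (P + 1) x = x := fun x hx =>
    Equiv.swap_apply_of_ne_of_ne (by omega) (by omega)
  have d0 : conjSwap P (P + 1) f P = f (P + 1) := by
    simp [conjSwap, hlt _ c1]
  have hcov : ∀ g, cover (conjSwap P (P + 1) f) g = cover f g := by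
    intro g
    by_cases hg : g = P + 1
    · subst hg
      have k1 := cover_succ_of_gt hm.invol (x := P) (by omega)
      have k2 := cover_succ_of_gt hf.matching.invol c0
      have k3 := cover_conjSwap f (a := P) (b := P + 1) (g := P) (by omega)
      omega
    · exact cover_conjSwap f (by omega)
  refine ⟨hm, fun g => by rw [hcov]; exact hf.le_cover g, fun x z e1 e2 e3 => ?_⟩
  rw [hcov]
  have hxN : conjSwap P (P + 1) f x < N := by
    by_contra h
    have := hm.invol x
    rw [hm.eq _ (not_lt.1 h)] at this
    omega
  rcases Nat.lt_or_ge (conjSwap P (P + 1) f x) P with h | h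
  · have hxP : x < P := by omega
    have hx : conjSwap P (P + 1) f x = f x := by
      unfold conjSwap at h ⊢
      rw [hlt x hxP] at h ⊢
      rw [Equiv.swap_apply_def] at h ⊢
      grind
    rw [hx] at e2 e3 h ⊢
    refine hf.cover_le x z e1 e2 ?_
    unfold conjSwap at e3
    rw [hlt z (by omega), Equiv.swap_apply_def] at e3
    grind
  · rw [hf.matching.cover_eq_right (by omega)]
    refine (Finset.card_filter_le _ _).trans ?_
    rw [Nat.card_Ico]
    omega

/-- Let `Q + 1`, `Q + 2` be a pair. Moving it in front of position `Q` preserves tameness. -/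
theorem IsTame.shift (hf : IsTame i N f) {Q : ℕ} (h1 : i ≤ Q) (h2 : Q + 2 < N)
    (h3 : Q + i ≤ N) (h : f (Q + 1) = Q + 2) : IsTame i N (conjSwap Q (Q + 2) f) := by
  have hm := hf.matching.conjSwap (a := Q) (b := Q + 2) (by omega) h2
  have h' : f (Q + 2) = Q + 1 := by rw [← h, hf.matching.invol]
  have hne : f Q ≠ Q ∧ f Q ≠ Q + 1 ∧ f Q ≠ Q + 2 := by
    have := hf.matching.invol Q
    exact ⟨hf.matching.ne Q (by omega), by grind, by grind⟩
  have d0 : conjSwap Q (Q + 2) f Q = Q + 1 := by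
    simp [conjSwap, h', Equiv.swap_apply_of_ne_of_ne]
  have d1 : conjSwap Q (Q + 2) f (Q + 1) = Q := by
    simpa [d0] using hm.invol Q
  have d2 : conjSwap Q (Q + 2) f (Q + 2) = f Q := by
    simp [conjSwap, Equiv.swap_apply_of_ne_of_ne hne.1 hne.2.2]
  have d3 : ∀ x, x ≠ Q → x ≠ Q + 1 → x ≠ Q + 2 → x ≠ f Q →
      conjSwap Q (Q + 2) f x = f x := by
    intro x x1 x2 x3 x4
    have := hf.matching.invol x
    unfold conjSwap
    rw [Equiv.swap_apply_of_ne_of_ne x1 x3, Equiv.swap_apply_of_ne_of_ne] <;> grind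
  have d4 : conjSwap Q (Q + 2) f (f Q) = Q + 2 := by rw [← d2, hm.invol]
  have k0 : ∀ g, g ≤ Q ∨ Q + 3 ≤ g → cover (conjSwap Q (Q + 2) f) g = cover f g :=
    fun g hg => cover_conjSwap f (by omega)
  have k1 := cover_succ_of_lt hm.invol (x := Q) (by omega)
  have k2 : cover (conjSwap Q (Q + 2) f) (Q + 1) = cover (conjSwap Q (Q + 2) f) (Q + 2) + 1 :=
    cover_succ_of_gt hm.invol (by omega)
  have k3 := k0 Q (Or.inl le_rfl)
  refine ⟨hm, fun g e1 e2 => ?_, fun x z e1 e2 e3 => ?_⟩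
  · have := hf.le_cover Q h1 h3
    by_cases g1 : g = Q + 1
    · subst g1; omega
    by_cases g2 : g = Q + 2
    · subst g2; omega
    rw [k0 g (by omega)]
    exact hf.le_cover g e1 e2
  · have hi1 := hf.matching.invol x
    have hi2 := hf.matching.invol z
    -- the short pair crosses nothing
    have x1 : x ≠ Q := by rintro rfl; omega
    have x2 : x ≠ Q + 1 := by rintro rfl; omega
    have z1 : z ≠ Q + 1 := by rintro rfl; omega
    have z2 : z ≠ Q := by rintro rfl; omega
    by_cases x3 : x = Q + 2
    · subst x3
      rw [d2] at e2 e3 ⊢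
      rw [d3 z z2 z1 (by omega) (by omega)] at e3
      rw [k0 _ (by omega)]
      exact hf.cover_le Q z (by omega) e2 e3
    by_cases x4 : x = f Q
    · subst x4
      rw [d4] at e2 e3 ⊢
      rw [d3 z z2 z1 (by omega) (by omega)] at e3
      have := hf.cover_le (f Q) z e1 (by rw [hf.matching.invol]; omega)
        (by rw [hf.matching.invol]; omega)
      rw [hf.matching.invol] at this
      omega
    have hx := d3 x x1 x2 x3 x4
    have hfx : f x ≠ Q ∧ f x ≠ Q + 1 ∧ f x ≠ Q + 2 := by grind
    rw [hx] at e2 e3 ⊢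
    rw [k0 _ (by omega)]
    by_cases z3 : z = Q + 2
    · subst z3
      rw [d2] at e3
      exact hf.cover_le x Q (by omega) (by omega) e3
    by_cases z4 : z = f Q
    · subst z4
      rw [d4] at e3
      exact hf.cover_le x (f Q) e1 e2 (by rw [hf.matching.invol]; omega)
    rw [d3 z z2 z1 z3 z4] at e3
    exact hf.cover_le x z e1 e2 e3

theorem IsDiskMatching.joinAt (hf : IsDiskMatching N f) {P : ℕ} (hP : P + 1 < N) :
    IsDiskMatching N (joinAt f P) := by
  have h1 := hf.lt P (by omega)
  have h2 := hf.lt (P + 1) hP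
  have h3 := hf.invol P
  have h4 := hf.invol (P + 1)
  have h5 := hf.ne P (by omega)
  have h6 := hf.ne (P + 1) hP
  refine ⟨fun x => ?_, fun x h => ?_, fun x h => ?_, fun x h => ?_⟩
  · have := hf.invol x
    unfold Brauer.joinAt
    grind
  · have := hf.lt x h
    unfold Brauer.joinAt
    grind
  · have := hf.ne x h
    have := hf.invol x
    unfold Brauer.joinAt
    grind
  · have := hf.eq x h
    unfold Brauer.joinAt
    grind

theorem IsDiskMatching.joinAt_reflect (hf : IsDiskMatching N f) {P : ℕ} (hP : P + 1 < N) :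
    Brauer.joinAt (Brauer.reflect N f) (N - 2 - P) =
      Brauer.reflect N (Brauer.joinAt f P) := by
  funext x
  have h1 := hf.lt P (by omega)
  have h2 := hf.lt (P + 1) hP
  by_cases hx : x < N
  · have h3 := hf.lt (N - 1 - x) (by omega)
    rw [reflect_of_lt hx]
    unfold Brauer.joinAt
    rw [reflect_of_lt hx, reflect_of_lt (by omega), reflect_of_lt (by omega),
      show N - 1 - (N - 2 - P + 1) = P by omega, show N - 1 - (N - 2 - P) = P + 1 by omega]
    split_ifs <;> omega
  · rw [(hf.joinAt hP).reflect.eq x (by omega),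
      (hf.reflect.joinAt (by omega)).eq x (by omega)]

/-- The part of `IsTame.le_cover_joinAt` on the gaps up to position `P`. -/
theorem IsTame.le_cover_joinAt_of_le (hf : IsTame i N f) {P g : ℕ} (hP : P + 2 + i ≤ N)
    (hiP : i ≤ P) (hg : i ≤ g) (hgP : g ≤ P) : i ≤ cover (joinAt f P) g := by
  have hN := hf.le_cover g hg (by omega)
  have hI := hf.matching.invol
  by_cases hc : f P < g ∧ f (P + 1) < g
  · -- two pairs over the gap are lost, but the gap lay under at least `i + 2` pairs
    have hbig : i + 2 ≤ cover f g := by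
      have k1 := cover_succ_of_gt hI (x := P) (by omega)
      have k2 : cover f (P + 1) = cover f (P + 2) + 1 := cover_succ_of_gt hI (by omega)
      have k3 := hf.le_cover (P + 2) (by omega) (by omega)
      have k4 : cover f P ≤ cover f g := by
        apply Finset.card_le_card
        intro x hx
        simp only [Finset.mem_filter, Finset.mem_range] at hx ⊢
        refine ⟨?_, by omega⟩
        by_contra hxg
        have h1 : f x ≠ P := by intro e; rw [← e, hI] at hc; omega
        have h2 := hf.cover_le (f P) x (by omega) (by rw [hI]; omega) (by rw [hI]; omega)
        rw [hI] at h2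
        omega
      omega
    have hsub : ((Finset.range g).filter fun x => g ≤ f x) \ {f P, f (P + 1)} ⊆
        (Finset.range g).filter fun x => g ≤ joinAt f P x := by
      intro x hx
      simp only [Finset.mem_filter, Finset.mem_range, Finset.mem_sdiff, Finset.mem_insert,
        Finset.mem_singleton] at hx ⊢
      have := hI x
      unfold joinAt
      grind
    have h1 := Finset.card_le_card hsub
    have h2 := Finset.le_card_sdiff {f P, f (P + 1)} ((Finset.range g).filter fun x => g ≤ f x)
    have h3 := Finset.card_le_two (a := f P) (b := f (P + 1))
    unfold cover at hbig ⊢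
    omega
  · refine hN.trans (Finset.card_le_card ?_)
    intro x hx
    simp only [Finset.mem_filter, Finset.mem_range] at hx ⊢
    have := hI x
    unfold joinAt
    grind

/-- Joining neighbouring positions, neither among the first nor among the last `i`, keeps the lower
bound for the cover function. -/
theorem IsTame.le_cover_joinAt (hf : IsTame i N f) {P g : ℕ} (hP : P + 2 + i ≤ N)
    (hiP : i ≤ P) (hg : i ≤ g) (hgN : g + i ≤ N) : i ≤ cover (joinAt f P) g := by
  rcases Nat.lt_or_ge g (P + 1) with h | h
  · exact hf.le_cover_joinAt_of_le hP hiP hg (by omega)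
  rcases Nat.lt_or_ge (P + 1) g with h' | h'
  · have h1 := hf.reflect.le_cover_joinAt_of_le (P := N - 2 - P) (g := N - g) (by omega)
      (by omega) (by omega) (by omega)
    rw [hf.matching.joinAt_reflect (by omega),
      (hf.matching.joinAt (by omega)).cover_reflect (by omega)] at h1
    rwa [show N - (N - g) = g by omega] at h1
  · have e : g = P + 1 := by omega
    have h1 := hf.le_cover_joinAt_of_le hP hiP hiP le_rfl
    have h2 := cover_succ_of_lt (hf.matching.joinAt (P := P) (by omega)).invol (x := P)
      (by simp [joinAt])
    rw [e]
    omega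

end Moves

end Brauer

namespace BrauerPartition

/-! ### Brauer partitions as matchings of the disk positions -/

section DiskInv

variable {m n : ℕ}

/-- The vertices in the disk order. -/
def diskEquiv (m n : ℕ) : Fin m ⊕ Fin n ≃ Fin (m + n) :=
  (Equiv.sumCongr (Equiv.refl _) Fin.revPerm).trans finSumFinEquiv

theorem diskEquiv_val (v : Fin m ⊕ Fin n) : (diskEquiv m n v : ℕ) = diskPos v := by
  rcases v with v | v
  · simp [diskEquiv, diskPos]
  · simp [diskEquiv, diskPos, Fin.val_rev]
    omega

theorem diskPos_lt (v : Fin m ⊕ Fin n) : diskPos v < m + n := by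
  rw [← diskEquiv_val]
  exact (diskEquiv m n v).2

theorem diskPos_injective : Function.Injective (diskPos : Fin m ⊕ Fin n → ℕ) := by
  intro v w h
  rw [← diskEquiv_val, ← diskEquiv_val] at h
  exact (diskEquiv m n).injective (Fin.ext h)

theorem exists_diskPos {x : ℕ} (h : x < m + n) : ∃ v : Fin m ⊕ Fin n, diskPos v = x :=
  ⟨(diskEquiv m n).symm ⟨x, h⟩, by rw [← diskEquiv_val]; simp⟩

/-- The vertex paired with `v`. -/
noncomputable def partner (p : BrauerPartition m n) (v : Fin m ⊕ Fin n) : Fin m ⊕ Fin n :=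
  (p.pairing v).choose

theorem rel_iff_partner (p : BrauerPartition m n) (v w : Fin m ⊕ Fin n) :
    p.rel v w ↔ w = v ∨ w = p.partner v := by
  have h := (p.pairing v).choose_spec
  constructor
  · intro hr
    by_cases hw : w = v
    · exact Or.inl hw
    · exact Or.inr (h.2 w ⟨hw, hr⟩)
  · rintro (rfl | rfl)
    · exact p.rel.refl' _
    · exact h.1.2

theorem partner_ne (p : BrauerPartition m n) (v : Fin m ⊕ Fin n) : p.partner v ≠ v :=
  (p.pairing v).choose_spec.1.1

theorem partner_partner (p : BrauerPartition m n) (v : Fin m ⊕ Fin n) :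
    p.partner (p.partner v) = v := by
  have h1 : p.rel (p.partner v) v := p.rel.symm' ((p.rel_iff_partner _ _).2 (Or.inr rfl))
  rcases (p.rel_iff_partner _ _).1 h1 with h | h
  · exact absurd h.symm (p.partner_ne v)
  · exact h.symm

/-- The matching of the disk positions defined by a Brauer partition. -/
noncomputable def diskInv (p : BrauerPartition m n) (x : ℕ) : ℕ :=
  if h : x < m + n then diskPos (p.partner ((diskEquiv m n).symm ⟨x, h⟩)) else x

theorem diskInv_diskPos (p : BrauerPartition m n) (v : Fin m ⊕ Fin n) :
    p.diskInv (diskPos v) = diskPos (p.partner v) := by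
  unfold diskInv
  rw [dif_pos (diskPos_lt v)]
  congr 2
  rw [Equiv.symm_apply_eq]
  exact Fin.ext (diskEquiv_val v).symm

theorem rel_iff (p : BrauerPartition m n) (v w : Fin m ⊕ Fin n) :
    p.rel v w ↔ w = v ∨ p.diskInv (diskPos v) = diskPos w := by
  rw [rel_iff_partner, diskInv_diskPos, diskPos_injective.eq_iff, eq_comm (b := w)]

theorem isDiskMatching_diskInv (p : BrauerPartition m n) : IsDiskMatching (m + n) p.diskInv where
  invol x := by
    by_cases h : x < m + n
    · obtain ⟨v, rfl⟩ := exists_diskPos h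
      rw [diskInv_diskPos, diskInv_diskPos, partner_partner]
    · simp [diskInv, h]
  lt x h := by
    obtain ⟨v, rfl⟩ := exists_diskPos h
    rw [diskInv_diskPos]
    exact diskPos_lt _
  ne x h := by
    obtain ⟨v, rfl⟩ := exists_diskPos h
    rw [diskInv_diskPos]
    exact fun e => p.partner_ne v (diskPos_injective e)
  eq x h := dif_neg (not_lt.2 h)

theorem ext_diskInv {p q : BrauerPartition m n} (h : p.diskInv = q.diskInv) : p = q := by
  ext v w
  rw [rel_iff, rel_iff, h]

/-- A matching is that of `p` as soon as all its pairs are pairs of `p`. -/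
theorem diskInv_eq {p : BrauerPartition m n} {f : ℕ → ℕ} (hf : IsDiskMatching (m + n) f)
    (h : ∀ v w, f (diskPos v) = diskPos w → p.rel v w) : p.diskInv = f := by
  funext x
  by_cases hx : x < m + n
  · obtain ⟨v, rfl⟩ := exists_diskPos hx
    obtain ⟨w, hw⟩ := exists_diskPos (hf.lt _ hx)
    rcases (p.rel_iff v w).1 (h v w hw.symm) with rfl | e
    · exact absurd hw.symm (hf.ne _ hx)
    · rw [e, hw]
  · rw [hf.eq x (by omega), p.isDiskMatching_diskInv.eq x (by omega)]

end DiskInv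

/-! ### Reflection in a horizontal axis -/

section Flip

variable {X Y A B C : Type}

theorem comap_equiv_eq_map (r : Setoid Y) (e : X ≃ Y) : r.comap e = r.map e.symm := by
  apply le_antisymm
  · intro x y h
    simpa using map_rel r e.symm h
  · rw [map_le_iff]
    intro x y h
    simpa [Setoid.comap_rel] using h

/-- The glued diagram upside down. -/
def turn : A ⊕ (B ⊕ C) ≃ C ⊕ (B ⊕ A) :=
  (Equiv.sumComm _ _).trans
    ((Equiv.sumCongr (Equiv.sumComm _ _) (Equiv.refl _)).trans (Equiv.sumAssoc _ _ _))

theorem glue_swap (p : Setoid (A ⊕ B)) (q : Setoid (B ⊕ C)) :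
    glue (q.comap (Equiv.sumComm C B)) (p.comap (Equiv.sumComm B A)) = (glue p q).map turn := by
  unfold glue
  rw [map_sup, map_map, map_map, comap_equiv_eq_map, comap_equiv_eq_map, map_map, map_map, sup_comm]
  congr 2
  funext x
  rcases x with x | x <;> rfl

theorem comp_swap (p : Setoid (A ⊕ B)) (q : Setoid (B ⊕ C)) :
    comp (q.comap (Equiv.sumComm C B)) (p.comap (Equiv.sumComm B A)) =
      (comp p q).comap (Equiv.sumComm C A) := by
  unfold comp
  rw [glue_swap]
  ext v w
  have h : ∀ v : C ⊕ A, outer v = turn (outer (Sum.swap v) : A ⊕ (B ⊕ C)) := by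
    rintro (v | v) <;> rfl
  rw [Setoid.comap_rel, Setoid.comap_rel, Setoid.comap_rel, h, h]
  conv_rhs => rw [← Setoid.comap_map_eq turn (glue p q) turn.injective]
  rfl

theorem loops_swap (p : Setoid (A ⊕ B)) (q : Setoid (B ⊕ C)) :
    Brauer.loops (q.comap (Equiv.sumComm C B)) (p.comap (Equiv.sumComm B A)) =
      Brauer.loops p q := by
  unfold Brauer.loops
  rw [glue_swap]
  apply freeClasses_map (i := Equiv.sumComm A C)
  · exact turn.injective
  · rintro (w | w) <;> rfl
  · rintro z y h
    refine ⟨Sum.swap y, ?_, by simp⟩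
    apply (turn (A := A) (B := B) (C := C)).injective
    rw [h]
    rcases y with y | y <;> rfl
  · intro x
    exact Or.inl ⟨turn.symm x, by simp⟩

variable {l m n : ℕ}

/-- The partition with top and bottom exchanged. -/
def flip (p : BrauerPartition m n) : BrauerPartition n m where
  rel := p.rel.comap (Equiv.sumComm _ _)
  pairing v := by
    obtain ⟨w, ⟨h1, h2⟩, h3⟩ := p.pairing (Sum.swap v)
    refine ⟨Sum.swap w, ⟨?_, ?_⟩, ?_⟩
    · rintro rfl
      simp at h1
    · change p.rel (Sum.swap v) (Sum.swap (Sum.swap w))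
      simpa using h2
    · rintro u ⟨h4, h5⟩
      rw [← h3 (Sum.swap u) ⟨fun h => h4 (Sum.swap_leftInverse.injective h), h5⟩]
      simp

theorem flip_rel (p : BrauerPartition m n) (v w) :
    p.flip.rel v w ↔ p.rel (Sum.swap v) (Sum.swap w) := Iff.rfl

theorem flip_mul (p : BrauerPartition l m) (q : BrauerPartition m n) :
    (p.mul q).flip = q.flip.mul p.flip :=
  BrauerPartition.ext (comp_swap p.rel q.rel).symm

theorem loops_flip (p : BrauerPartition l m) (q : BrauerPartition m n) :
    q.flip.loops p.flip = p.loops q := loops_swap p.rel q.rel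

theorem diskPos_swap (v : Fin m ⊕ Fin n) : diskPos (Sum.swap v) = m + n - 1 - diskPos v := by
  rcases v with ⟨v, hv⟩ | ⟨v, hv⟩
  · simp [diskPos]; omega
  · simp [diskPos]; omega

theorem diskInv_flip (p : BrauerPartition m m) : p.flip.diskInv = reflect (m + m) p.diskInv := by
  refine diskInv_eq p.isDiskMatching_diskInv.reflect fun v w h => ?_
  rw [flip_rel, rel_iff]
  right
  have h1 := diskPos_lt v
  have h2 := p.isDiskMatching_diskInv.lt (m + m - 1 - diskPos v) (by omega)
  rw [reflect_of_lt h1] at h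
  rw [diskPos_swap, diskPos_swap, ← h]
  omega

theorem flip_one (m : ℕ) : (one m).flip = one m := by
  ext v w
  rcases v with v | v <;> rcases w with w | w <;> exact Iff.rfl

theorem flip_sigma (j : ℕ) (h1 : 1 ≤ j) (h2 : j < m) : (sigma j h1 h2).flip = sigma j h1 h2 := by
  ext v w
  change (_ ∨ _) ↔ (_ ∨ _)
  rcases v with v | v <;> rcases w with w | w <;> simp

theorem flip_cupCap (j : ℕ) (h1 : 1 ≤ j) (h2 : j < m) :
    (cupCap j h1 h2).flip = cupCap j h1 h2 := by
  ext v w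
  change (_ ∨ _) ↔ (_ ∨ _)
  rcases v with v | v <;> rcases w with w | w <;> simp only [Equiv.sumComm_apply, Sum.swap_inl,
    Sum.swap_inr, cupCapPartner] <;> split_ifs <;> simp

end Flip

/-! ### Multiplication by a generator -/

section MulGenerator

variable {l m : ℕ}

theorem glue_left {A B C : Type} {p : Setoid (A ⊕ B)} (q : Setoid (B ⊕ C)) {v w : A ⊕ B}
    (h : p v w) : glue p q (Sum.map id Sum.inl v) (Sum.map id Sum.inl w) :=
  (le_sup_left : _ ≤ glue p q) (map_rel p _ h)

theorem glue_right {A B C : Type} (p : Setoid (A ⊕ B)) {q : Setoid (B ⊕ C)} {v w : B ⊕ C}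
    (h : q v w) : glue p q (Sum.inr v) (Sum.inr w) :=
  (le_sup_right : _ ≤ glue p q) (map_rel q _ h)

/-- There are no closed loops if each middle point is joined to an outer point. -/
theorem loops_eq_zero {A B C : Type} {p : Setoid (A ⊕ B)} {q : Setoid (B ⊕ C)}
    (h : ∀ b : B, ∃ v, glue p q (Sum.inr (Sum.inl b)) (outer v)) : Brauer.loops p q = 0 := by
  unfold Brauer.loops freeClasses
  rw [Nat.card_eq_zero]
  left
  refine ⟨fun ⟨c, hc⟩ => ?_⟩
  induction c using Quotient.inductionOn with
  | h x =>
  rcases x with x | x | x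
  · exact hc (Sum.inl x) rfl
  · obtain ⟨v, hv⟩ := h x
    exact hc v (Quotient.sound (Setoid.symm' _ hv))
  · exact hc (Sum.inr x) rfl

theorem sigma_rel (j : ℕ) (h1 : 1 ≤ j) (h2 : j < m) (b : Fin m) :
    (sigma j h1 h2).rel (Sum.inl (Equiv.swap (⟨j - 1, by omega⟩ : Fin m) ⟨j, h2⟩ b))
      (Sum.inr b) := by
  right
  simp

theorem diskInv_mul_sigma (p : BrauerPartition l m) (j : ℕ) (h1 : 1 ≤ j) (h2 : j < m) :
    (p.mul (sigma j h1 h2)).diskInv =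
      conjSwap (l + m - j - 1) (l + m - j - 1 + 1) p.diskInv := by
  have hp := p.isDiskMatching_diskInv
  let s : Fin l ⊕ Fin m → Fin l ⊕ Fin m :=
    Sum.map id (Equiv.swap (⟨j - 1, by omega⟩ : Fin m) ⟨j, h2⟩)
  have hs : ∀ v, diskPos (s v) =
      Equiv.swap (l + m - j - 1) (l + m - j - 1 + 1) (diskPos v) := by
    rintro (v | v)
    · have := v.2
      rw [Equiv.swap_apply_of_ne_of_ne] <;> simp [s, diskPos] <;> omega
    · have := v.2
      simp only [s, diskPos, Sum.map_inr, Equiv.swap_apply_def, Fin.ext_iff]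
      split_ifs <;> simp at * <;> omega
  have hout : ∀ v, glue p.rel (sigma j h1 h2).rel (Sum.map id Sum.inl (s v)) (outer v) := by
    rintro (v | v)
    · exact Setoid.refl' _ _
    · exact glue_right p.rel (sigma_rel j h1 h2 v)
  refine diskInv_eq (hp.conjSwap (by omega) (by omega)) fun v w h => ?_
  have h3 : p.rel (s v) (s w) := by
    rw [rel_iff]
    right
    rw [hs, hs, ← h]
    simp [conjSwap]
  change glue _ _ _ _
  exact Setoid.trans' _ (Setoid.symm' _ (hout v)) (Setoid.trans' _ (glue_left _ h3) (hout w))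

theorem loops_sigma (p : BrauerPartition l m) (j : ℕ) (h1 : 1 ≤ j) (h2 : j < m) :
    p.loops (sigma j h1 h2) = 0 := by
  refine loops_eq_zero fun b =>
    ⟨Sum.inr (Equiv.swap (⟨j - 1, by omega⟩ : Fin m) ⟨j, h2⟩ b), glue_right p.rel ?_⟩
  simpa using sigma_rel j h1 h2 (Equiv.swap (⟨j - 1, by omega⟩ : Fin m) ⟨j, h2⟩ b)

theorem cupCap_rel_through (j : ℕ) (h1 : 1 ≤ j) (h2 : j < m) {b : Fin m} (hb : b.1 ≠ j - 1)
    (hb' : b.1 ≠ j) : (cupCap j h1 h2).rel (Sum.inl b) (Sum.inr b) := by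
  right
  simp [cupCapPartner, hb, hb']

theorem cupCap_rel_top (j : ℕ) (h1 : 1 ≤ j) (h2 : j < m) :
    (cupCap j h1 h2).rel (Sum.inl ⟨j, h2⟩) (Sum.inl ⟨j - 1, by omega⟩) := by
  right
  simp [cupCapPartner]

theorem cupCap_rel_bottom (j : ℕ) (h1 : 1 ≤ j) (h2 : j < m) :
    (cupCap j h1 h2).rel (Sum.inr ⟨j, h2⟩) (Sum.inr ⟨j - 1, by omega⟩) := by
  right
  simp [cupCapPartner]

/-- Away from the two special vertices, an outer point of the diagram of `p * U_j` is joined to the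
corresponding point of `p`. -/
theorem glue_cupCap_outer (p : BrauerPartition l m) {j : ℕ} (h1 : 1 ≤ j) (h2 : j < m)
    {v : Fin l ⊕ Fin m} (hv : diskPos v ≠ l + m - j - 1) (hv' : diskPos v ≠ l + m - j - 1 + 1) :
    glue p.rel (cupCap j h1 h2).rel (Sum.map id Sum.inl v) (outer v) := by
  rcases v with v | v
  · exact Setoid.refl' _ _
  · have := v.2
    simp only [diskPos] at hv hv'
    exact glue_right p.rel (cupCap_rel_through j h1 h2 (by omega) (by omega))

theorem diskInv_mul_cupCap (p : BrauerPartition l m) (j : ℕ) (h1 : 1 ≤ j) (h2 : j < m) :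
    (p.mul (cupCap j h1 h2)).diskInv = joinAt p.diskInv (l + m - j - 1) := by
  have hp := p.isDiskMatching_diskInv
  have e0 : diskPos (Sum.inr ⟨j, h2⟩ : Fin l ⊕ Fin m) = l + m - j - 1 := by
    simp [diskPos]; omega
  have e1 : diskPos (Sum.inr ⟨j - 1, by omega⟩ : Fin l ⊕ Fin m) = l + m - j - 1 + 1 := by
    simp [diskPos]; omega
  have hmid := glue_right p.rel (cupCap_rel_top j h1 h2)
  have hbot := glue_right p.rel (cupCap_rel_bottom j h1 h2)
  have hrel : ∀ {v w : Fin l ⊕ Fin m}, p.diskInv (diskPos v) = diskPos w →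
      glue p.rel (cupCap j h1 h2).rel (Sum.map id Sum.inl v) (Sum.map id Sum.inl w) :=
    fun h => glue_left _ ((p.rel_iff _ _).2 (Or.inr h))
  refine diskInv_eq (hp.joinAt (by omega)) fun v w h => ?_
  change glue _ _ _ _
  have hI := hp.invol (diskPos v)
  have hI' := hp.invol (diskPos w)
  have hJ := hp.invol (l + m - j - 1)
  have hJ' := hp.invol (l + m - j - 1 + 1)
  have hne := hp.ne _ (diskPos_lt v)
  have hne' := hp.ne (l + m - j - 1) (by omega)
  have hne'' := hp.ne (l + m - j - 1 + 1) (by omega)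
  unfold joinAt at h
  split_ifs at h with c1 c2 c3 c4
  · rw [← e0] at c1
    rw [← e1] at h
    rw [diskPos_injective c1, ← diskPos_injective h]
    exact hbot
  · rw [← e1] at c2
    rw [← e0] at h
    rw [diskPos_injective c2, ← diskPos_injective h]
    exact Setoid.symm' _ hbot
  · have k1 := hrel (c3.trans e0.symm)
    have k2 : p.diskInv (diskPos (Sum.inr ⟨j - 1, by omega⟩ : Fin l ⊕ Fin m)) = diskPos w := by
      rw [e1, h]
    refine Setoid.trans' _ (Setoid.symm' _ (glue_cupCap_outer p h1 h2 c1 c2))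
      (Setoid.trans' _ k1 (Setoid.trans' _ hmid (Setoid.trans' _ (hrel k2)
        (glue_cupCap_outer p h1 h2 ?_ ?_)))) <;> grind
  · have k1 := hrel (c4.trans e1.symm)
    have k2 : p.diskInv (diskPos (Sum.inr ⟨j, h2⟩ : Fin l ⊕ Fin m)) = diskPos w := by
      rw [e0, h]
    refine Setoid.trans' _ (Setoid.symm' _ (glue_cupCap_outer p h1 h2 c1 c2))
      (Setoid.trans' _ k1 (Setoid.trans' _ (Setoid.symm' _ hmid) (Setoid.trans' _ (hrel k2)
        (glue_cupCap_outer p h1 h2 ?_ ?_)))) <;> grind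
  · refine Setoid.trans' _ (Setoid.symm' _ (glue_cupCap_outer p h1 h2 c1 c2))
      (Setoid.trans' _ (hrel h) (glue_cupCap_outer p h1 h2 ?_ ?_)) <;> grind

/-- Multiplication by `U_j` creates a closed loop only if `j'` and `(j + 1)'` are paired. -/
theorem loops_cupCap (p : BrauerPartition l m) {j : ℕ} (h1 : 1 ≤ j) (h2 : j < m)
    (h : p.diskInv (l + m - j - 1) ≠ l + m - j - 1 + 1) : p.loops (cupCap j h1 h2) = 0 := by
  have hp := p.isDiskMatching_diskInv
  have e0 : diskPos (Sum.inr ⟨j, h2⟩ : Fin l ⊕ Fin m) = l + m - j - 1 := by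
    simp [diskPos]; omega
  have e1 : diskPos (Sum.inr ⟨j - 1, by omega⟩ : Fin l ⊕ Fin m) = l + m - j - 1 + 1 := by
    simp [diskPos]; omega
  -- the arc on top of `U_j` continues to the partner of `j'`
  obtain ⟨w, hw⟩ : ∃ w : Fin l ⊕ Fin m, diskPos w = p.diskInv (l + m - j - 1) :=
    exists_diskPos (hp.lt _ (by omega))
  have hne := hp.ne (l + m - j - 1) (by omega)
  have k0 : glue p.rel (cupCap j h1 h2).rel (Sum.inr (Sum.inl ⟨j, h2⟩)) (outer w) := by
    refine Setoid.trans' _ (glue_left (v := Sum.inr ⟨j, h2⟩) (w := w) _ ?_)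
      (glue_cupCap_outer p h1 h2 (by omega) (by omega))
    rw [rel_iff]
    right
    rw [e0, hw]
  refine loops_eq_zero fun b => ?_
  by_cases hb : b.1 = j
  · refine ⟨w, ?_⟩
    have : b = ⟨j, h2⟩ := Fin.ext hb
    rw [this]
    exact k0
  by_cases hb' : b.1 = j - 1
  · refine ⟨w, ?_⟩
    have : b = ⟨j - 1, by omega⟩ := Fin.ext hb'
    rw [this]
    exact Setoid.trans' _ (Setoid.symm' _ (glue_right p.rel (cupCap_rel_top j h1 h2))) k0
  · exact ⟨Sum.inr b, glue_right p.rel (cupCap_rel_through j h1 h2 hb' hb)⟩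

end MulGenerator

end BrauerPartition

/-! ### Heights and crossing pairs -/

namespace Picture

variable {m n : ℕ} (d : Picture m n)

/-- The partition of the points of a picture into lines. -/
def lines : Setoid (ℕ × ℕ) := Relation.EqvGen.setoid d.Segment

theorem lines_of_segment {P Q : ℕ × ℕ} (h : d.Segment P Q) : d.lines P Q :=
  Relation.EqvGen.rel _ _ h

open Classical in
/-- The indicator function of the line of `P` on the points of level `t`. -/
noncomputable def onLine (P : ℕ × ℕ) (t j : ℕ) : ZMod 2 := if d.lines (t, j) P then 1 else 0

/-- The parity of the number of points to the left of gap `g` of level `t` on the line of `P`. It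
depends only on the region of the picture that contains the gap. -/
noncomputable def leftParity (P : ℕ × ℕ) (t g : ℕ) : ZMod 2 :=
  ∑ j ∈ Finset.range g, d.onLine P t j

theorem leftParity_succ (P : ℕ × ℕ) (t g : ℕ) :
    d.leftParity P t (g + 1) = d.leftParity P t g + d.onLine P t g := Finset.sum_range_succ _ _

theorem onLine_eq_of_lines {t j t' j' : ℕ} (h : d.lines (t, j) (t', j')) (P : ℕ × ℕ) :
    d.onLine P t j = d.onLine P t' j' := by
  classical
  exact if_congr ⟨fun k => d.lines.trans' (d.lines.symm' h) k, fun k => d.lines.trans' h k⟩ rfl rfl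

theorem leftParity_eq_of_passes (P : ℕ × ℕ) {t g g' : ℕ} (ht : t < d.depth) (hg : g ≤ d.width t)
    (h : (d.layer t).Passes g g') : d.leftParity P t g = d.leftParity P (t + 1) g' := by
  have hfit := d.fits t ht
  have hrun : ∀ j j', j < d.width t → (d.layer t).Runs j j' →
      d.onLine P t j = d.onLine P (t + 1) j' := fun j j' hj h =>
    d.onLine_eq_of_lines (d.lines_of_segment (Segment.run t j j' ht hj h)) P
  -- lines to the left of the special part
  have hleft : ∀ g, g ≤ d.width t → (∀ j < g, (d.layer t).Runs j j) →
      d.leftParity P t g = d.leftParity P (t + 1) g := by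
    intro g hg hr
    refine Finset.sum_congr rfl fun j hj => ?_
    rw [Finset.mem_range] at hj
    exact hrun j j (by omega) (hr j hj)
  cases hL : d.layer t with
  | cross a =>
    simp only [hL, PictureLayer.Fits, PictureLayer.Passes, PictureLayer.Runs] at hfit h hrun hleft
    obtain ⟨h1, rfl⟩ := h
    rcases Nat.lt_or_ge a g' with h2 | h2
    · have h3 : a + 2 ≤ g' := by omega
      induction g', h3 using Nat.le_induction with
      | base =>
        rw [leftParity_succ, leftParity_succ, leftParity_succ, leftParity_succ,
          hleft a (by omega) fun j hj => by rw [Equiv.swap_apply_of_ne_of_ne] <;> omega,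
          hrun a (a + 1) (by omega) (Equiv.swap_apply_left a (a + 1)).symm,
          hrun (a + 1) a (by omega) (Equiv.swap_apply_right a (a + 1)).symm]
        ring
      | succ k hk ih =>
        rw [leftParity_succ, leftParity_succ, ih (by omega) (by omega) (by omega),
          hrun k k (by omega)
          (Equiv.swap_apply_of_ne_of_ne (show k ≠ a by omega) (show k ≠ a + 1 by omega)).symm]
    · exact hleft _ hg fun j hj => by rw [Equiv.swap_apply_of_ne_of_ne] <;> omega
  | cup a =>
    simp only [hL, PictureLayer.Fits, PictureLayer.Passes, PictureLayer.Runs] at hfit h hrun hleft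
    rcases h with ⟨h1, rfl⟩ | ⟨h1, rfl⟩
    · exact hleft _ hg fun j hj => Or.inl ⟨by omega, trivial⟩
    · have h2 : a ≤ g' := by omega
      clear h1
      induction g', h2 using Nat.le_induction with
      | base =>
        rw [leftParity_succ, leftParity_succ,
          hleft a (by omega) fun j hj => Or.inl ⟨by omega, trivial⟩, add_assoc,
          d.onLine_eq_of_lines (d.lines_of_segment (Segment.cup t a ht hL)),
          CharTwo.add_self_eq_zero, add_zero]
      | succ k hk ih =>
        rw [d.leftParity_succ P t (k + 2), d.leftParity_succ P (t + 1) k, ih (by omega),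
          hrun (k + 2) k (by omega) (by omega)]
  | cap a =>
    simp only [hL, PictureLayer.Fits, PictureLayer.Passes, PictureLayer.Runs] at hfit h hrun hleft
    rcases h with ⟨h1, rfl⟩ | ⟨h1, rfl⟩
    · exact hleft _ hg fun j hj => Or.inl ⟨by omega, trivial⟩
    · induction g, h1 using Nat.le_induction with
      | base =>
        rw [leftParity_succ, leftParity_succ,
          hleft a (by omega) fun j hj => Or.inl ⟨by omega, trivial⟩, add_assoc,
          d.onLine_eq_of_lines (d.lines_of_segment (Segment.cap t a ht hL)),
          CharTwo.add_self_eq_zero, add_zero]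
      | succ k hk ih =>
        rw [d.leftParity_succ P (t + 1) (k + 2), d.leftParity_succ P t k, ih (by omega),
          hrun k (k + 2) (by omega) (by omega)]

open Classical in
/-- The number of lines through points of `G` that separate gap `g` of level `t` from the left
edge. -/
noncomputable def separating (G : Finset (ℕ × ℕ)) (t g : ℕ) : ℕ :=
  (G.filter fun P => d.leftParity P t g ≠ 0).card

variable {d} {G : Finset (ℕ × ℕ)}

theorem separating_eq_of_passes {t g g' : ℕ} (ht : t < d.depth) (hg : g ≤ d.width t)
    (h : (d.layer t).Passes g g') : d.separating G t g = d.separating G (t + 1) g' := by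
  unfold separating
  simp only [d.leftParity_eq_of_passes _ ht hg h]

theorem separating_succ (hG : ∀ P ∈ G, ∀ Q ∈ G, d.lines P Q → P = Q) (t g : ℕ) :
    d.separating G t (g + 1) ≤ d.separating G t g + 1 ∧
      d.separating G t g ≤ d.separating G t (g + 1) + 1 := by
  classical
  have h1 : (G.filter fun P => d.lines (t, g) P).card ≤ 1 := by
    rw [Finset.card_le_one]
    intro P hP Q hQ
    rw [Finset.mem_filter] at hP hQ
    exact hG P hP.1 Q hQ.1 (d.lines.trans' (d.lines.symm' hP.2) hQ.2)
  have h2 : ∀ P, ¬ d.lines (t, g) P → d.leftParity P t (g + 1) = d.leftParity P t g := by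
    intro P hP
    rw [leftParity_succ, onLine, if_neg hP, add_zero]
  unfold separating
  constructor
  · refine le_trans (Finset.card_le_card ?_) ((Finset.card_union_le _ _).trans
      (Nat.add_le_add_left h1 _))
    intro P hP
    rw [Finset.mem_union, Finset.mem_filter, Finset.mem_filter]
    rw [Finset.mem_filter] at hP
    by_cases h : d.lines (t, g) P
    · exact Or.inr ⟨hP.1, h⟩
    · exact Or.inl ⟨hP.1, by rw [← h2 P h]; exact hP.2⟩
  · refine le_trans (Finset.card_le_card ?_) ((Finset.card_union_le _ _).trans
      (Nat.add_le_add_left h1 _))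
    intro P hP
    rw [Finset.mem_union, Finset.mem_filter, Finset.mem_filter]
    rw [Finset.mem_filter] at hP
    by_cases h : d.lines (t, g) P
    · exact Or.inr ⟨hP.1, h⟩
    · exact Or.inl ⟨hP.1, by rw [h2 P h]; exact hP.2⟩

/-- A path to the left edge meets every line that separates its starting point from this edge. -/
theorem PathToLeft.separating_le (hG : ∀ P ∈ G, ∀ Q ∈ G, d.lines P Q → P = Q) {F : ℕ × ℕ} {c : ℕ}
    (h : d.PathToLeft F c) : d.separating G F.1 F.2 ≤ c := by
  induction h with
  | left t ht => simp [separating, leftParity]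
  | down t g g' c ht hg hp _ ih => rwa [separating_eq_of_passes ht hg hp]
  | up t g g' c ht hg hp _ ih => rwa [← separating_eq_of_passes ht hg hp]
  | crossLeft t g c _ _ _ ih => exact (separating_succ hG t g).1.trans (by simpa using ih)
  | crossRight t g c _ _ _ ih => exact (separating_succ hG t g).2.trans (by simpa using ih)

/-- In a picture of height at most `c - 3`, a line with a region on one of its sides that is
separated from the left edge by `c` lines runs along such regions from end to end: at a crossing
point, all four sectors would be separated from the left edge by at least `c - 2` lines. -/
theorem Segment.separating_iff (hG : ∀ P ∈ G, ∀ Q ∈ G, d.lines P Q → P = Q) {l : ℤ} {c : ℕ}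
    (hd : d.HeightLE l) (hc : l + 3 ≤ c) {P Q : ℕ × ℕ} (h : d.Segment P Q) :
    (c ≤ d.separating G P.1 P.2 ∨ c ≤ d.separating G P.1 (P.2 + 1)) ↔
      (c ≤ d.separating G Q.1 Q.2 ∨ c ≤ d.separating G Q.1 (Q.2 + 1)) := by
  cases h with
  | run t j j' ht hj hr =>
    have hfit := d.fits t ht
    have hpass := fun {g g'} hg h => separating_eq_of_passes (G := G) (g := g) (g' := g') ht hg h
    cases hL : d.layer t with
    | cross a =>
      simp only [hL, PictureLayer.Fits, PictureLayer.Passes, PictureLayer.Runs] at hfit hr hpass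
      by_cases hja : j = a ∨ j = a + 1
      · have p0 := hpass (g := a) (g' := a) (by omega) (by omega)
        have p2 := hpass (g := a + 2) (g' := a + 2) (by omega) (by omega)
        have s0 := separating_succ hG t a
        have s1 := separating_succ hG t (a + 1)
        have s0' := separating_succ hG (t + 1) a
        have s1' := separating_succ hG (t + 1) (a + 1)
        obtain ⟨F, e, hF, hpath, hle⟩ := hd t a ht hL
        have hlow := hpath.separating_le hG
        have hj' : j' = a ∨ j' = a + 1 := by
          rcases hja with rfl | rfl
          · right; rw [hr, Equiv.swap_apply_left]
          · left; rw [hr, Equiv.swap_apply_right]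
        have eq2 : a + 1 + 1 = a + 2 := rfl
        rw [eq2] at s1 s1'
        rcases hF with rfl | rfl | rfl | rfl <;> simp only at hlow <;>
          rcases hja with rfl | rfl <;> rcases hj' with rfl | rfl <;>
          simp only [eq2] <;> omega
      · rw [Equiv.swap_apply_of_ne_of_ne (by omega) (by omega)] at hr
        subst hr
        simp only
        rw [hpass (g := j') (by omega) ⟨by omega, rfl⟩,
          hpass (g := j' + 1) (by omega) ⟨by omega, rfl⟩]
    | cup a =>
      simp only [hL, PictureLayer.Fits, PictureLayer.Passes, PictureLayer.Runs] at hfit hr hpass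
      simp only
      rcases hr with ⟨h1, rfl⟩ | ⟨h1, rfl⟩
      · rw [hpass (g := j') (by omega) (Or.inl ⟨by omega, rfl⟩),
          hpass (g := j' + 1) (by omega) (Or.inl ⟨by omega, rfl⟩)]
      · rw [hpass (g := j' + 2) (by omega) (Or.inr ⟨by omega, rfl⟩),
          hpass (g := j' + 2 + 1) (g' := j' + 1) (by omega) (Or.inr ⟨by omega, by omega⟩)]
    | cap a =>
      simp only [hL, PictureLayer.Fits, PictureLayer.Passes, PictureLayer.Runs] at hfit hr hpass
      simp only
      rcases hr with ⟨h1, rfl⟩ | ⟨h1, rfl⟩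
      · rw [hpass (g := j') (by omega) (Or.inl ⟨by omega, rfl⟩),
          hpass (g := j' + 1) (by omega) (Or.inl ⟨by omega, rfl⟩)]
      · rw [hpass (g := j) (by omega) (Or.inr ⟨by omega, rfl⟩),
          hpass (g := j + 1) (g' := j + 2 + 1) (by omega) (Or.inr ⟨by omega, by omega⟩)]
  | cup t a ht hL =>
    have hfit := d.fits t ht
    have hpass := fun {g g'} hg h => separating_eq_of_passes (G := G) (g := g) (g' := g') ht hg h
    simp only [hL, PictureLayer.Fits, PictureLayer.Passes] at hfit hpass
    have p0 := hpass (g := a) (g' := a) (by omega) (by omega)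
    have p2 := hpass (g := a + 2) (g' := a) (by omega) (by omega)
    have eq2 : a + 1 + 1 = a + 2 := rfl
    simp only [eq2]
    omega
  | cap t a ht hL =>
    have hfit := d.fits t ht
    have hpass := fun {g g'} hg h => separating_eq_of_passes (G := G) (g := g) (g' := g') ht hg h
    simp only [hL, PictureLayer.Fits, PictureLayer.Passes] at hfit hpass
    have p0 := hpass (g := a) (g' := a) (by omega) (by omega)
    have p2 := hpass (g := a) (g' := a + 2) (by omega) (by omega)
    have eq2 : a + 1 + 1 = a + 2 := rfl
    simp only [eq2]
    omega

theorem separating_iff_of_lines (hG : ∀ P ∈ G, ∀ Q ∈ G, d.lines P Q → P = Q) {l : ℤ} {c : ℕ}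
    (hd : d.HeightLE l) (hc : l + 3 ≤ c) {P Q : ℕ × ℕ} (h : d.lines P Q) :
    (c ≤ d.separating G P.1 P.2 ∨ c ≤ d.separating G P.1 (P.2 + 1)) ↔
      (c ≤ d.separating G Q.1 Q.2 ∨ c ≤ d.separating G Q.1 (Q.2 + 1)) := by
  change Relation.EqvGen d.Segment P Q at h
  induction h with
  | rel _ _ h => exact h.separating_iff hG hd hc
  | refl => exact Iff.rfl
  | symm _ _ _ ih => exact ih.symm
  | trans _ _ _ _ _ ih1 ih2 => exact ih1.trans ih2

end Picture

namespace Picture.IsPictureOf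

variable {m n : ℕ} {d : Picture m n} {p : BrauerPartition m n}

open BrauerPartition

theorem lines_iff (hp : d.IsPictureOf p) (v w : Fin m ⊕ Fin n) :
    d.lines (d.marked v) (d.marked w) ↔
      diskPos v = diskPos w ∨ diskPos v = p.diskInv (diskPos w) := by
  rw [diskPos_injective.eq_iff]
  refine (hp v w).symm.trans ?_
  rw [rel_iff]
  have := p.isDiskMatching_diskInv.invol (diskPos v)
  have := p.isDiskMatching_diskInv.invol (diskPos w)
  grind

theorem two_indicators_ne_zero (a b : Prop) [Decidable a] [Decidable b] :
    ((if a then 1 else 0) + (if b then 1 else 0) : ZMod 2) ≠ 0 ↔ (a ↔ ¬ b) := by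
  by_cases a <;> by_cases b <;> simp_all [CharTwo.add_self_eq_zero]

theorem leftParity_top (hp : d.IsPictureOf p) (v : Fin m ⊕ Fin n) {g : ℕ} (hg : g ≤ m) :
    d.leftParity (d.marked v) 0 g ≠ 0 ↔ (diskPos v < g ↔ ¬ p.diskInv (diskPos v) < g) := by
  classical
  have hne := p.isDiskMatching_diskInv.ne _ (diskPos_lt v)
  rw [← two_indicators_ne_zero]
  suffices h : d.leftParity (d.marked v) 0 g = (if diskPos v < g then 1 else 0) +
      (if p.diskInv (diskPos v) < g then 1 else 0) by rw [h]
  calc d.leftParity (d.marked v) 0 g = ∑ j ∈ Finset.range g,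
        ((if j = diskPos v then 1 else 0) + (if j = p.diskInv (diskPos v) then 1 else 0)) := by
        refine Finset.sum_congr rfl fun j hj => ?_
        rw [Finset.mem_range] at hj
        have h1 := hp.lines_iff (Sum.inl ⟨j, by omega⟩) v
        have h2 : (diskPos (Sum.inl ⟨j, by omega⟩ : Fin m ⊕ Fin n)) = j := rfl
        rw [h2] at h1
        change (if d.lines (d.marked (Sum.inl ⟨j, by omega⟩)) (d.marked v) then _ else _) = _
        simp only [h1]
        split_ifs <;> first | omega | simp
    _ = _ := by simp [Finset.sum_add_distrib]

theorem leftParity_bottom (hp : d.IsPictureOf p) (v : Fin m ⊕ Fin n) {g : ℕ} (hg : g ≤ n) :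
    d.leftParity (d.marked v) d.depth g ≠ 0 ↔
      (diskPos v < m + n - g ↔ ¬ p.diskInv (diskPos v) < m + n - g) := by
  classical
  have hne := p.isDiskMatching_diskInv.ne _ (diskPos_lt v)
  have hlt := p.isDiskMatching_diskInv.lt _ (diskPos_lt v)
  have hv := diskPos_lt v
  have hneg : ∀ a b : Prop, (a ↔ ¬ b) ↔ (¬ a ↔ ¬ ¬ b) := fun a b => by tauto
  rw [hneg, ← two_indicators_ne_zero]
  suffices h : d.leftParity (d.marked v) d.depth g = (if ¬ diskPos v < m + n - g then 1 else 0) +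
      (if ¬ p.diskInv (diskPos v) < m + n - g then 1 else 0) by rw [h]
  calc d.leftParity (d.marked v) d.depth g = ∑ j ∈ Finset.range g,
        ((if j = m + n - 1 - diskPos v then 1 else 0) +
          (if j = m + n - 1 - p.diskInv (diskPos v) then 1 else 0)) := by
        refine Finset.sum_congr rfl fun j hj => ?_
        rw [Finset.mem_range] at hj
        have h1 := hp.lines_iff (Sum.inr ⟨j, by omega⟩) v
        have h2 : (diskPos (Sum.inr ⟨j, by omega⟩ : Fin m ⊕ Fin n)) = m + n - 1 - j := rfl
        rw [h2] at h1
        change (if d.lines (d.marked (Sum.inr ⟨j, by omega⟩)) (d.marked v) then _ else _) = _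
        simp only [h1]
        split_ifs <;> first | omega | simp
    _ = _ := by
      rw [Finset.sum_add_distrib, Finset.sum_ite_eq', Finset.sum_ite_eq']
      simp only [Finset.mem_range]
      congr 1 <;> (congr 1; apply propext; omega)

/-- The number of lines through `G` that separate from the left edge the gap of the boundary in
front of disk position `g`. -/
theorem separating_marked (hp : d.IsPictureOf p) (G : Finset (Fin m ⊕ Fin n))
    (v : Fin m ⊕ Fin n) (c : ℕ) :
    (c ≤ d.separating (G.image d.marked) (d.marked v).1 (d.marked v).2 ∨
        c ≤ d.separating (G.image d.marked) (d.marked v).1 ((d.marked v).2 + 1)) →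
      ∃ g, diskPos v ≤ g ∧ g ≤ diskPos v + 1 ∧
        c ≤ (G.filter fun u => (diskPos u < g ↔ ¬ p.diskInv (diskPos u) < g)).card := by
  classical
  have hsep : ∀ t g, d.separating (G.image d.marked) t g ≤
      (G.filter fun u => d.leftParity (d.marked u) t g ≠ 0).card := by
    intro t g
    unfold separating
    rw [Finset.filter_image]
    exact Finset.card_image_le
  rcases v with v | v
  · have hv := v.2
    have key : ∀ g ≤ m, d.separating (G.image d.marked) 0 g ≤
        (G.filter fun u => (diskPos u < g ↔ ¬ p.diskInv (diskPos u) < g)).card := by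
      intro g hg
      refine (hsep _ _).trans (le_of_eq ?_)
      simp only [hp.leftParity_top _ hg]
    rintro (h | h)
    · exact ⟨v, le_rfl, by simp [diskPos], h.trans (key _ hv.le)⟩
    · exact ⟨v + 1, by simp [diskPos], le_rfl, h.trans (key _ hv)⟩
  · have hv := v.2
    have key : ∀ g ≤ n, d.separating (G.image d.marked) d.depth g ≤
        (G.filter fun u => (diskPos u < m + n - g ↔ ¬ p.diskInv (diskPos u) < m + n - g)).card := by
      intro g hg
      refine (hsep _ _).trans (le_of_eq ?_)
      simp only [hp.leftParity_bottom _ hg]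
    rintro (h | h)
    · exact ⟨m + n - v, by simp [diskPos]; omega, by simp [diskPos]; omega,
        h.trans (key _ hv.le)⟩
    · exact ⟨m + n - (v + 1), by simp [diskPos]; omega, by simp [diskPos]; omega,
        h.trans (key _ hv)⟩

/-- In a picture of height at most `l`, where two pairs cross, the one that closes first does so at
a place covered by at most `l + 2` pairs: otherwise the line of the last pair opened before that
place meets no crossing point, and leads to the vertex where the first of these pairs closes. -/
theorem cover_le (hp : d.IsPictureOf p) {l : ℤ} (hd : d.HeightLE l) {x z : ℕ} (h1 : x < z)
    (h2 : z < p.diskInv x) (h3 : p.diskInv x < p.diskInv z) :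
    (cover p.diskInv (p.diskInv x) : ℤ) ≤ l + 2 := by
  classical
  by_contra hc
  have hm := p.isDiskMatching_diskInv
  set f := p.diskInv with hf
  set y := f x with hy
  have hxN : x < m + n := by
    by_contra h
    have := hm.eq x (by omega)
    omega
  have hyN := hm.lt x hxN
  let G : Finset (Fin m ⊕ Fin n) := Finset.univ.filter fun u => diskPos u < y ∧ y ≤ f (diskPos u)
  have hGmem : ∀ u, u ∈ G ↔ diskPos u < y ∧ y ≤ f (diskPos u) := by simp [G]
  have hcard : G.card = cover f y := by
    unfold cover
    rw [← Finset.card_image_of_injective G diskPos_injective]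
    congr 1
    ext u
    simp only [Finset.mem_image, Finset.mem_filter, Finset.mem_range, hGmem]
    constructor
    · rintro ⟨v, hv, rfl⟩
      exact hv
    · rintro ⟨hu1, hu2⟩
      obtain ⟨v, rfl⟩ := exists_diskPos (m := m) (n := n) (x := u) (by omega)
      exact ⟨v, ⟨hu1, hu2⟩, rfl⟩
  obtain ⟨u0, hu0⟩ := exists_diskPos (m := m) (n := n) hxN
  obtain ⟨w0, hw0⟩ := exists_diskPos (m := m) (n := n) (x := z) (by omega)
  have hu0G : u0 ∈ G := (hGmem _).2 (by rw [hu0]; omega)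
  have hw0G : w0 ∈ G := (hGmem _).2 (by rw [hw0]; omega)
  obtain ⟨X, hXG, hXmax⟩ := Finset.exists_max_image G diskPos ⟨u0, hu0G⟩
  have hX := (hGmem X).1 hXG
  have hpair : ∀ P ∈ G.image d.marked, ∀ Q ∈ G.image d.marked, d.lines P Q → P = Q := by
    intro P hP Q hQ hPQ
    rw [Finset.mem_image] at hP hQ
    obtain ⟨u, hu, rfl⟩ := hP
    obtain ⟨w, hw, rfl⟩ := hQ
    rw [hGmem] at hu hw
    rcases (hp.lines_iff u w).1 hPQ with h | h
    · rw [diskPos_injective h]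
    · rw [← hf] at h
      omega
  have hY : diskPos (p.partner X) = f (diskPos X) := (p.diskInv_diskPos X).symm
  have hline : d.lines (d.marked X) (d.marked (p.partner X)) := by
    rw [hp.lines_iff, hY, ← hf, hm.invol]
    exact Or.inr rfl
  -- all pairs of `G` are open at the gap behind `X`
  have hstart : ∃ t g, (t = (d.marked X).1 ∧ (g = (d.marked X).2 ∨ g = (d.marked X).2 + 1)) ∧
      G.card ≤ d.separating (G.image d.marked) t g := by
    have himg : (G.image d.marked).card = G.card := by
      refine Finset.card_image_of_injOn fun u hu w hw huw => ?_
      have hl : d.lines (d.marked u) (d.marked w) := by rw [huw]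
      rcases (hp.lines_iff u w).1 hl with h | h
      · exact diskPos_injective h
      · have h5 := (hGmem u).1 hu
        have h6 := (hGmem w).1 hw
        rw [← hf] at h
        omega
    rcases hXv : X with a | b
    · refine ⟨0, a + 1, ⟨rfl, Or.inr rfl⟩, ?_⟩
      unfold Picture.separating
      rw [Finset.filter_true_of_mem, himg]
      intro P hP
      obtain ⟨u, hu, rfl⟩ := Finset.mem_image.1 hP
      rw [hp.leftParity_top u a.2, ← hf]
      have h5 := hXmax u hu
      have h6 := (hGmem u).1 hu
      have h7 : diskPos X = a := by rw [hXv]; rfl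
      omega
    · refine ⟨d.depth, b, ⟨rfl, Or.inl rfl⟩, ?_⟩
      unfold Picture.separating
      rw [Finset.filter_true_of_mem, himg]
      intro P hP
      obtain ⟨u, hu, rfl⟩ := Finset.mem_image.1 hP
      rw [hp.leftParity_bottom u b.2.le, ← hf]
      have h5 := hXmax u hu
      have h6 := (hGmem u).1 hu
      have h7 : diskPos X = m + n - 1 - b := by rw [hXv]; rfl
      have h8 := b.2
      omega
  have hend := (Picture.separating_iff_of_lines hpair hd (c := G.card) (by omega) hline).1 (by
    obtain ⟨t, g, ⟨rfl, rfl | rfl⟩, h⟩ := hstart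
    · exact Or.inl h
    · exact Or.inr h)
  obtain ⟨g, hg1, hg2, hg3⟩ := hp.separating_marked G (p.partner X) _ hend
  have hall := Finset.filter_card_eq (le_antisymm (Finset.card_filter_le _ _) hg3) u0 hu0G
  rw [hY] at hg1 hg2
  rw [hu0, ← hf] at hall
  have h5 := hXmax w0 hw0G
  have h6 : f (diskPos X) = f x := by omega
  have h7 : diskPos X = x := by rw [← hm.invol (diskPos X), h6, hm.invol]
  omega

end Picture.IsPictureOf

/-! ### Pictures of products -/

namespace Picture

variable {l m n : ℕ}

/-- The picture `d` drawn above the picture `e`. -/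
def append (d : Picture l m) (e : Picture m n) : Picture l n where
  depth := d.depth + e.depth
  width t := if t < d.depth then d.width t else e.width (t - d.depth)
  layer t := if t < d.depth then d.layer t else e.layer (t - d.depth)
  width_top := by
    split_ifs with h
    · exact d.width_top
    · have h0 : d.depth = 0 := by omega
      have h1 := d.width_bottom
      rw [h0, d.width_top] at h1
      rw [Nat.zero_sub, e.width_top, h1]
  width_bottom := by
    rw [if_neg (by omega), Nat.add_sub_cancel_left, e.width_bottom]
  fits t ht := by
    by_cases h : t + 1 < d.depth
    · rw [if_pos (by omega), if_pos (by omega), if_pos h]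
      exact d.fits t (by omega)
    by_cases h' : t < d.depth
    · have h0 : t + 1 = d.depth := by omega
      have h1 := d.fits t h'
      have hb := d.width_bottom
      rw [← h0] at hb
      rw [hb] at h1
      rw [if_pos h', if_pos h', if_neg h, h0, Nat.sub_self, e.width_top]
      exact h1
    · have h1 := e.fits (t - d.depth) (by omega)
      rw [if_neg h', if_neg h', if_neg (by omega), show t + 1 - d.depth = t - d.depth + 1 by omega]
      exact h1

section Append

variable (d : Picture l m) (e : Picture m n)

theorem append_width_left {t : ℕ} (h : t ≤ d.depth) : (d.append e).width t = d.width t := by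
  rcases h.lt_or_eq with h | rfl
  · exact if_pos h
  · simp [append, e.width_top, d.width_bottom]

theorem append_width_right (t : ℕ) : (d.append e).width (d.depth + t) = e.width t := by
  simp [append]

theorem append_layer_left {t : ℕ} (h : t < d.depth) : (d.append e).layer t = d.layer t := if_pos h

theorem append_layer_right (t : ℕ) : (d.append e).layer (d.depth + t) = e.layer t := by
  simp [append]

theorem append_depth : (d.append e).depth = d.depth + e.depth := rfl

theorem Segment.append_left {P Q : ℕ × ℕ} (h : d.Segment P Q) : (d.append e).Segment P Q := by
  cases h with
  | run t j j' ht hj hr =>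
    refine .run t j j' (by rw [append_depth]; omega) ?_ ?_
    · rwa [append_width_left _ _ ht.le]
    · rwa [append_layer_left _ _ ht]
  | cup t a ht hL =>
    exact .cup t a (by rw [append_depth]; omega) (by rwa [append_layer_left _ _ ht])
  | cap t a ht hL =>
    exact .cap t a (by rw [append_depth]; omega) (by rwa [append_layer_left _ _ ht])

theorem Segment.append_right {P Q : ℕ × ℕ} (h : e.Segment P Q) :
    (d.append e).Segment (d.depth + P.1, P.2) (d.depth + Q.1, Q.2) := by
  cases h with
  | run t j j' ht hj hr =>
    refine .run (d.depth + t) j j' (by rw [append_depth]; omega) ?_ ?_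
    · rwa [append_width_right]
    · rwa [append_layer_right]
  | cup t a ht hL =>
    exact .cup (d.depth + t) a (by rw [append_depth]; omega) (by rwa [append_layer_right])
  | cap t a ht hL =>
    exact .cap (d.depth + t) a (by rw [append_depth]; omega) (by rwa [append_layer_right])

theorem Segment.of_append {P Q : ℕ × ℕ} (h : (d.append e).Segment P Q) :
    d.Segment P Q ∨ ∃ P' Q', e.Segment P' Q' ∧ P = (d.depth + P'.1, P'.2) ∧
      Q = (d.depth + Q'.1, Q'.2) := by
  cases h with
  | run t j j' ht hj hr =>
    by_cases h : t < d.depth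
    · rw [append_width_left _ _ h.le] at hj
      rw [append_layer_left _ _ h] at hr
      exact Or.inl (.run t j j' h hj hr)
    · obtain ⟨s, rfl⟩ := Nat.exists_eq_add_of_le (not_lt.1 h)
      rw [append_width_right] at hj
      rw [append_layer_right] at hr
      rw [append_depth] at ht
      exact Or.inr ⟨_, _, .run s j j' (by omega) hj hr, rfl, rfl⟩
  | cup t a ht hL =>
    by_cases h : t < d.depth
    · rw [append_layer_left _ _ h] at hL
      exact Or.inl (.cup t a h hL)
    · obtain ⟨s, rfl⟩ := Nat.exists_eq_add_of_le (not_lt.1 h)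
      rw [append_layer_right] at hL
      rw [append_depth] at ht
      exact Or.inr ⟨_, _, .cup s a (by omega) hL, rfl, rfl⟩
  | cap t a ht hL =>
    by_cases h : t < d.depth
    · rw [append_layer_left _ _ h] at hL
      exact Or.inl (.cap t a h hL)
    · obtain ⟨s, rfl⟩ := Nat.exists_eq_add_of_le (not_lt.1 h)
      rw [append_layer_right] at hL
      rw [append_depth] at ht
      exact Or.inr ⟨_, _, .cap s a (by omega) hL, rfl, rfl⟩

variable {d e}

theorem Segment.valid {P Q : ℕ × ℕ} (h : d.Segment P Q) :
    (P.1 ≤ d.depth ∧ P.2 < d.width P.1) ∧ (Q.1 ≤ d.depth ∧ Q.2 < d.width Q.1) := by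
  cases h with
  | run t j j' ht hj hr =>
    have h := d.fits t ht
    refine ⟨⟨ht.le, hj⟩, ht, ?_⟩
    cases hL : d.layer t with
    | cross a =>
      simp only [hL, PictureLayer.Fits, PictureLayer.Runs, Equiv.swap_apply_def] at h hr ⊢
      split_ifs at hr <;> omega
    | cup a => simp only [hL, PictureLayer.Fits, PictureLayer.Runs] at h hr ⊢; omega
    | cap a => simp only [hL, PictureLayer.Fits, PictureLayer.Runs] at h hr ⊢; omega
  | cup t a ht hL =>
    have h := d.fits t ht
    simp only [hL, PictureLayer.Fits] at h ⊢
    omega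
  | cap t a ht hL =>
    have h := d.fits t ht
    simp only [hL, PictureLayer.Fits] at h ⊢
    omega

/-- If one point of a line is in the picture, so are all its points; the other classes of `d.lines`
consist of a single point each. -/
theorem lines_level_iff {P Q : ℕ × ℕ} (h : d.lines P Q) : P.1 ≤ d.depth ↔ Q.1 ≤ d.depth := by
  change Relation.EqvGen d.Segment P Q at h
  induction h with
  | rel _ _ h => have := h.valid; tauto
  | refl => exact Iff.rfl
  | symm _ _ _ ih => exact ih.symm
  | trans _ _ _ _ _ ih1 ih2 => exact ih1.trans ih2

theorem marked_level_le (v : Fin l ⊕ Fin m) : (d.marked v).1 ≤ d.depth := by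
  rcases v with v | v
  · exact Nat.zero_le _
  · exact le_rfl

theorem lines_append_left {P Q : ℕ × ℕ} (h : d.lines P Q) : (d.append e).lines P Q :=
  Setoid.eqvGen_le (s := (d.append e).lines)
    (fun _ _ h => lines_of_segment _ (Segment.append_left d e h)) h

theorem lines_append_right {P Q : ℕ × ℕ} (h : e.lines P Q) :
    (d.append e).lines (d.depth + P.1, P.2) (d.depth + Q.1, Q.2) :=
  Setoid.eqvGen_le (s := (d.append e).lines.comap fun P : ℕ × ℕ => (d.depth + P.1, P.2))
    (fun _ _ h => lines_of_segment _ (Segment.append_right d e h)) h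

theorem PathToLeft.append_left {F : ℕ × ℕ} {c : ℕ} (h : d.PathToLeft F c) :
    (d.append e).PathToLeft F c := by
  have hw := fun {t} h => d.append_width_left e (t := t) h
  induction h with
  | left t ht => exact .left t (by rw [append_depth]; omega)
  | down t g g' c ht hg hp _ ih =>
    exact .down t g g' c (by rw [append_depth]; omega) (by rwa [hw ht.le])
      (by rwa [append_layer_left _ _ ht]) ih
  | up t g g' c ht hg hp _ ih =>
    exact .up t g g' c (by rw [append_depth]; omega) (by rwa [hw ht.le])
      (by rwa [append_layer_left _ _ ht]) ih
  | crossLeft t g c ht hg _ ih =>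
    exact .crossLeft t g c (by rw [append_depth]; omega) (by rwa [hw ht]) ih
  | crossRight t g c ht hg _ ih =>
    exact .crossRight t g c (by rw [append_depth]; omega) (by rwa [hw ht]) ih

theorem PathToLeft.append_right {F : ℕ × ℕ} {c : ℕ} (h : e.PathToLeft F c) :
    (d.append e).PathToLeft (d.depth + F.1, F.2) c := by
  have hw := fun t => d.append_width_right e t
  induction h with
  | left t ht => exact .left _ (by rw [append_depth]; omega)
  | down t g g' c ht hg hp _ ih =>
    exact .down (d.depth + t) g g' c (by rw [append_depth]; omega) (by rwa [hw])
      (by rwa [append_layer_right]) ih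
  | up t g g' c ht hg hp _ ih =>
    exact .up (d.depth + t) g g' c (by rw [append_depth]; omega) (by rwa [hw])
      (by rwa [append_layer_right]) ih
  | crossLeft t g c ht hg _ ih =>
    exact .crossLeft (d.depth + t) g c (by rw [append_depth]; omega) (by rwa [hw]) ih
  | crossRight t g c ht hg _ ih =>
    exact .crossRight (d.depth + t) g c (by rw [append_depth]; omega) (by rwa [hw]) ih

theorem HeightLE.append {k : ℤ} (hd : d.HeightLE k) (he : e.HeightLE k) :
    (d.append e).HeightLE k := by
  intro t a ht hL
  by_cases h : t < d.depth
  · rw [append_layer_left _ _ h] at hL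
    obtain ⟨F, c, hF, hp, hc⟩ := hd t a h hL
    exact ⟨F, c, hF, hp.append_left, hc⟩
  · obtain ⟨s, rfl⟩ := Nat.exists_eq_add_of_le (not_lt.1 h)
    rw [append_layer_right] at hL
    rw [append_depth] at ht
    obtain ⟨F, c, hF, hp, hc⟩ := he s a (by omega) hL
    refine ⟨_, c, ?_, hp.append_right, hc⟩
    rcases hF with rfl | rfl | rfl | rfl <;> simp [add_assoc]

/-- The point of `d.append e` at a vertex of the glued diagram. -/
def gluedPoint (d : Picture l m) (e : Picture m n) : Fin l ⊕ (Fin m ⊕ Fin n) → ℕ × ℕ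
  | Sum.inl a => (0, a)
  | Sum.inr (Sum.inl b) => (d.depth, b)
  | Sum.inr (Sum.inr c) => (d.depth + e.depth, c)

/-- `d.Meets e p q P x`: inside one of the two pictures, the line of the point `P` reaches a marked
point in the class of `x` in the glued diagram of `p` and `q`. -/
def Meets (d : Picture l m) (e : Picture m n) (p : BrauerPartition l m) (q : BrauerPartition m n)
    (P : ℕ × ℕ) (x : Fin l ⊕ (Fin m ⊕ Fin n)) : Prop :=
  (∃ v, d.lines P (d.marked v) ∧ glue p.rel q.rel (Sum.map id Sum.inl v) x) ∨
    ∃ P' v, P = (d.depth + P'.1, P'.2) ∧ e.lines P' (e.marked v) ∧ glue p.rel q.rel (Sum.inr v) x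

open BrauerPartition in
/-- A stack of two pictures is a picture of the product. Following a line through the stack, the
class in the glued diagram of the marked points that it meets does not change. -/
theorem IsPictureOf.append {p : BrauerPartition l m} {q : BrauerPartition m n}
    (hd : d.IsPictureOf p) (he : e.IsPictureOf q) : (d.append e).IsPictureOf (p.mul q) := by
  have hd' : ∀ v w, d.lines (d.marked v) (d.marked w) → p.rel v w := fun v w => (hd v w).2
  have he' : ∀ v w, e.lines (e.marked v) (e.marked w) → q.rel v w := fun v w => (he v w).2
  have hmark : ∀ v : Fin l ⊕ Fin n, (d.append e).marked v = gluedPoint d e (outer v) := by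
    rintro (v | v) <;> rfl
  have hleft : ∀ v, gluedPoint d e (Sum.map id Sum.inl v) = d.marked v := by
    rintro (v | v) <;> rfl
  have hright : ∀ v, gluedPoint d e (Sum.inr v) = (d.depth + (e.marked v).1, (e.marked v).2) := by
    rintro (v | v) <;> rfl
  -- a marked point of `d` at the level where the pictures meet is a marked point of `e`
  have hmid : ∀ {P' : ℕ × ℕ}, P'.1 = 0 → P'.2 < m → ∃ b : Fin m,
      P' = e.marked (Sum.inl b) ∧ (d.depth + P'.1, P'.2) = d.marked (Sum.inr b) := by
    rintro ⟨s, j⟩ h1 h2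
    simp only at h1 h2
    subst h1
    exact ⟨⟨j, h2⟩, rfl, rfl⟩
  -- the class of a glued vertex is determined by its point
  have hdet : ∀ x z, Meets d e p q (gluedPoint d e x) z → glue p.rel q.rel x z := by
    have caseL : ∀ v z, (∃ w, d.lines (d.marked v) (d.marked w) ∧
        glue p.rel q.rel (Sum.map id Sum.inl w) z) →
        glue p.rel q.rel (Sum.map id Sum.inl v) z := by
      rintro v z ⟨w, h1, h2⟩
      exact Setoid.trans' _ (glue_left _ (hd' _ _ h1)) h2
    have caseR : ∀ v z, (∃ w, e.lines (e.marked v) (e.marked w) ∧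
        glue p.rel q.rel (Sum.inr w) z) → glue p.rel q.rel (Sum.inr v) z := by
      rintro v z ⟨w, h1, h2⟩
      exact Setoid.trans' _ (glue_right _ (he' _ _ h1)) h2
    have caseL' : ∀ v z P', d.marked v = (d.depth + P'.1, P'.2) → (∃ w, e.lines P' (e.marked w) ∧
        glue p.rel q.rel (Sum.inr w) z) → glue p.rel q.rel (Sum.map id Sum.inl v) z := by
      intro v z P' h1 h2
      have h3 := marked_level_le (d := d) v
      have h4 : (d.marked v).2 < m := by
        rcases v with a | b
        · have h5 : d.depth = 0 := by
            have := congrArg Prod.fst h1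
            simp only [marked] at this
            omega
          have h6 : l = m :=
            d.width_top.symm.trans ((congrArg d.width h5.symm).trans d.width_bottom)
          exact lt_of_lt_of_eq a.2 h6
        · exact b.2
      rw [h1] at h3 h4
      obtain ⟨b, rfl, hb⟩ := hmid (P' := P') (by simp only at h3; omega) h4
      have h5 : p.rel v (Sum.inr b) := hd' _ _ (by rw [h1, hb])
      exact Setoid.trans' _ (glue_left _ h5) (caseR (Sum.inl b) z h2)
    have caseR' : ∀ v z, (∃ w, d.lines (d.depth + (e.marked v).1, (e.marked v).2) (d.marked w) ∧
        glue p.rel q.rel (Sum.map id Sum.inl w) z) → glue p.rel q.rel (Sum.inr v) z := by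
      rintro v z ⟨w, h1, h2⟩
      have h3 := (lines_level_iff h1).2 (marked_level_le w)
      have h4 : (e.marked v).1 = 0 := by simp only at h3; omega
      have h4' : (e.marked v).2 < m := by
        rcases v with a | b
        · exact a.2
        · have h6 : n = m :=
            e.width_bottom.symm.trans ((congrArg e.width h4).trans e.width_top)
          exact lt_of_lt_of_eq b.2 h6
      obtain ⟨b, hb, hb'⟩ := hmid h4 h4'
      have h5 : q.rel v (Sum.inl b) := he' _ _ (by rw [hb])
      rw [hb'] at h1
      exact Setoid.trans' _ (glue_right _ h5) (caseL (Sum.inr b) z ⟨w, h1, h2⟩)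
    intro x z h
    rcases x with a | x
    · rcases h with h | ⟨P', w, h1, h2⟩
      · exact caseL (Sum.inl a) z h
      · exact caseL' (Sum.inl a) z P' h1 ⟨w, h2⟩
    · rw [hright] at h
      rcases h with h | ⟨P', w, h1, h2⟩
      · exact caseR' x z h
      · refine caseR x z ⟨w, ?_, h2.2⟩
        have : e.marked x = P' := Prod.ext (by simpa using congrArg Prod.fst h1)
          (by simpa using congrArg Prod.snd h1)
        rw [this]
        exact h2.1
  have hself : ∀ x, Meets d e p q (gluedPoint d e x) x := by
    rintro (a | x)
    · exact Or.inl ⟨Sum.inl a, d.lines.refl' _, Setoid.refl' _ _⟩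
    · rw [hright]
      exact Or.inr ⟨_, x, rfl, e.lines.refl' _, Setoid.refl' _ _⟩
  -- a point in the middle level meets the same marked points in both pictures
  have htoR : ∀ {P' Q' : ℕ × ℕ} {z}, e.lines P' Q' → P'.2 < e.width P'.1 →
      Meets d e p q (d.depth + P'.1, P'.2) z → Meets d e p q (d.depth + Q'.1, Q'.2) z := by
    intro P' Q' z hl hw h
    rcases h with h | ⟨P'', w, h1, h2, h3⟩
    · obtain ⟨w, h1, h2⟩ := id h
      have h3 := (lines_level_iff h1).2 (marked_level_le w)
      have h4 : P'.1 = 0 := by simp only at h3; omega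
      rw [h4, e.width_top] at hw
      obtain ⟨b, rfl, hb⟩ := hmid h4 hw
      refine Or.inr ⟨Q', Sum.inl b, rfl, e.lines.symm' hl, hdet (Sum.inr (Sum.inl b)) z (Or.inl ?_)⟩
      exact h
    · have : P' = P'' := Prod.ext (by simpa using congrArg Prod.fst h1)
          (by simpa using congrArg Prod.snd h1)
      subst this
      exact Or.inr ⟨Q', w, rfl, e.lines.trans' (e.lines.symm' hl) h2, h3⟩
  have htoL : ∀ {P Q : ℕ × ℕ} {z}, d.lines P Q → P.1 ≤ d.depth → P.2 < d.width P.1 →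
      Meets d e p q P z → Meets d e p q Q z := by
    intro P Q z hl hP hw h
    rcases h with ⟨w, h1, h2⟩ | ⟨P', w, rfl, h2, h3⟩
    · exact Or.inl ⟨w, d.lines.trans' (d.lines.symm' hl) h1, h2⟩
    · have h4 : P'.1 = 0 := by simp only at hP; omega
      rw [h4, Nat.add_zero, d.width_bottom] at hw
      obtain ⟨b, rfl, hb⟩ := hmid h4 hw
      refine Or.inl ⟨Sum.inr b, ?_, hdet (Sum.inr (Sum.inl b)) z (Or.inr ⟨_, w, hb.symm, h2, h3⟩)⟩
      rw [← hb]
      exact d.lines.symm' hl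
  have hseg : ∀ {P Q : ℕ × ℕ} {z}, (d.append e).Segment P Q →
      (Meets d e p q P z ↔ Meets d e p q Q z) := by
    intro P Q z h
    rcases Segment.of_append d e h with h | ⟨P', Q', h', rfl, rfl⟩
    · have hl := d.lines_of_segment h
      obtain ⟨⟨h1, h2⟩, h3, h4⟩ := h.valid
      exact ⟨htoL hl h1 h2, htoL (d.lines.symm' hl) h3 h4⟩
    · have hl := e.lines_of_segment h'
      obtain ⟨⟨_, h2⟩, _, h4⟩ := h'.valid
      exact ⟨htoR hl h2, htoR (e.lines.symm' hl) h4⟩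
  have hlines : ∀ {P Q : ℕ × ℕ} {z}, (d.append e).lines P Q →
      (Meets d e p q P z ↔ Meets d e p q Q z) := by
    intro P Q z h
    change Relation.EqvGen _ P Q at h
    induction h with
    | rel _ _ h => exact hseg h
    | refl => exact Iff.rfl
    | symm _ _ _ ih => exact ih.symm
    | trans _ _ _ _ _ ih1 ih2 => exact ih1.trans ih2
  have hle : glue p.rel q.rel ≤ (d.append e).lines.comap (gluedPoint d e) := by
    refine sup_le ?_ ?_ <;> rw [map_le_iff] <;> intro v w h
    · rw [Setoid.comap_rel, hleft, hleft]
      exact lines_append_left ((hd v w).1 h)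
    · rw [Setoid.comap_rel, hright, hright]
      exact lines_append_right ((he v w).1 h)
  intro v w
  rw [hmark, hmark]
  constructor
  · intro h
    exact hle h
  · intro h
    change glue p.rel q.rel (outer v) (outer w)
    exact hdet _ _ ((hlines h).2 (hself _))

end Append

end Picture

/-! ### Pictures of the generators -/

namespace Picture

variable {l m n : ℕ}

/-- The picture without layers. -/
def vertical (m : ℕ) : Picture m m where
  depth := 0
  width _ := m
  layer _ := .cross 0
  width_top := rfl
  width_bottom := rfl
  fits t ht := absurd ht (Nat.not_lt_zero t)

theorem vertical_isPictureOf (m : ℕ) : (vertical m).IsPictureOf (BrauerPartition.one m) := by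
  intro v w
  constructor
  · intro h
    have : (vertical m).marked v = (vertical m).marked w := by
      rcases v with v | v <;> rcases w with w | w <;> cases h <;> rfl
    rw [this]
    exact .refl _
  · intro h
    have key : ∀ P Q, Relation.EqvGen (vertical m).Segment P Q → P.2 = Q.2 := by
      intro P Q h
      induction h with
      | rel _ _ h =>
        rcases h with ⟨t, _, _, ht⟩ | ⟨t, _, ht⟩ | ⟨t, _, ht⟩ <;>
          exact absurd ht (Nat.not_lt_zero t)
      | refl => rfl
      | symm _ _ _ ih => exact ih.symm
      | trans _ _ _ _ _ ih1 ih2 => exact ih1.trans ih2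
    have h1 := key _ _ h
    rcases v with v | v <;> rcases w with w | w <;> exact Fin.ext h1

theorem vertical_heightLE (m : ℕ) (k : ℤ) : (vertical m).HeightLE k :=
  fun t _ ht => absurd ht (Nat.not_lt_zero t)

/-- The picture with one crossing. -/
def crossing (m a : ℕ) (h : a + 2 ≤ m) : Picture m m where
  depth := 1
  width _ := m
  layer _ := .cross a
  width_top := rfl
  width_bottom := rfl
  fits _ _ := ⟨h, rfl⟩

theorem crossing_isPictureOf {m j : ℕ} (h1 : 1 ≤ j) (h2 : j < m) :
    (crossing m (j - 1) (by omega)).IsPictureOf (BrauerPartition.sigma j h1 h2) := by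
  have hj : j - 1 + 1 = j := by omega
  have hswap : ∀ a : Fin m, (Equiv.swap (⟨j - 1, by omega⟩ : Fin m) ⟨j, h2⟩ a : ℕ) =
      Equiv.swap (j - 1) (j - 1 + 1) (a : ℕ) := by
    intro a
    rw [hj]
    simp only [Equiv.swap_apply_def, Fin.ext_iff]
    split_ifs <;> rfl
  have hrun : ∀ a : Fin m, (crossing m (j - 1) (by omega)).Segment (0, a)
      (1, (Equiv.swap (⟨j - 1, by omega⟩ : Fin m) ⟨j, h2⟩ a : ℕ)) := fun a =>
    .run 0 a _ Nat.one_pos a.2 (hswap a)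
  -- a label of the lines: the position of their lower end
  let L : ℕ × ℕ → ℕ := fun P => if P.1 = 0 then Equiv.swap (j - 1) (j - 1 + 1) P.2 else P.2
  have key : ∀ P Q, Relation.EqvGen (crossing m (j - 1) (by omega)).Segment P Q → L P = L Q := by
    intro P Q h
    induction h with
    | rel _ _ h =>
      rcases h with ⟨t, a, a', ht, _, hr⟩ | ⟨t, a, ht, hL⟩ | ⟨t, a, ht, hL⟩
      · have ht0 : t = 0 := Nat.lt_one_iff.1 ht
        subst ht0
        exact hr.symm
      · cases hL
      · cases hL
    | refl => rfl
    | symm _ _ _ ih => exact ih.symm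
    | trans _ _ _ _ _ ih1 ih2 => exact ih1.trans ih2
  intro v w
  constructor
  · rintro (rfl | rfl)
    · exact .refl _
    · rcases v with v | v
      · exact .rel _ _ (hrun v)
      · have := hrun (Equiv.swap (⟨j - 1, by omega⟩ : Fin m) ⟨j, h2⟩ v)
        rw [Equiv.swap_apply_self] at this
        exact .symm _ _ (.rel _ _ this)
  · intro h
    have h3 := key _ _ h
    rcases v with v | v <;> rcases w with w | w
    · exact Or.inl (congrArg Sum.inl (Fin.ext ((Equiv.injective _) h3)).symm)
    · refine Or.inr (congrArg Sum.inr (Fin.ext ?_))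
      rw [hswap]
      exact h3.symm
    · refine Or.inr (congrArg Sum.inl (Fin.ext ?_))
      rw [hswap]
      change (v : ℕ) = Equiv.swap (j - 1) (j - 1 + 1) (w : ℕ) at h3
      rw [h3, Equiv.swap_apply_self]
    · exact Or.inl (congrArg Sum.inr (Fin.ext h3).symm)

/-- The horizontal path to the left edge. -/
theorem pathToLeft_of_le {d : Picture l m} {t g : ℕ} (ht : t ≤ d.depth) (hg : g ≤ d.width t) :
    d.PathToLeft (t, g) g := by
  induction g with
  | zero => exact .left t ht
  | succ g ih => exact .crossLeft t g g ht hg (ih (by omega))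

theorem crossing_heightLE {m a : ℕ} (h : a + 2 ≤ m) : (crossing m a h).HeightLE a := by
  intro t b ht hL
  cases hL
  exact ⟨(t, a), a, Or.inl rfl, pathToLeft_of_le ht.le (by simp only [crossing]; omega), le_rfl⟩

/-- The picture with one local minimum above one local maximum. -/
def minMax (m a : ℕ) (h : a + 2 ≤ m) : Picture m m where
  depth := 2
  width t := if t = 1 then m - 2 else m
  layer t := if t = 0 then .cup a else .cap a
  width_top := rfl
  width_bottom := rfl
  fits t ht := by
    rcases t with _ | _ | t
    · exact ⟨h, by simp only [Nat.zero_add, if_true, if_neg Nat.zero_ne_one]; omega⟩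
    · exact ⟨by simp only [Nat.zero_add, if_true]; omega, by simp; omega⟩
    · omega

theorem minMax_isPictureOf {m j : ℕ} (h1 : 1 ≤ j) (h2 : j < m) :
    (minMax m (j - 1) (by omega)).IsPictureOf (BrauerPartition.cupCap j h1 h2) := by
  set d := minMax m (j - 1) (by omega) with hd
  have hcup : d.Segment (0, j - 1) (0, j - 1 + 1) := .cup 0 (j - 1) Nat.two_pos rfl
  have hcap : d.Segment (2, j - 1) (2, j - 1 + 1) := .cap 1 (j - 1) Nat.one_lt_two rfl
  have hthrough : ∀ a : Fin m, a.1 ≠ j - 1 → a.1 ≠ j → d.lines (0, a) (2, a) := by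
    intro a ha ha'
    have ha2 := a.2
    by_cases h : a.1 < j - 1
    · have k1 : d.Segment (0, a) (1, a) := .run 0 a a Nat.two_pos a.2 (Or.inl ⟨h, rfl⟩)
      have k2 : d.Segment (1, a) (2, a) := .run 1 a a Nat.one_lt_two
        (by simp only [hd, minMax, if_true]; omega) (Or.inl ⟨h, rfl⟩)
      exact .trans _ _ _ (.rel _ _ k1) (.rel _ _ k2)
    · have k1 : d.Segment (0, a) (1, a - 2) := .run 0 a (a - 2) Nat.two_pos a.2
        (Or.inr ⟨by omega, by omega⟩)
      have k2 : d.Segment (1, a - 2) (2, a) := .run 1 (a - 2) a Nat.one_lt_two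
        (by simp only [hd, minMax, if_true]; omega) (Or.inr ⟨by omega, by omega⟩)
      exact .trans _ _ _ (.rel _ _ k1) (.rel _ _ k2)
  have hj : j - 1 + 1 = j := by omega
  -- a label of the lines: the common position of a vertical line, or one of two arcs
  let L : ℕ × ℕ → ℕ × ℕ := fun P =>
    if P.1 = 1 then (if P.2 < j - 1 then P.2 else P.2 + 2, 0)
    else if P.2 = j - 1 ∨ P.2 = j then (0, P.1 + 1) else (P.2, 0)
  have key : ∀ P Q, Relation.EqvGen d.Segment P Q → L P = L Q := by
    intro P Q h
    induction h with
    | rel _ _ h =>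
      rcases h with ⟨t, a, a', ht, _, hr⟩ | ⟨t, a, ht, hL⟩ | ⟨t, a, ht, hL⟩
      · have ht' : t = 0 ∨ t = 1 := by
          have : t < 2 := ht
          omega
        rcases ht' with rfl | rfl
        · change (a < j - 1 ∧ a' = a) ∨ (j - 1 + 2 ≤ a ∧ a = a' + 2) at hr
          simp only [L, Nat.zero_add, if_true, Nat.reduceAdd, Nat.reduceEqDiff, if_false]
          split_ifs <;> simp only [Prod.mk.injEq, and_true] <;> omega
        · change (a < j - 1 ∧ a' = a) ∨ (j - 1 ≤ a ∧ a' = a + 2) at hr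
          simp only [L, if_true, Nat.reduceAdd, Nat.reduceEqDiff, if_false]
          split_ifs <;> simp only [Prod.mk.injEq, and_true] <;> omega
      · have ht' : t = 0 := by
          by_contra h0
          simp [hd, minMax, h0] at hL
        subst ht'
        have ha : j - 1 = a := PictureLayer.cup.inj hL
        subst ha
        simp only [L, if_pos (Or.inr hj)]
        rfl
      · have ht' : t = 1 := by
          have : t < 2 := ht
          have h0 : t ≠ 0 := by
            rintro rfl
            simp [hd, minMax] at hL
          omega
        subst ht'
        have ha : j - 1 = a := PictureLayer.cap.inj hL
        subst ha
        simp only [L, if_pos (Or.inr hj)]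
        rfl
    | refl => rfl
    | symm _ _ _ ih => exact ih.symm
    | trans _ _ _ _ _ ih1 ih2 => exact ih1.trans ih2
  have hpart : ∀ v, d.lines (d.marked v) (d.marked (BrauerPartition.cupCapPartner j h2 v)) := by
    rw [hj] at hcup hcap
    rintro (v | v) <;> simp only [BrauerPartition.cupCapPartner] <;> split_ifs with h
    · rcases h with h | h
      · have : v = ⟨j - 1, by omega⟩ := Fin.ext h
        rw [this, Equiv.swap_apply_left]
        exact .rel _ _ hcup
      · have : v = ⟨j, h2⟩ := Fin.ext h
        rw [this, Equiv.swap_apply_right]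
        exact .symm _ _ (.rel _ _ hcup)
    · push Not at h
      exact hthrough v h.1 h.2
    · rcases h with h | h
      · have : v = ⟨j - 1, by omega⟩ := Fin.ext h
        rw [this, Equiv.swap_apply_left]
        exact .rel _ _ hcap
      · have : v = ⟨j, h2⟩ := Fin.ext h
        rw [this, Equiv.swap_apply_right]
        exact .symm _ _ (.rel _ _ hcap)
    · push Not at h
      exact d.lines.symm' (hthrough v h.1 h.2)
  intro v w
  constructor
  · rintro (rfl | rfl)
    · exact .refl _
    · exact hpart v
  · intro h
    have h3 := key _ _ h
    change w = v ∨ w = BrauerPartition.cupCapPartner j h2 v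
    have hcase : ∀ a : ℕ, ∀ s ≠ 1, L (s, a) = if a = j - 1 ∨ a = j then (0, s + 1) else (a, 0) :=
      fun a s hs => if_neg hs
    rcases v with v | v <;> rcases w with w | w
    · change L (0, _) = L (0, _) at h3
      rw [hcase _ _ (by omega), hcase _ _ (by omega)] at h3
      simp only [BrauerPartition.cupCapPartner, Equiv.swap_apply_def, Fin.ext_iff]
      split_ifs at h3 ⊢ <;>
        simp only [Prod.mk.injEq, Sum.inl.injEq, reduceCtorEq, Fin.ext_iff, or_false] at h3 ⊢ <;>
        first | omega | exact h3.2.elim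
    · change L (0, _) = L (2, _) at h3
      rw [hcase _ _ (by omega), hcase _ _ (by omega)] at h3
      simp only [BrauerPartition.cupCapPartner]
      split_ifs at h3 ⊢ <;>
        simp only [Prod.mk.injEq, Sum.inr.injEq, reduceCtorEq, Fin.ext_iff, false_or] at h3 ⊢ <;>
        first | omega | exact h3.2.elim
    · change L (2, _) = L (0, _) at h3
      rw [hcase _ _ (by omega), hcase _ _ (by omega)] at h3
      simp only [BrauerPartition.cupCapPartner]
      split_ifs at h3 ⊢ <;>
        simp only [Prod.mk.injEq, Sum.inl.injEq, reduceCtorEq, Fin.ext_iff, false_or] at h3 ⊢ <;>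
        first | omega | exact h3.2.elim
    · change L (2, _) = L (2, _) at h3
      rw [hcase _ _ (by omega), hcase _ _ (by omega)] at h3
      simp only [BrauerPartition.cupCapPartner, Equiv.swap_apply_def, Fin.ext_iff]
      split_ifs at h3 ⊢ <;>
        simp only [Prod.mk.injEq, Sum.inr.injEq, reduceCtorEq, Fin.ext_iff, or_false] at h3 ⊢ <;>
        first | omega | exact h3.2.elim

theorem minMax_heightLE {m a : ℕ} (h : a + 2 ≤ m) (k : ℤ) : (minMax m a h).HeightLE k := by
  intro t b ht hL
  simp only [minMax] at hL
  split_ifs at hL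

end Picture

/-! ### Chains -/

namespace Brauer

variable {i N : ℕ} {f : ℕ → ℕ}

/-- The pair that opens at `a` can be a member of one of the chains: it opens at a place covered by
at most `i` pairs, and not all of its span is covered by more than `i` pairs. -/
def ChainLink (i : ℕ) (f : ℕ → ℕ) (a : ℕ) : Prop :=
  a < f a ∧ cover f a ≤ i ∧ ∃ g, a < g ∧ g ≤ f a ∧ i ≤ g ∧ cover f g ≤ i

/-- The pair that opens at `b` follows the pair that opens at `a` in a chain: `b` is the last
position in front of which only `i` pairs are open before the closing end of the first pair. -/
def ChainStep (i : ℕ) (f : ℕ → ℕ) (a b : ℕ) : Prop :=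
  ChainLink i f a ∧ ChainLink i f b ∧ a < b ∧ b < f a ∧ f a < f b ∧ i ≤ b ∧ cover f b = i ∧
    ∀ g, b < g → g ≤ f a → i + 1 ≤ cover f g

/-- The crossing condition bounds the cover at the closing end of a pair that opens at a place
covered by at most `i` pairs, whether or not the pair is crossed. -/
theorem IsTame.cover_partner_le (hf : IsTame i N f) {a : ℕ} (h1 : a < f a) (h2 : cover f a ≤ i) :
    cover f (f a) ≤ i + 1 := by
  by_contra hc
  have h3 : cover f (f a) ≤ cover f (a + 1) := by
    apply Finset.card_le_card
    intro z hz
    simp only [Finset.mem_filter, Finset.mem_range] at hz ⊢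
    have h4 := hf.cover_le a z
    have h5 : f z = f a → z = a := fun e => by
      rw [← hf.matching.invol z, e, hf.matching.invol]
    by_cases e : z = a
    · subst e; omega
    · have : f z ≠ f a := fun k => e (h5 k)
      omega
  rw [cover_succ_of_lt hf.matching.invol h1] at h3
  omega

/-- A chain can be continued until it closes among the last `i` positions. -/
theorem IsTame.exists_chainStep (hf : IsTame i N f) {a : ℕ} (ha : ChainLink i f a)
    (hN : f a + i < N) : ∃ b, ChainStep i f a b := by
  obtain ⟨h1, h2, g, g1, g2, g3, g4⟩ := ha
  have hI := hf.matching.invol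
  have hr := hf.cover_partner_le h1 h2
  have hr' := cover_succ_of_gt hI (x := f a) (by rw [hI]; exact h1)
  have hC := fun g k1 k2 => hf.le_cover g k1 k2
  have hr'' := hC (f a + 1) (by omega) (by omega)
  obtain ⟨b, hb, hbmax⟩ := Finset.exists_max_image
    ((Finset.Icc g (f a)).filter fun b => cover f b = i) id
    ⟨g, by
      have := hC g g3 (by omega)
      simp only [Finset.mem_filter, Finset.mem_Icc]
      omega⟩
  simp only [Finset.mem_filter, Finset.mem_Icc, id] at hb hbmax
  have hne : b ≠ f a := by rintro rfl; omega
  have hgt : ∀ g, b < g → g ≤ f a → i + 1 ≤ cover f g := by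
    intro g' k1 k2
    have k3 := hC g' (by omega) (by omega)
    have k4 : cover f g' ≠ i := fun e => by
      have := hbmax g' ⟨⟨by omega, k2⟩, e⟩
      omega
    omega
  have hopen : b < f b := by
    by_contra h
    have k1 := hf.matching.ne b (by omega)
    have k2 := cover_succ_of_gt hI (x := b) (by omega)
    have k3 := hgt (b + 1) (by omega) (by omega)
    omega
  have hcl : f a < f b := by
    by_contra h
    have k0 : f b ≠ f a := fun e => by
      have : b = a := by rw [← hI b, e, hI]
      omega
    have k1 := hf.cover_partner_le hopen (by omega)
    have k2 := cover_succ_of_gt hI (x := f b) (by rw [hI]; exact hopen)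
    have k3 := hgt (f b + 1) (by omega) (by omega)
    omega
  refine ⟨b, ⟨h1, h2, g, g1, g2, g3, g4⟩, ⟨hopen, by omega, f a + 1, by omega, by omega, by omega,
    by omega⟩, by omega, by omega, hcl, by omega, hb.2, hgt⟩

/-- If two pairs had the same successor, the one that closes first would do so inside the link
region of the other, where it would be covered by more than `i + 1` pairs. -/
theorem IsTame.chainStep_left_unique (hf : IsTame i N f) {a a' b : ℕ} (h : ChainStep i f a b)
    (h' : ChainStep i f a' b) : a = a' := by
  have hI := hf.matching.invol
  have key : ∀ {a a'}, ChainStep i f a b → ChainStep i f a' b → ¬ f a < f a' := by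
    intro a a' h h' hlt
    have k1 := hf.cover_partner_le h.1.1 h.1.2.1
    have k2 := cover_succ_of_gt hI (x := f a) (by rw [hI]; exact h.1.1)
    have k3 := h'.2.2.2.2.2.2.2 (f a + 1) (by have := h.2.2.2.1; omega) (by omega)
    omega
  have e : f a = f a' := by
    have := key h h'
    have := key h' h
    omega
  rw [← hI a, e, hI]

/-- Chains with different starting positions `a, a' < i` have no member in common. -/
theorem IsTame.eq_of_reflTransGen_chainStep (hf : IsTame i N f) {a a' b : ℕ} (ha : a < i)
    (ha' : a' < i) (h : Relation.ReflTransGen (ChainStep i f) a b)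
    (h' : Relation.ReflTransGen (ChainStep i f) a' b) : a = a' := by
  have key : ∀ {a a'}, a' < i → Relation.ReflTransGen (ChainStep i f) a a' → a = a' := by
    intro a a' ha' h
    rcases Relation.ReflTransGen.cases_tail h with e | ⟨c, _, h3⟩
    · exact e.symm
    · have := h3.2.2.2.2.2.1
      omega
  have hu : Relator.RightUnique (Function.swap (ChainStep i f)) :=
    fun _ _ _ h1 h2 => hf.chainStep_left_unique h1 h2
  rcases Relation.ReflTransGen.total_of_right_unique hu (Relation.reflTransGen_swap.2 h)
    (Relation.reflTransGen_swap.2 h') with k | k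
  · exact (key ha (Relation.reflTransGen_swap.1 k)).symm
  · exact key ha' (Relation.reflTransGen_swap.1 k)

end Brauer

namespace BrauerPartition

variable {i m n : ℕ}

theorem exists_mem_cover {p : BrauerPartition m n} {g : ℕ} {v w : Fin m ⊕ Fin n}
    (hw : g ≤ diskPos w) (c : List ((Fin m ⊕ Fin n) × (Fin m ⊕ Fin n))) :
    p.IsChain c → StartsAt c v → diskPos v < g → EndsAt c w →
      ∃ e ∈ c, diskPos e.1 < g ∧ g ≤ diskPos e.2 := by
  induction c generalizing v with
  | nil => intro _ h; simp [StartsAt] at h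
  | cons e c ih =>
    intro hc hs hv he
    simp only [StartsAt, List.head?_cons, Option.map_some, Option.some.injEq] at hs
    by_cases h : g ≤ diskPos e.2
    · exact ⟨e, by simp, by rw [hs]; exact hv, h⟩
    · cases c with
      | nil =>
        simp only [EndsAt, List.getLast?_singleton, Option.map_some, Option.some.injEq] at he
        rw [he] at h
        exact absurd hw h
      | cons e' c =>
        obtain ⟨hc1, hc2⟩ := hc
        rw [List.isChain_cons_cons] at hc2
        obtain ⟨x, hx, hx'⟩ := ih (v := e'.1) ⟨fun y hy => hc1 y (List.mem_cons_of_mem _ hy), hc2.2⟩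
          rfl (by omega) (by simpa [EndsAt] using he)
        exact ⟨x, List.mem_cons_of_mem _ hx, hx'⟩

/-- Each chain contains a pair that covers the given gap, and exclusive chains have no pair in
common. -/
theorem IsLChain.le_cover {p : BrauerPartition m n} (hp : p.IsLChain i) {g : ℕ} (h1 : i ≤ g)
    (h2 : g + i ≤ m + n) : i ≤ cover p.diskInv g := by
  obtain ⟨c, hc, hs, he, hd⟩ := hp
  have h : ∀ s, ∃ e ∈ c s, diskPos e.1 < g ∧ g ≤ diskPos e.2 := by
    intro s
    obtain ⟨v, hv, hv'⟩ := hs s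
    obtain ⟨w, hw, hw'⟩ := he s
    have := s.2
    refine exists_mem_cover (v := Sum.inl v) (w := Sum.inr w) ?_ (c s) (hc s) hv' ?_ hw' <;>
      simp only [diskPos] <;> omega
  choose e he1 he2 he3 using h
  have hf : ∀ s, p.diskInv (diskPos (e s).1) = diskPos (e s).2 := by
    intro s
    obtain ⟨h4, h5⟩ := (hc s).1 (e s) (he1 s)
    rcases (p.rel_iff _ _).1 h4 with h6 | h6
    · rw [h6] at h5
      omega
    · exact h6
  have hinj : Function.Injective fun s => diskPos (e s).1 := by
    intro s s' h
    have h4 : (e s).1 = (e s').1 := diskPos_injective h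
    have h5 : (e s).2 = (e s').2 := diskPos_injective (by rw [← hf, ← hf, h4])
    by_contra hne
    refine (hd s s' hne).1 (he1 s) ?_
    rw [Prod.ext h4 h5]
    exact he1 s'
  calc i = (Finset.univ.image fun s => diskPos (e s).1).card := by
        rw [Finset.card_image_of_injective _ hinj, Finset.card_univ, Fintype.card_fin]
    _ ≤ _ := by
        apply Finset.card_le_card
        intro x hx
        simp only [Finset.mem_image, Finset.mem_univ, true_and] at hx
        obtain ⟨s, rfl⟩ := hx
        rw [Finset.mem_filter, Finset.mem_range, hf]
        exact ⟨he2 s, he3 s⟩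

/-- The greedy continuation of a chain, as the list of the opening ends of its pairs. -/
theorem exists_chain {p : BrauerPartition m n} (hp : IsTame i (m + n) p.diskInv)
    (v : Fin m ⊕ Fin n) (hv : ChainLink i p.diskInv (diskPos v)) :
    ∃ L : List (Fin m ⊕ Fin n),
      (v :: L).IsChain (fun a b => ChainStep i p.diskInv (diskPos a) (diskPos b)) ∧
      (∀ w ∈ v :: L, ChainLink i p.diskInv (diskPos w) ∧
        Relation.ReflTransGen (ChainStep i p.diskInv) (diskPos v) (diskPos w)) ∧
      ∃ w, (v :: L).getLast? = some w ∧ m + n ≤ p.diskInv (diskPos w) + i := by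
  by_cases h : p.diskInv (diskPos v) + i < m + n
  · obtain ⟨b, hb⟩ := hp.exists_chainStep hv h
    have hbl : p.diskInv (diskPos v) < p.diskInv b := hb.2.2.2.2.1
    obtain ⟨w, rfl⟩ := exists_diskPos (m := m) (n := n) (x := b) (by
      have := hb.2.2.2.1
      omega)
    have hlt := p.isDiskMatching_diskInv.lt _ (diskPos_lt w)
    obtain ⟨L, hL1, hL2, u, hu⟩ := exists_chain hp w hb.2.1
    refine ⟨w :: L, List.isChain_cons_cons.2 ⟨hb, hL1⟩, fun x hx => ?_, u, ?_, hu.2⟩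
    · rcases List.mem_cons.1 hx with rfl | hx
      · exact ⟨hv, .refl⟩
      · exact ⟨(hL2 x hx).1, .head hb (hL2 x hx).2⟩
    · rw [← hu.1, List.getLast?_cons_cons]
  · refine ⟨[], List.isChain_singleton _, fun x hx => ?_, v, by simp, by omega⟩
    rw [List.mem_singleton] at hx
    subst hx
    exact ⟨hv, .refl⟩
  termination_by m + n - p.diskInv (diskPos v)

/-- In the link region of a step of a greedy chain, more than `i` pairs cover each gap except the
first, and exactly `i` cover that one. So link regions that meet have the same first gap, and
belong to the same chain. -/
theorem isLChain_of_isTame (him : i ≤ m) {p : BrauerPartition m m}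
    (hp : IsTame i (m + m) p.diskInv) : p.IsLChain i := by
  have hm := hp.matching
  have hfirst : ∀ s < i, i ≤ p.diskInv s := fun s hs => hp.first_lt (by omega) hs
  have hlink : ∀ s : Fin i, ChainLink i p.diskInv
      (diskPos (Sum.inl (s.castLE him) : Fin m ⊕ Fin m)) := by
    intro s
    have h1 := hfirst s s.2
    have h2 := cover_le_self p.diskInv s
    have h3 := cover_le_self p.diskInv i
    have h4 := s.2
    exact ⟨by simp only [diskPos, Fin.val_castLE]; omega,
      by simp only [diskPos, Fin.val_castLE]; omega, i, h4, h1, le_rfl, h3⟩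
  choose L hL1 hL2 hL3 using fun s => exists_chain hp _ (hlink s)
  let pr : Fin m ⊕ Fin m → (Fin m ⊕ Fin m) × (Fin m ⊕ Fin m) := fun v => (v, p.partner v)
  have hpr : ∀ v, diskPos (pr v).2 = p.diskInv (diskPos v) := fun v => (p.diskInv_diskPos v).symm
  let c := fun s : Fin i => (Sum.inl (s.castLE him) :: L s).map pr
  have hstep : ∀ s, (c s).IsChain fun e f => ChainStep i p.diskInv (diskPos e.1) (diskPos f.1) ∧
      diskPos e.2 = p.diskInv (diskPos e.1) ∧ diskPos f.2 = p.diskInv (diskPos f.1) := by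
    intro s
    rw [List.isChain_map]
    exact (hL1 s).imp fun a b h => ⟨h, hpr a, hpr b⟩
  have hmem : ∀ s e, e ∈ c s → Relation.ReflTransGen (ChainStep i p.diskInv) s (diskPos e.1) := by
    intro s e he
    obtain ⟨v, hv, rfl⟩ := List.mem_map.1 he
    exact (hL2 s v hv).2
  have huniq : ∀ s s' e e', e ∈ c s → e' ∈ c s' → diskPos e.1 = diskPos e'.1 → s = s' := by
    intro s s' e e' he he' h
    have h1 := hmem s' e' he'
    rw [← h] at h1
    exact Fin.ext (hp.eq_of_reflTransGen_chainStep s.2 s'.2 (hmem s e he) h1)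
  refine ⟨c, fun s => ⟨fun e he => ?_, (hstep s).imp ?_⟩, fun s => ⟨s.castLE him, rfl, rfl⟩,
    fun s => ?_, fun s s' hss => ⟨fun e he he' => hss (huniq s s' e e he he' rfl), ?_⟩⟩
  · obtain ⟨v, hv, rfl⟩ := List.mem_map.1 he
    refine ⟨(p.rel_iff_partner _ _).2 (Or.inr rfl), ?_⟩
    rw [hpr]
    exact (hL2 s v hv).1.1
  · rintro e f ⟨h1, h2, h3⟩
    rw [h2, h3]
    exact ⟨h1.2.2.1, h1.2.2.2.1, h1.2.2.2.2.1⟩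
  · obtain ⟨w, hw1, hw2⟩ := hL3 s
    have h1 := p.diskInv_diskPos w
    have h2 := s.2
    rcases hpw : p.partner w with a | b
    · rw [hpw] at h1
      change _ = a.1 at h1
      have := a.2
      omega
    · rw [hpw] at h1
      change _ = m + m - 1 - b.1 at h1
      have := b.2
      refine ⟨b, by omega, ?_⟩
      simp only [EndsAt, c, List.getLast?_map, hw1, Option.map_some, pr, hpw]
  · intro e f e' f' h h'
    have k1 := List.isChain_pair.1 ((hstep s).infix h)
    have k2 := List.isChain_pair.1 ((hstep s').infix h')
    have hne : diskPos f.1 ≠ diskPos f'.1 := fun k =>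
      hss (huniq s s' f f' (h.subset (by simp)) (h'.subset (by simp)) k)
    rw [Set.disjoint_left]
    rintro u ⟨u1, u2⟩ ⟨u3, u4⟩
    rcases lt_or_gt_of_ne hne with k | k
    · have := k1.1.2.2.2.2.2.2.2 (diskPos f'.1) k (by omega)
      have := k2.1.2.2.2.2.2.2.1
      omega
    · have := k2.1.2.2.2.2.2.2.2 (diskPos f.1) k (by omega)
      have := k1.1.2.2.2.2.2.2.1
      omega

end BrauerPartition

/-! ### Products of generators -/

theorem Picture.HeightLE.mono {m n : ℕ} {d : Picture m n} {a b : ℤ} (h : d.HeightLE a)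
    (hab : a ≤ b) : d.HeightLE b := by
  intro t c ht hL
  obtain ⟨F, s, hF, hp, hs⟩ := h t c ht hL
  exact ⟨F, s, hF, hp, hs.trans hab⟩

namespace BrauerPartition

variable {i m : ℕ}

/-- The partitions that occur, up to powers of `δ`, as products of the generators. -/
inductive GeneratorProduct (i m : ℕ) : BrauerPartition m m → Prop
  | one : GeneratorProduct i m (one m)
  | mul_sigma (p : BrauerPartition m m) (j : ℕ) (h1 : 1 ≤ j) (h2 : j < m) :
      GeneratorProduct i m p → j ≤ i → GeneratorProduct i m (p.mul (sigma j h1 h2))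
  | mul_cupCap (p : BrauerPartition m m) (j : ℕ) (h1 : 1 ≤ j) (h2 : j < m) :
      GeneratorProduct i m p → i < j → GeneratorProduct i m (p.mul (cupCap j h1 h2))

theorem GeneratorProduct.heightLE {p : BrauerPartition m m} (h : GeneratorProduct i m p) :
    p.HeightLE ((i : ℤ) - 1) := by
  induction h with
  | one => exact ⟨_, Picture.vertical_isPictureOf m, Picture.vertical_heightLE m _⟩
  | mul_sigma p j h1 h2 _ hj ih =>
    obtain ⟨d, hd, hh⟩ := ih
    exact ⟨_, hd.append (Picture.crossing_isPictureOf h1 h2),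
      hh.append ((Picture.crossing_heightLE (by omega)).mono (by omega))⟩
  | mul_cupCap p j h1 h2 _ hj ih =>
    obtain ⟨d, hd, hh⟩ := ih
    exact ⟨_, hd.append (Picture.minMax_isPictureOf h1 h2),
      hh.append (Picture.minMax_heightLE (by omega) _)⟩

theorem diskInv_one (m : ℕ) :
    (one m).diskInv = fun x => if x < m + m then m + m - 1 - x else x := by
  refine diskInv_eq ⟨fun x => ?_, fun x hx => ?_, fun x hx => ?_, fun x hx => ?_⟩ fun v w h => ?_
  · by_cases h : x < m + m
    · simp only [if_pos h, if_pos (show m + m - 1 - x < m + m by omega)]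
      omega
    · simp only [if_neg h]
  · simp only [if_pos hx]
    omega
  · simp only [if_pos hx]
    omega
  · simp only [if_neg (not_lt.2 hx)]
  · have h1 := diskPos_lt v
    simp only [if_pos h1] at h
    change Sum.elim id id v = Sum.elim id id w
    rcases v with v | v <;> rcases w with w | w <;> simp only [diskPos] at h <;>
      apply Fin.ext <;> simp only [Sum.elim_inl, Sum.elim_inr, id] <;> omega

theorem isTame_one : IsTame i (m + m) (one m).diskInv where
  matching := isDiskMatching_diskInv _
  le_cover g h1 h2 := by
    rw [diskInv_one]
    have : Finset.range i ⊆
        (Finset.range g).filter fun x => g ≤ if x < m + m then m + m - 1 - x else x := by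
      intro x hx
      rw [Finset.mem_range] at hx
      rw [Finset.mem_filter, Finset.mem_range, if_pos (by omega)]
      omega
    exact (Finset.card_range i).symm.trans_le (Finset.card_le_card this)
  cover_le x z h1 h2 h3 := by
    rw [diskInv_one] at h2 h3
    simp only at h2 h3
    split_ifs at h2 h3 <;> omega

/-- The bound for the height gives the crossing condition. -/
theorem IsTame.of_heightLE {p : BrauerPartition m m} (hp : p.HeightLE ((i : ℤ) - 1))
    (h : ∀ g, i ≤ g → g + i ≤ m + m → i ≤ cover p.diskInv g) : IsTame i (m + m) p.diskInv where
  matching := isDiskMatching_diskInv _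
  le_cover := h
  cover_le x z h1 h2 h3 := by
    obtain ⟨d, hd, hh⟩ := hp
    have := hd.cover_le hh h1 h2 h3
    omega

theorem GeneratorProduct.isTame (him : i ≤ m) {p : BrauerPartition m m}
    (h : GeneratorProduct i m p) : IsTame i (m + m) p.diskInv := by
  induction h with
  | one => exact isTame_one
  | mul_sigma p j h1 h2 _ hj ih =>
    rw [diskInv_mul_sigma]
    exact ih.conjSwap_succ (by omega) (by omega) (by omega) (by omega)
  | mul_cupCap p j h1 h2 hp hj ih =>
    refine IsTame.of_heightLE (mul_cupCap p j h1 h2 hp hj).heightLE fun g hg hg' => ?_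
    rw [diskInv_mul_cupCap]
    exact ih.le_cover_joinAt (by omega) (by omega) hg hg'

theorem GeneratorProduct.mem_chainSet (him : i ≤ m) {p : BrauerPartition m m}
    (h : GeneratorProduct i m p) : p ∈ chainSet i ((i : ℤ) - 1) m m :=
  ⟨isLChain_of_isTame him (h.isTame him), h.heightLE⟩

theorem isTame_of_mem_chainSet {p : BrauerPartition m m}
    (h : p ∈ chainSet i ((i : ℤ) - 1) m m) : IsTame i (m + m) p.diskInv :=
  IsTame.of_heightLE h.2 fun _ h1 h2 => h.1.le_cover h1 h2

/-- The partitions obtained from the generators by products without closed loops. -/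
inductive LoopFreeProduct (i m : ℕ) : BrauerPartition m m → Prop
  | one : LoopFreeProduct i m (one m)
  | sigma (j : ℕ) (h1 : 1 ≤ j) (h2 : j < m) : j ≤ i → LoopFreeProduct i m (sigma j h1 h2)
  | cupCap (j : ℕ) (h1 : 1 ≤ j) (h2 : j < m) : i < j → LoopFreeProduct i m (cupCap j h1 h2)
  | mul (p q : BrauerPartition m m) : LoopFreeProduct i m p → LoopFreeProduct i m q →
      p.loops q = 0 → LoopFreeProduct i m (p.mul q)

theorem LoopFreeProduct.flip {p : BrauerPartition m m} (h : LoopFreeProduct i m p) :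
    LoopFreeProduct i m p.flip := by
  induction h with
  | one => rw [flip_one]; exact .one
  | sigma j h1 h2 hj => rw [flip_sigma]; exact .sigma j h1 h2 hj
  | cupCap j h1 h2 hj => rw [flip_cupCap]; exact .cupCap j h1 h2 hj
  | mul p q _ _ hl ihp ihq =>
    rw [flip_mul]
    exact .mul _ _ ihq ihp (by rw [loops_flip, hl])

theorem LoopFreeProduct.of_mem {k : Type*} [CommRing k] (δ : k) {p : BrauerPartition m m}
    (h : LoopFreeProduct i m p) :
    BrauerAlgebra.of k δ p ∈ BrauerAlgebra.coxeterSubalgebra k δ i m := by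
  induction h with
  | one => exact one_mem (BrauerAlgebra.coxeterSubalgebra k δ i m)
  | sigma j h1 h2 hj => exact Algebra.subset_adjoin (Or.inl ⟨j, h1, h2, hj, rfl⟩)
  | cupCap j h1 h2 hj => exact Algebra.subset_adjoin (Or.inr ⟨j, h1, h2, hj, rfl⟩)
  | mul p q _ _ hl ihp ihq =>
    have := mul_mem ihp ihq
    rwa [BrauerAlgebra.of_mul_of, hl, pow_zero, one_smul] at this

/-- The partition with the matching `f` is a product of generators without closed loops. -/
def IsGenerated (i m : ℕ) (f : ℕ → ℕ) : Prop :=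
  ∃ p : BrauerPartition m m, p.diskInv = f ∧ LoopFreeProduct i m p

theorem IsGenerated.of_reflect {f : ℕ → ℕ} (hf : IsDiskMatching (m + m) f)
    (h : IsGenerated i m (reflect (m + m) f)) : IsGenerated i m f := by
  obtain ⟨p, hp, hw⟩ := h
  exact ⟨p.flip, by rw [diskInv_flip, hp, hf.reflect_reflect], hw.flip⟩

theorem conjSwap_conjSwap (a b : ℕ) (f : ℕ → ℕ) : conjSwap a b (conjSwap a b f) = f := by
  funext x
  simp [conjSwap]

/-- Right multiplication by `σ_j` exchanges two neighbouring positions, and undoes itself. -/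
theorem IsGenerated.of_conjSwap_succ {f : ℕ → ℕ} {P : ℕ} (h1 : m ≤ P) (h2 : P + 1 < m + m)
    (h3 : m + m ≤ P + 1 + i) (h : IsGenerated i m (conjSwap P (P + 1) f)) : IsGenerated i m f := by
  obtain ⟨p, hp, hw⟩ := h
  refine ⟨p.mul (sigma (m + m - 1 - P) (by omega) (by omega)), ?_,
    .mul _ _ hw (.sigma _ _ _ (by omega)) (loops_sigma _ _ _ _)⟩
  rw [diskInv_mul_sigma, show m + m - (m + m - 1 - P) - 1 = P by omega, hp, conjSwap_conjSwap]

theorem joinAt_conjSwap {f : ℕ → ℕ} {N Q : ℕ} (hf : IsDiskMatching N f) (hQ : Q + 2 < N)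
    (h : f (Q + 1) = Q + 2) : joinAt (conjSwap Q (Q + 2) f) (Q + 1) = f := by
  have hI := hf.invol
  have h' : f (Q + 2) = Q + 1 := by rw [← h, hI]
  have hQQ := hf.ne Q (by omega)
  have e1 : ∀ y, f y = Q + 1 → y = Q + 2 := fun y hy => by rw [← hI y, hy, h]
  have e2 : ∀ y, f y = Q + 2 → y = Q + 1 := fun y hy => by rw [← hI y, hy, h']
  have e3 : ∀ y, f y = Q → y = f Q := fun y hy => by rw [← hy, hI]
  have e4 := hI Q
  funext x
  unfold joinAt
  simp only [conjSwap, Equiv.swap_apply_def]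
  grind

/-- When the pair at `Q + 1`, `Q + 2` is moved to `Q`, `Q + 1`, the original matching is recovered
through right multiplication by `U_j`, where `(j + 1)'` and `j'` are the vertices at `Q + 1` and
`Q + 2`. -/
theorem IsGenerated.of_shift {f : ℕ → ℕ} {Q : ℕ} (hf : IsDiskMatching (m + m) f) (h1 : m ≤ Q + 1)
    (h2 : Q + 2 + i < m + m) (h : f (Q + 1) = Q + 2)
    (hg : IsGenerated i m (conjSwap Q (Q + 2) f)) : IsGenerated i m f := by
  obtain ⟨p, hp, hw⟩ := hg
  have hQ := hf.ne Q (by omega)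
  refine ⟨p.mul (cupCap (m + m - 2 - Q) (by omega) (by omega)), ?_,
    .mul _ _ hw (.cupCap _ _ _ (by omega)) (loops_cupCap _ _ _ ?_)⟩
  · rw [diskInv_mul_cupCap, show m + m - (m + m - 2 - Q) - 1 = Q + 1 by omega, hp,
      joinAt_conjSwap hf (by omega) h]
  · rw [show m + m - (m + m - 2 - Q) - 1 = Q + 1 by omega, hp]
    simp [conjSwap, Equiv.swap_apply_def, h]
    omega

end BrauerPartition

/-! ### Reduction of tame matchings to the identity -/

namespace BrauerPartition

variable {i m : ℕ} {f : ℕ → ℕ}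

/-- `f'` is a tame matching obtained from `f` by multiplications at the bottom vertices: these keep
the pairs of top vertices and the set of top vertices joined to bottom vertices, and `f` can be
generated when `f'` can. -/
structure BottomReduces (i m : ℕ) (f f' : ℕ → ℕ) : Prop where
  tame : IsTame i (m + m) f'
  top_eq : ∀ x < m, f x < m → f' x = f x
  le_top : ∀ x < m, m ≤ f x → m ≤ f' x
  generated : IsGenerated i m f' → IsGenerated i m f

theorem BottomReduces.refl (hf : IsTame i (m + m) f) : BottomReduces i m f f :=
  ⟨hf, fun _ _ _ => rfl, fun _ _ h => h, id⟩

theorem BottomReduces.trans {f' f'' : ℕ → ℕ} (h : BottomReduces i m f f')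
    (h' : BottomReduces i m f' f'') : BottomReduces i m f f'' where
  tame := h'.tame
  top_eq x hx hfx := by
    have := h.top_eq x hx hfx
    rw [h'.top_eq x hx (by rwa [this]), this]
  le_top x hx hfx := h'.le_top x hx (h.le_top x hx hfx)
  generated hg := h.generated (h'.generated hg)

theorem BottomReduces.cover_eq {f' : ℕ → ℕ} (h : BottomReduces i m f f') :
    cover f' m = cover f m := by
  unfold cover
  congr 1
  refine Finset.filter_congr fun x hx => ?_
  rw [Finset.mem_range] at hx
  refine ⟨fun h' => ?_, h.le_top x hx⟩
  by_contra hc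
  rw [h.top_eq x hx (not_le.1 hc)] at h'
  exact hc h'

theorem BottomReduces.of_conjSwap {a b : ℕ} (ha : m ≤ a) (hb : m ≤ b)
    (ht : IsTame i (m + m) (conjSwap a b f))
    (hg : IsGenerated i m (conjSwap a b f) → IsGenerated i m f) :
    BottomReduces i m f (conjSwap a b f) where
  tame := ht
  top_eq x hx hfx := by
    unfold conjSwap
    rw [Equiv.swap_apply_of_ne_of_ne (x := x) (by omega) (by omega),
      Equiv.swap_apply_of_ne_of_ne (by omega) (by omega)]
  le_top x hx hfx := by
    unfold conjSwap
    rw [Equiv.swap_apply_of_ne_of_ne (x := x) (by omega) (by omega), Equiv.swap_apply_def]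
    split_ifs <;> assumption
  generated := hg

/-- A pair that opens `i + 2` positions before the end is made short by crossings. -/
theorem exists_bottomReduces_sort {x : ℕ} (hx : x + 2 + i = m + m) (hmx : m ≤ x)
    (n : ℕ) (hf : IsTame i (m + m) f) (h : f x = x + 1 + n) :
    ∃ f', BottomReduces i m f f' ∧ f' x = x + 1 := by
  induction n generalizing f with
  | zero => exact ⟨f, .refl hf, h⟩
  | succ n ih =>
    have hlt := hf.matching.lt x (by omega)
    have ht := hf.conjSwap_succ (P := x + 1 + n) (by omega) (by omega) (by omega) (by omega)
    have hr : BottomReduces i m f (conjSwap (x + 1 + n) (x + 1 + n + 1) f) :=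
      .of_conjSwap (by omega) (by omega) ht
        (IsGenerated.of_conjSwap_succ (by omega) (by omega) (by omega))
    have hfx : conjSwap (x + 1 + n) (x + 1 + n + 1) f x = x + 1 + n := by
      unfold conjSwap
      rw [Equiv.swap_apply_of_ne_of_ne (x := x) (by omega) (by omega), h]
      exact Equiv.swap_apply_right _ _
    obtain ⟨f', h1, h2⟩ := ih ht hfx
    exact ⟨f', hr.trans h1, h2⟩

/-- A short pair at the bottom is moved to the last two bottom vertices. -/
theorem exists_bottomReduces_shift (n : ℕ) (hn : m + n + 2 + i ≤ m + m)
    (hf : IsTame i (m + m) f) (h : f (m + n) = m + n + 1) :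
    ∃ f', BottomReduces i m f f' ∧ f' m = m + 1 := by
  induction n generalizing f with
  | zero => exact ⟨f, .refl hf, h⟩
  | succ n ih =>
    have ht := hf.shift (Q := m + n) (by omega) (by omega) (by omega) h
    have hr : BottomReduces i m f (conjSwap (m + n) (m + n + 2) f) :=
      .of_conjSwap (by omega) (by omega) ht
        (IsGenerated.of_shift hf.matching (by omega) (by omega) h)
    have h' : f (m + n + 2) = m + n + 1 := by
      rw [show m + n + 2 = f (m + n + 1) from h.symm, hf.matching.invol]
    have hfx : conjSwap (m + n) (m + n + 2) f (m + n) = m + n + 1 := by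
      unfold conjSwap
      rw [Equiv.swap_apply_left, h', Equiv.swap_apply_of_ne_of_ne (by omega) (by omega)]
    obtain ⟨f', h1, h2⟩ := ih (by omega) ht hfx
    exact ⟨f', hr.trans h1, h2⟩

/-- If two bottom vertices are paired, bottom multiplications lead to a matching that pairs the last
two bottom vertices: among the pairs of bottom vertices, take the one that opens last. -/
theorem exists_bottomReduces (him : i ≤ m) (hf : IsTame i (m + m) f) (hc : cover f m < m) :
    ∃ f', BottomReduces i m f f' ∧ f' m = m + 1 := by
  have hm := hf.matching
  have hI := hm.invol
  have hex : ((Finset.Ico m (m + m)).filter fun x => x < f x).Nonempty := by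
    by_contra he
    rw [Finset.not_nonempty_iff_eq_empty, Finset.filter_eq_empty_iff] at he
    rw [hm.cover_eq_right (by omega), Finset.filter_true_of_mem, Nat.card_Ico] at hc
    · omega
    intro y hy
    rw [Finset.mem_Ico] at hy
    by_contra h1
    have h2 := hm.lt y hy.2
    have h3 := hm.ne y hy.2
    have h4 := he (Finset.mem_Ico.2 hy)
    have h5 := he (Finset.mem_Ico.2 ⟨not_lt.1 h1, h2⟩)
    rw [hI] at h5
    omega
  obtain ⟨x, hx, hmax⟩ := Finset.exists_max_image _ id hex
  simp only [Finset.mem_filter, Finset.mem_Ico, id] at hx hmax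
  obtain ⟨⟨hmx, hxN⟩, hxf⟩ := hx
  have hfN := hm.lt x hxN
  have hclose : ∀ y, x < y → y < m + m → f y < x + 1 := by
    intro y h1 h2
    by_contra h3
    have h4 := hm.lt y h2
    have h5 := hm.ne y h2
    by_cases h6 : y < f y
    · have := hmax y ⟨⟨by omega, h2⟩, h6⟩
      omega
    · have := hmax (f y) ⟨⟨by omega, h4⟩, by rw [hI]; omega⟩
      omega
  have hcov : cover f (x + 1) = m + m - (x + 1) := by
    rw [hm.cover_eq_right (by omega), Finset.filter_true_of_mem, Nat.card_Ico]
    intro y hy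
    rw [Finset.mem_Ico] at hy
    exact hclose y (by omega) hy.2
  have hxi : x + i < m + m := by
    by_contra h1
    have := hf.last_lt (by omega) (x := x) (by omega) hxN
    omega
  have hcx := cover_succ_of_lt hI hxf
  have hix := hf.le_cover x (by omega) (by omega)
  obtain ⟨g, hg, hgx⟩ : ∃ g, BottomReduces i m f g ∧ g x = x + 1 := by
    by_cases h1 : x + 2 + i = m + m
    · exact exists_bottomReduces_sort h1 hmx (f x - (x + 1)) hf (by omega)
    refine ⟨f, .refl hf, ?_⟩
    -- otherwise the pairs of `x` and `x + 1` cross, and too many pairs cover the place in between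
    by_contra h2
    have h3 := hclose (x + 1) (by omega) (by omega)
    have h4 : f (x + 1) ≠ x := fun h => h2 (by rw [← hI (x + 1), h])
    have h5 := hf.cover_le (f (x + 1)) x (by omega) (by rw [hI]; omega) (by rw [hI]; omega)
    rw [hI] at h5
    omega
  obtain ⟨n, rfl⟩ := Nat.exists_eq_add_of_le hmx
  obtain ⟨f', h1, h2⟩ := exists_bottomReduces_shift n (by omega) hg.tame hgx
  exact ⟨f', hg.trans h1, h2⟩

theorem isGenerated_one : IsGenerated i m fun x => if x < m + m then m + m - 1 - x else x :=
  ⟨one m, diskInv_one m, .one⟩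

/-- The last top vertex that is not joined to the vertex below it, in a matching of top with bottom
vertices, is one of the first `i + 1`: its pair is crossed by that of the bottom vertex below it. -/
theorem le_of_fixed_after (hf : IsTame i (m + m) f) {k : ℕ} (hk : k < m)
    (hbot : ∀ y, m ≤ y → y < m + m → f y < m)
    (hfix : ∀ x, k < x → x < m → f x = m + m - 1 - x) (hlt : m + m - 1 - k < f k) : k ≤ i := by
  have hm := hf.matching
  have hI := hm.invol
  have h1 := hbot (m + m - 1 - k) (by omega) (by omega)
  have h2 : f (m + m - 1 - k) < k := by
    by_contra h3
    rcases eq_or_lt_of_le (not_lt.1 h3) with h4 | h4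
    · have := hI (m + m - 1 - k)
      rw [← h4] at this
      omega
    · have := hfix _ h4 h1
      rw [hI] at this
      omega
  have h3 := hf.cover_le (f (m + m - 1 - k)) k h2 (by rw [hI]; omega) (by rw [hI]; exact hlt)
  rw [hI, hm.cover_eq_right (by omega), Finset.filter_true_of_mem, Nat.card_Ico] at h3
  · omega
  · intro y hy
    rw [Finset.mem_Ico] at hy
    have := hbot y (by omega) hy.2
    omega

/-- A tame matching that pairs top with bottom vertices is a permutation of the first `i + 1`
vertices, and is sorted by crossings: the top vertices are joined to the vertices below them one by
one, from the last to the first. -/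
theorem isGenerated_of_cover_eq (him : i ≤ m) (k : ℕ) (hk : k ≤ m) (hf : IsTame i (m + m) f)
    (hc : cover f m = m) (hfix : ∀ x, k ≤ x → x < m → f x = m + m - 1 - x) :
    IsGenerated i m f := by
  have hends : ∀ {f : ℕ → ℕ}, IsTame i (m + m) f → cover f m = m →
      (∀ x < m, m ≤ f x) ∧ ∀ y, m ≤ y → y < m + m → f y < m := by
    intro f hf hc
    constructor
    · have h := Finset.filter_card_eq (s := Finset.range m) (p := fun x => m ≤ f x)
        (by rw [Finset.card_range]; exact hc)
      exact fun x hx => h x (Finset.mem_range.2 hx)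
    · rw [hf.matching.cover_eq_right (by omega)] at hc
      have h := Finset.filter_card_eq (s := Finset.Ico m (m + m)) (p := fun x => f x < m)
        (by rw [Nat.card_Ico, Nat.add_sub_cancel]; exact hc)
      exact fun y h1 h2 => h y (Finset.mem_Ico.2 ⟨h1, h2⟩)
  induction k generalizing f with
  | zero =>
    have h : f = fun x => if x < m + m then m + m - 1 - x else x := by
      funext x
      split_ifs with hx
      · rcases Nat.lt_or_ge x m with h | h
        · exact hfix x (Nat.zero_le x) h
        · have := hfix (m + m - 1 - x) (Nat.zero_le _) (by omega)
          rw [show m + m - 1 - (m + m - 1 - x) = x by omega] at this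
          rw [← this, hf.matching.invol]
          exact this.symm ▸ rfl
      · exact hf.matching.eq x (not_lt.1 hx)
    rw [h]
    exact isGenerated_one
  | succ k ih =>
    have hle : m + m - 1 - k ≤ f k := by
      by_contra h1
      have h2 := (hends hf hc).1 k (by omega)
      have h3 := hfix (m + m - 1 - f k) (by omega) (by omega)
      rw [show m + m - 1 - (m + m - 1 - f k) = f k by omega] at h3
      have h4 : m + m - 1 - f k = k := by
        have := congrArg f h3
        rwa [hf.matching.invol, hf.matching.invol] at this
      omega
    obtain ⟨n, hn⟩ := Nat.exists_eq_add_of_le hle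
    clear hle
    induction n generalizing f with
    | zero =>
      refine ih (by omega) hf hc fun x h1 h2 => ?_
      rcases eq_or_lt_of_le h1 with rfl | h1
      · omega
      · exact hfix x h1 h2
    | succ n ihn =>
      have hki := le_of_fixed_after hf (k := k) (by omega) (hends hf hc).2 hfix (by omega)
      have hlt := hf.matching.lt k (by omega)
      obtain ⟨P, hP⟩ : ∃ P, f k = P + 1 := ⟨f k - 1, by omega⟩
      have ht := hf.conjSwap_succ (P := P) (by omega) (by omega) (by omega) (by omega)
      refine IsGenerated.of_conjSwap_succ (P := P) (by omega) (by omega) (by omega)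
        (ihn ht ?_ ?_ ?_)
      · rw [cover_conjSwap _ (by omega), hc]
      · intro x h1 h2
        have := hfix x h1 h2
        unfold conjSwap
        rw [Equiv.swap_apply_of_ne_of_ne (x := x) (by omega) (by omega), this,
          Equiv.swap_apply_of_ne_of_ne (by omega) (by omega)]
      · unfold conjSwap
        rw [Equiv.swap_apply_of_ne_of_ne (x := k) (by omega) (by omega), hP,
          Equiv.swap_apply_right]
        omega

/-- Every tame matching is generated. Reducing at the bottom and, after a reflection, at the top,
one reaches a matching that pairs the last two top and the last two bottom vertices; it is obtained
by `U_{m-1}` from a matching with two more pairs between top and bottom vertices. -/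
theorem isGenerated_of_isTame (him : i ≤ m) (hf : IsTame i (m + m) f) : IsGenerated i m f := by
  induction hn : m - cover f m using Nat.strong_induction_on generalizing f with
  | _ n ih =>
  have hle := cover_le_self f m
  rcases eq_or_lt_of_le hle with hc | hc
  · exact isGenerated_of_cover_eq him m le_rfl hf hc fun x h1 h2 => absurd h2 (not_lt.2 h1)
  have hcr : ∀ {f : ℕ → ℕ}, IsTame i (m + m) f → cover (reflect (m + m) f) m = cover f m := by
    intro f hf
    rw [hf.matching.cover_reflect (by omega), Nat.add_sub_cancel]
  obtain ⟨g, hg, hgm⟩ := exists_bottomReduces him hf.reflect (by rwa [hcr hf])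
  have hm2 : m + 1 < m + m := by
    have := hg.tame.matching.lt m (by omega)
    omega
  have hgc : cover (reflect (m + m) g) m = cover f m := by
    rw [hcr hg.tame, hg.cover_eq, hcr hf]
  have htop : reflect (m + m) g (m - 1) = m - 2 := by
    rw [reflect_of_lt (by omega), show m + m - 1 - (m - 1) = m by omega, hgm]
    omega
  obtain ⟨h, hh, hhm⟩ := exists_bottomReduces him hg.tame.reflect (by rwa [hgc])
  have ht := hh.tame
  have hI := ht.matching.invol
  have htop' : h (m - 1) = m - 2 := by rw [hh.top_eq (m - 1) (by omega) (by omega), htop]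
  have hcov1 := cover_succ_of_gt hI (x := m - 1) (by omega)
  have hcov2 := cover_succ_of_lt hI (x := m - 2) (by rw [← htop', hI]; omega)
  rw [show m - 1 + 1 = m by omega] at hcov1
  rw [show m - 2 + 1 = m - 1 by omega] at hcov2
  have hcov3 := cover_le_self h (m - 2)
  have hcov4 := ht.le_cover m him (by omega)
  have hcov5 : cover h m = cover f m := by rw [hh.cover_eq, hgc]
  have hshort : h (m - 1 + 1) = m - 1 + 2 := by
    rw [show m - 1 + 1 = m by omega, hhm]
    omega
  have hlast : h (m - 1 + 2) = m - 1 + 1 := by rw [← hshort, hI]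
  have ht' := ht.shift (Q := m - 1) (by omega) (by omega) (by omega) hshort
  have hnew : conjSwap (m - 1) (m - 1 + 2) h (m - 1) = m - 1 + 1 := by
    unfold conjSwap
    rw [Equiv.swap_apply_left, hlast, Equiv.swap_apply_of_ne_of_ne (by omega) (by omega)]
  have hcov6 := cover_succ_of_lt ht'.matching.invol (x := m - 1) (by omega)
  rw [show m - 1 + 1 = m by omega, cover_conjSwap (g := m - 1) _ (by omega)] at hcov6
  have hgen : IsGenerated i m h :=
    IsGenerated.of_shift ht.matching (by omega) (by omega) hshort
      (ih _ (by omega) ht' rfl)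
  exact IsGenerated.of_reflect hf.matching
    (hg.generated (IsGenerated.of_reflect hg.tame.matching (hh.generated hgen)))

end BrauerPartition

/-! ### The span of the chain partitions -/

namespace BrauerAlgebra

open BrauerPartition

variable {k : Type*} [CommRing k] {i m : ℕ}

theorem linearIndependent_of (δ : k) :
    LinearIndependent k (of k δ : BrauerPartition m m → BrauerAlgebra k δ m) :=
  Finsupp.linearIndependent_single_one k (BrauerPartition m m)

/-- The closed loops contribute a power of `δ`. -/
theorem exists_generatorProduct (δ : k) {x : BrauerAlgebra k δ m}
    (hx : x ∈ Submonoid.closure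
      ({x | ∃ (j : ℕ) (h1 : 1 ≤ j) (h2 : j < m), j ≤ i ∧ x = of k δ (sigma j h1 h2)} ∪
       {x | ∃ (j : ℕ) (h1 : 1 ≤ j) (h2 : j < m), i < j ∧ x = of k δ (cupCap j h1 h2)})) :
    ∃ (c : ℕ) (p : BrauerPartition m m), GeneratorProduct i m p ∧ x = δ ^ c • of k δ p := by
  induction hx using Submonoid.closure_induction_right with
  | one => exact ⟨0, one m, .one, by rw [pow_zero, one_smul, one_def]⟩
  | mul_right x _ y hy ih =>
    obtain ⟨c, p, hp, rfl⟩ := ih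
    rcases hy with ⟨j, h1, h2, hj, rfl⟩ | ⟨j, h1, h2, hj, rfl⟩
    · exact ⟨_, _, .mul_sigma p j h1 h2 hp hj, by
        rw [smul_mul_assoc, of_mul_of, smul_smul, ← pow_add]⟩
    · exact ⟨_, _, .mul_cupCap p j h1 h2 hp hj, by
        rw [smul_mul_assoc, of_mul_of, smul_smul, ← pow_add]⟩

theorem toSubmodule_coxeterSubalgebra (δ : k) (him : i ≤ m) :
    Subalgebra.toSubmodule (coxeterSubalgebra k δ i m) =
      Submodule.span k (of k δ '' chainSet i ((i : ℤ) - 1) m m) := by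
  apply le_antisymm
  · rw [coxeterSubalgebra, Algebra.adjoin_eq_span, Submodule.span_le]
    intro x hx
    obtain ⟨c, p, hp, rfl⟩ := exists_generatorProduct δ hx
    exact Submodule.smul_mem _ _ (Submodule.subset_span ⟨p, hp.mem_chainSet him, rfl⟩)
  · rw [Submodule.span_le]
    rintro _ ⟨p, hp, rfl⟩
    obtain ⟨q, hq, hw⟩ := isGenerated_of_isTame him (isTame_of_mem_chainSet hp)
    rw [← ext_diskInv hq]
    exact hw.of_mem δ

end BrauerAlgebra

theorem mainTheorem1 {k : Type*} [CommRing k] (δ : k) (i m : ℕ) (him : i ≤ m) :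
    Subalgebra.toSubmodule (BrauerAlgebra.coxeterSubalgebra k δ i m) =
        Submodule.span k
          (BrauerAlgebra.of k δ '' BrauerPartition.chainSet i ((i : ℤ) - 1) m m) ∧
      (∃ S : Subalgebra k (BrauerAlgebra k δ m), Subalgebra.toSubmodule S =
        Submodule.span k
          (BrauerAlgebra.of k δ '' BrauerPartition.chainSet i ((i : ℤ) - 1) m m)) ∧
      LinearIndependent k
        (fun p : BrauerPartition.chainSet i ((i : ℤ) - 1) m m => BrauerAlgebra.of k δ p.1) :=
  ⟨BrauerAlgebra.toSubmodule_coxeterSubalgebra δ him,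
    ⟨_, BrauerAlgebra.toSubmodule_coxeterSubalgebra δ him⟩,
    (BrauerAlgebra.linearIndependent_of δ).comp _ Subtype.val_injective⟩
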